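/- Let $V$ be a complex vector space of dimension $2n+2$ ($n\ge 0$) with a symplectic form $\omega$. A Zariski closed subset $X\subset\mathbb P(V)$ (with its reduced structure, possibly reducible) is called *Legendrian* if at every smooth point of its affine cone $\hat X\subset V$ the tangent space to $\hat X$ is Lagrangian, i.e. maximal isotropic for $\omega$. For a hyperplane $H\subset V$ let $h=H^{\perp_\omega}\subset H$, let $\omega'$ be the form on $H/h$ induced by $\omega$, let $\pi:\mathbb P(H)\setminus\{h\}\to\mathbb P(H/h)$ be the projection from $h$, and for $X\subset\mathbb P(V)$ let $\widetilde X_H$ be the image under $\pi$ of $(X\cap\mathbb P(H))\setminus\{h\}$. Write $X\cap H$ for $X\cap \mathbb P(H)$, regarded as a variety with its reduced structure. "For a general hyperplane" means: for all $H$ in some non-empty Zariski open subset of $\mathbb P(V^*)$. The empty set has dimension $-\infty$. Let $X\subset\mathbb P(V)$ be an irreducible Legendrian subvariety. (1) If $X$ is smooth or has only isolated singularities, then for a general hyperplane $H$: $\omega'$ is a symplectic form on $H/h$, which has dimension $2n$ (so that $\mathbb P(H/h)\cong\mathbb P^{2n-1}$); $X\cap H$ is smooth; $h\notin X\cap H$,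 and $\pi$ restricts to an isomorphism of $X\cap H$ onto $\widetilde X_H$; and $\widetilde X_H$ is a Legendrian subvariety of $\mathbb P(H/h)$ with respect to $\omega'$. (2) In general, let $k$ be the dimension of the singular locus of $X$. Then for a general hyperplane $H$: $\omega'$ is a symplectic form on the $2n$-dimensional space $H/h$; $h\notin X\cap H$; $\widetilde X_H$ is a (Zariski closed) Legendrian subvariety of $\mathbb P(H/h)$ with respect to $\omega'$; the singular locus of $\widetilde X_H$ has dimension at most $k-1$ (in particular it is empty if $k\le 0$); and $\pi$ restricts to an isomorphism of the smooth locus of $X\cap H$ onto a Zariski open subset of $\widetilde X_H$. -/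

import Mathlib

open scoped LinearAlgebra.Projectivization Topology

namespace LegendrianSection

/-! ### Zariski topologies -/

section Topology

variable (V : Type*) [AddCommGroup V] [Module ℂ V]

/-- The algebra of polynomial functions on `V`: the functions generated by the linear forms. -/
def polyFun : Subalgebra ℂ (V → ℂ) :=
  Algebra.adjoin ℂ (Set.range fun l : Module.Dual ℂ V => (l : V → ℂ))

/-- The Zariski topology on the vector space `V`. -/
@[reducible] def affineZariski : TopologicalSpace V :=
  TopologicalSpace.generateFrom {U | ∃ f ∈ polyFun V, U = {v | f v ≠ 0}}

variable {V}

/-- `F` is homogeneous of degree `d` (this is used for polynomial maps only). -/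
def IsHomog {W : Type*} [AddCommGroup W] [Module ℂ W] (F : V → W) (d : ℕ) : Prop :=
  ∀ (t : ℂ) (v : V), F (t • v) = t ^ d • F v

variable (V)

/-- The Zariski topology on the projective space `ℙ ℂ V` of lines in `V`, generated by the
non-vanishing loci of homogeneous polynomials. -/
@[reducible] def projZariski : TopologicalSpace (ℙ ℂ V) :=
  TopologicalSpace.generateFrom
    {U | ∃ f ∈ polyFun V, ∃ d : ℕ, IsHomog f d ∧ U = {p : ℙ ℂ V | f p.rep ≠ 0}}

end Topology

/-- The dimension of a subset `S` of a space with topology `t`: the Krull dimension of `S` in the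
induced topology, with values in `{-∞} ∪ ℕ ∪ {∞}`. The empty set has dimension `⊥ = -∞`. -/
noncomputable def dimOf {T : Type*} (t : TopologicalSpace T) (S : Set T) : WithBot ℕ∞ :=
  @topologicalKrullDim S (t.induced Subtype.val)

/-! ### Tangent spaces and smooth points -/

section Tangent

variable {V : Type*} [AddCommGroup V] [Module ℂ V]

/-- Polynomial functions have a linear differential at every point. -/
theorem exists_differential {f : V → ℂ} (hf : f ∈ polyFun V) (v : V) :
    ∃ D : V →ₗ[ℂ] ℂ, ∀ w, HasLineDerivAt ℂ f (D w) v w := by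
  induction hf using Algebra.adjoin_induction with
  | mem f hf =>
    obtain ⟨l, rfl⟩ := hf
    refine ⟨l, fun w => ?_⟩
    have h : HasDerivAt (fun t : ℂ => l v + t * l w) (1 * l w) 0 :=
      ((hasDerivAt_id (0 : ℂ)).mul_const (l w)).const_add (l v)
    simpa [HasLineDerivAt] using h
  | algebraMap c =>
    refine ⟨0, fun w => ?_⟩
    simpa [HasLineDerivAt] using hasDerivAt_const (0 : ℂ) (algebraMap ℂ (V → ℂ) c v)
  | add f g _ _ ihf ihg =>
    obtain ⟨D, hD⟩ := ihf
    obtain ⟨E, hE⟩ := ihg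
    exact ⟨D + E, fun w => HasDerivAt.add (hD w) (hE w)⟩
  | mul f g _ _ ihf ihg =>
    obtain ⟨D, hD⟩ := ihf
    obtain ⟨E, hE⟩ := ihg
    refine ⟨g v • D + f v • E, fun w => ?_⟩
    have h := HasDerivAt.mul (hD w) (hE w)
    simp only [zero_smul, add_zero] at h
    have e : (g v • D + f v • E) w = D w * g v + f v * E w := by
      simp [mul_comm]
    rw [e]
    exact h

/-- The Zariski tangent space at `v` of a subset `Z` of `V` (with its reduced structure): the
vectors killed by the differentials at `v` of all polynomials vanishing on `Z`. -/
noncomputable def tangentSpace (Z : Set V) (v : V) : Submodule ℂ V where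
  carrier := {w | ∀ f ∈ polyFun V, (∀ z ∈ Z, f z = 0) → lineDeriv ℂ f v w = 0}
  zero_mem' := fun f _ _ => lineDeriv_zero
  add_mem' := by
    intro a b ha hb f hf hZ
    obtain ⟨D, hD⟩ := exists_differential hf v
    have h1 := ha f hf hZ
    have h2 := hb f hf hZ
    rw [(hD _).lineDeriv] at h1 h2 ⊢
    rw [map_add, h1, h2, add_zero]
  smul_mem' := by
    intro c a ha f hf hZ
    obtain ⟨D, hD⟩ := exists_differential hf v
    have h1 := ha f hf hZ
    rw [(hD _).lineDeriv] at h1 ⊢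
    rw [map_smul, h1, smul_zero]

/-- The local dimension at `v` of a Zariski closed subset `Z` of `V`: the largest dimension of an
irreducible closed subset of `Z` through `v`. -/
noncomputable def localDim (Z : Set V) (v : V) : WithBot ℕ∞ :=
  ⨆ W ∈ {W : Set V | W ⊆ Z ∧ v ∈ W ∧ IsClosed[affineZariski V] W ∧
    @IsIrreducible V (affineZariski V) W}, dimOf (affineZariski V) W

/-- `v` is a smooth point of the affine variety `Z`: the tangent space of `Z` at `v` has the
dimension of `Z` at `v`. -/
def IsSmoothAt (Z : Set V) (v : V) : Prop :=
  v ∈ Z ∧ (Module.finrank ℂ (tangentSpace Z v) : WithBot ℕ∞) = localDim Z v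

/-- The affine cone over a subset of projective space; it contains the origin. -/
def cone (X : Set (ℙ ℂ V)) : Set V :=
  {v | ∀ hv : v ≠ 0, Projectivization.mk ℂ v hv ∈ X}

/-- The smooth points of a projective variety: those over which the affine cone is smooth away
from the origin. -/
def smoothLocus (X : Set (ℙ ℂ V)) : Set (ℙ ℂ V) :=
  {p | p ∈ X ∧ IsSmoothAt (cone X) p.rep}

/-- The singular points of a projective variety. -/
def singularLocus (X : Set (ℙ ℂ V)) : Set (ℙ ℂ V) :=
  {p | p ∈ X ∧ ¬ IsSmoothAt (cone X) p.rep}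

end Tangent

/-! ### Symplectic forms and Legendrian subvarieties -/

section Symplectic

variable {V : Type*} [AddCommGroup V] [Module ℂ V]

/-- A symplectic form: a non-degenerate alternating bilinear form. -/
structure IsSymplectic (ω : LinearMap.BilinForm ℂ V) : Prop where
  alt : ω.IsAlt
  nondegenerate : ω.Nondegenerate

/-- Lagrangian subspaces: the maximal isotropic ones. -/
def IsLagrangian (ω : LinearMap.BilinForm ℂ V) (L : Submodule ℂ V) : Prop :=
  Maximal (fun M : Submodule ℂ V => ∀ u ∈ M, ∀ w ∈ M, ω u w = 0) L

/-- Legendrian subvarieties of `ℙ ℂ V`, not necessarily irreducible: Zariski closed subsets such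
that the tangent space to the affine cone at each of its smooth points is Lagrangian. -/
structure IsLegendrian (ω : LinearMap.BilinForm ℂ V) (X : Set (ℙ ℂ V)) : Prop where
  isClosed : IsClosed[projZariski V] X
  isLagrangian : ∀ v, IsSmoothAt (cone X) v → IsLagrangian ω (tangentSpace (cone X) v)

end Symplectic

/-! ### Morphisms of quasi-projective varieties -/

section Morphism

variable {V W : Type*} [AddCommGroup V] [Module ℂ V] [AddCommGroup W] [Module ℂ W]

/-- `F` is a polynomial map between vector spaces. -/
def IsPolyMap (F : V → W) : Prop :=
  ∀ l : Module.Dual ℂ W, (fun v => l (F v)) ∈ polyFun V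

/-- A map from a quasi-projective variety `S` to a projective space is a morphism if it is locally
of the form `[v] ↦ [F v]` with `F` a homogeneous polynomial map. -/
def IsMorphism (S : Set (ℙ ℂ V)) (φ : S → ℙ ℂ W) : Prop :=
  ∀ p : S, ∃ O : Set (ℙ ℂ V), IsOpen[projZariski V] O ∧ (p : ℙ ℂ V) ∈ O ∧
    ∃ (F : V → W) (d : ℕ), IsPolyMap F ∧ IsHomog F d ∧
      ∀ q : S, (q : ℙ ℂ V) ∈ O → ∃ hq : F (q : ℙ ℂ V).rep ≠ 0,
        φ q = Projectivization.mk ℂ (F (q : ℙ ℂ V).rep) hq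

/-- The image of `S` under the linear projection `ℙ ℂ V ⇢ ℙ ℂ W` induced by `f`, which is defined
away from the points of `ker f`. -/
def projImage (f : V →ₗ[ℂ] W) (S : Set (ℙ ℂ V)) : Set (ℙ ℂ W) :=
  {q | ∃ p ∈ S, ∃ hp : f p.rep ≠ 0, q = Projectivization.mk ℂ (f p.rep) hp}

/-- The linear projection `ℙ ℂ V ⇢ ℙ ℂ W` induced by `f` is defined on `S` and restricts to an
isomorphism of quasi-projective varieties from `S` onto `T`. -/
def ProjectsIsomorphically (f : V →ₗ[ℂ] W) (S : Set (ℙ ℂ V)) (T : Set (ℙ ℂ W)) : Prop :=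
  ∃ e : S ≃ T,
    (∀ p : S, ∃ hp : f (p : ℙ ℂ V).rep ≠ 0,
      (e p : ℙ ℂ W) = Projectivization.mk ℂ (f (p : ℙ ℂ V).rep) hp) ∧
    IsMorphism S (fun p => (e p : ℙ ℂ W)) ∧ IsMorphism T (fun q => (e.symm q : ℙ ℂ V))

end Morphism

/-! ### Hyperplane sections and their projection -/

section Hyperplane

variable {V : Type*} [AddCommGroup V] [Module ℂ V]

/-- The linear hyperplane of `V` given by a point of the dual projective space. -/
noncomputable def hyperplane (H : ℙ ℂ (Module.Dual ℂ V)) : Submodule ℂ V :=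
  LinearMap.ker H.rep

/-- The subspace `h = H^⊥` of the hyperplane `H`, where `⊥` is taken with respect to `ω`. -/
noncomputable def pole (ω : LinearMap.BilinForm ℂ V) (H : ℙ ℂ (Module.Dual ℂ V)) :
    Submodule ℂ (hyperplane H) :=
  (ω.orthogonal (hyperplane H)).submoduleOf (hyperplane H)

/-- The quotient map `H → H / h`. -/
noncomputable def toQuotient (ω : LinearMap.BilinForm ℂ V) (H : ℙ ℂ (Module.Dual ℂ V)) :
    hyperplane H →ₗ[ℂ] hyperplane H ⧸ pole ω H :=
  (pole ω H).mkQ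

/-- The form on `H / h` induced by an alternating form `ω` on `V`. -/
noncomputable def reducedForm (ω : LinearMap.BilinForm ℂ V) (hω : ω.IsAlt)
    (H : ℙ ℂ (Module.Dual ℂ V)) : LinearMap.BilinForm ℂ (hyperplane H ⧸ pole ω H) :=
  LinearMap.liftQ₂ (pole ω H) (pole ω H) (ω.domRestrict₁₂ (hyperplane H) (hyperplane H))
    (fun x hx => by
      ext y
      exact hω.isRefl _ _ (hx y y.2))
    (fun x hx => by
      ext y
      exact hx y y.2)

theorem reducedForm_toQuotient (ω : LinearMap.BilinForm ℂ V) (hω : ω.IsAlt)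
    (H : ℙ ℂ (Module.Dual ℂ V)) (u w : hyperplane H) :
    reducedForm ω hω H (toQuotient ω H u) (toQuotient ω H w) = ω u w := rfl

/-- The hyperplane section `X ∩ H`, as a subset of the projective space of `H`. -/
noncomputable def hyperplaneSection (X : Set (ℙ ℂ V)) (H : ℙ ℂ (Module.Dual ℂ V)) :
    Set (ℙ ℂ (hyperplane H)) :=
  {p | Projectivization.map (hyperplane H).subtype (hyperplane H).injective_subtype p ∈ X}

/-- The image of `X ∩ H` in `ℙ (H / h)` under the projection from the point `h`. -/
noncomputable def projectedSection (ω : LinearMap.BilinForm ℂ V) (X : Set (ℙ ℂ V))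
    (H : ℙ ℂ (Module.Dual ℂ V)) : Set (ℙ ℂ (hyperplane H ⧸ pole ω H)) :=
  projImage (toQuotient ω H) (hyperplaneSection X H)

/-- A property holds for a general hyperplane of `V` if it holds for all hyperplanes in a non-empty
Zariski open subset of the dual projective space. -/
def ForGeneralHyperplane (P : ℙ ℂ (Module.Dual ℂ V) → Prop) : Prop :=
  ∃ U : Set (ℙ ℂ (Module.Dual ℂ V)), IsOpen[projZariski (Module.Dual ℂ V)] U ∧ U.Nonempty ∧
    ∀ H ∈ U, P H

end Hyperplane

end LegendrianSection

open LegendrianSection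

/-!
The proof works in the affine cone `C` over `X`: an irreducible closed cone of dimension `n + 1` in
the symplectic space `V` of dimension `2 n + 2`, with tangent spaces equal to their orthogonals at
its smooth points. A hyperplane is `H = e^⊥` for a vector `e`, which is also the centre of the
projection. For `n = 0` the section is the origin, and the section of `X` is empty.

A general `e` satisfies three conditions (`exists_poly_isGeneralCenter`), by dimension counts that
rest on generic smoothness (`generic_smoothness`).
* The vector `e` is not a limit of tangent vectors at points of `C` that converge to a point other
  than the origin (`exists_poly_tangentPairs`). The pairs of a smooth point `x` and a tangent vector
  `h` at `x` satisfy `ω x h = 0`; if `h` were to vary freely, then differentiating this equation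
  would give `ω x h' = 0` for all `h'`, and `x = 0`.
* The vector `e` is not a sum of two orthogonal points of `C` (`exists_poly_orthogonal_sum`).
  Consequently `e` is not on `C`, and the projection is injective on the section, since two points
  of the section on a line through the centre are orthogonal.
* The hyperplane avoids finitely many given nonzero vectors. Hence it contains neither `C`, nor a
  component of the section consisting of singular points of `C`, nor a component of the singular
  locus of `X`.

By the principal ideal theorem (`exists_zirred_hypersurface`) the section then has dimension `n` at
each of its points. It is smooth at the points that are smooth on `C`, where `e` is not tangent
to `C` and the tangent space is therefore not contained in `H`. The centre is not tangent to the
section at any of its smooth points: there, tangent vectors extend to polynomial tangent fields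
(`exists_tangent_extension`), so that otherwise `e` would be one of the excluded limits.

The projection of a cone from a point outside it is finite, hence closed
(`LineSplitting.zclosed_image`). If it is injective, Nakayama's lemma gives a local polynomial inverse
wherever the centre is not a tangent direction (`LineSplitting.exists_local_inverse`). So the smooth
locus of the section is mapped isomorphically, and with its tangent spaces, to the projection. At the
images of points that are smooth on `C` the tangent spaces of the projection are isotropic of
dimension `n`; these points are dense and tangent vectors extend, so the projection is Legendrian
(`IsGeneralCenter.isLagrangian_projection`). Its singular points come from singular points of `X` in
`H`, and as `H` contains no component of the singular locus of `X`, the dimension drops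
(`IsGeneralHyperplane.dimOf_singularLocus`).
-/

namespace LegendrianSection

/-! ### Polynomial functions -/

section PolyFun

variable {E F : Type*} [AddCommGroup E] [Module ℂ E] [AddCommGroup F] [Module ℂ F]

theorem dual_mem_polyFun (l : Module.Dual ℂ E) : (l : E → ℂ) ∈ polyFun E :=
  Algebra.subset_adjoin ⟨l, rfl⟩

theorem const_mem_polyFun (c : ℂ) : (fun _ : E => c) ∈ polyFun E :=
  (polyFun E).algebraMap_mem c

theorem sum_mem_polyFun {ι : Type*} (s : Finset ι) {f : ι → E → ℂ}
    (hf : ∀ i ∈ s, f i ∈ polyFun E) : (fun v => ∑ i ∈ s, f i v) ∈ polyFun E := by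
  have := Subalgebra.sum_mem (polyFun E) hf
  convert this using 1
  ext v; simp

theorem mul_mem_polyFun {f g : E → ℂ} (hf : f ∈ polyFun E) (hg : g ∈ polyFun E) :
    (fun v => f v * g v) ∈ polyFun E := Subalgebra.mul_mem _ hf hg

theorem add_mem_polyFun {f g : E → ℂ} (hf : f ∈ polyFun E) (hg : g ∈ polyFun E) :
    (fun v => f v + g v) ∈ polyFun E := Subalgebra.add_mem _ hf hg

theorem sub_mem_polyFun {f g : E → ℂ} (hf : f ∈ polyFun E) (hg : g ∈ polyFun E) :
    (fun v => f v - g v) ∈ polyFun E := Subalgebra.sub_mem _ hf hg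

theorem comp_mem_polyFun {φ : E → F} (hφ : IsPolyMap φ) {f : F → ℂ} (hf : f ∈ polyFun F) :
    (fun v => f (φ v)) ∈ polyFun E := by
  induction hf using Algebra.adjoin_induction with
  | mem f hf => obtain ⟨l, rfl⟩ := hf; exact hφ l
  | algebraMap c => exact const_mem_polyFun c
  | add f g _ _ ihf ihg => exact add_mem_polyFun ihf ihg
  | mul f g _ _ ihf ihg => exact mul_mem_polyFun ihf ihg

theorem isPolyMap_linear (φ : E →ₗ[ℂ] F) : IsPolyMap φ := fun l =>
  dual_mem_polyFun (l.comp φ)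

theorem isPolyMap_id : IsPolyMap (fun v : E => v) := fun l => dual_mem_polyFun l

theorem isPolyMap_const (u : F) : IsPolyMap (fun _ : E => u) := fun l => const_mem_polyFun (l u)

theorem IsPolyMap.add {φ ψ : E → F} (hφ : IsPolyMap φ) (hψ : IsPolyMap ψ) :
    IsPolyMap (fun v => φ v + ψ v) := fun l => by
  simpa using add_mem_polyFun (hφ l) (hψ l)

theorem IsPolyMap.sub {φ ψ : E → F} (hφ : IsPolyMap φ) (hψ : IsPolyMap ψ) :
    IsPolyMap (fun v => φ v - ψ v) := fun l => by
  simpa using sub_mem_polyFun (hφ l) (hψ l)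

theorem IsPolyMap.smul {φ : E → F} {f : E → ℂ} (hf : f ∈ polyFun E) (hφ : IsPolyMap φ) :
    IsPolyMap (fun v => f v • φ v) := fun l => by
  simpa using mul_mem_polyFun hf (hφ l)

theorem IsPolyMap.sum {ι : Type*} (s : Finset ι) {φ : ι → E → F}
    (hφ : ∀ i ∈ s, IsPolyMap (φ i)) : IsPolyMap (fun v => ∑ i ∈ s, φ i v) := fun l => by
  simpa using sum_mem_polyFun s (fun i hi => hφ i hi l)

theorem IsPolyMap.prodMk {G : Type*} [AddCommGroup G] [Module ℂ G] {φ : E → F} {ψ : E → G}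
    (hφ : IsPolyMap φ) (hψ : IsPolyMap ψ) : IsPolyMap (fun v => (φ v, ψ v)) := fun l => by
  have h := add_mem_polyFun (hφ (l.comp (LinearMap.inl ℂ F G)))
    (hψ (l.comp (LinearMap.inr ℂ F G)))
  convert h using 2 with v
  simp [← map_add]

theorem bilin_mem_polyFun (B : LinearMap.BilinForm ℂ F) [FiniteDimensional ℂ F] {φ ψ : E → F}
    (hφ : IsPolyMap φ) (hψ : IsPolyMap ψ) : (fun v => B (φ v) (ψ v)) ∈ polyFun E := by
  let b := Module.finBasis ℂ F
  have h : (fun v => B (φ v) (ψ v)) = fun v => ∑ i, b.coord i (φ v) * B (b i) (ψ v) := by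
    ext v
    conv_lhs => rw [← b.sum_repr (φ v)]
    simp only [map_sum, LinearMap.sum_apply, map_smul, LinearMap.smul_apply, smul_eq_mul,
      Module.Basis.coord_apply]
  rw [h]
  exact sum_mem_polyFun _ fun i _ => mul_mem_polyFun (hφ _) (hψ (B (b i)))

/-! #### Differentials -/

theorem hasLineDerivAt {f : E → ℂ} (hf : f ∈ polyFun E) (v w : E) :
    HasLineDerivAt ℂ f (lineDeriv ℂ f v w) v w := by
  obtain ⟨D, hD⟩ := exists_differential hf v
  rw [(hD w).lineDeriv]; exact hD w

/-- The differential of a polynomial function at a point, as a linear form. -/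
noncomputable def differential {f : E → ℂ} (hf : f ∈ polyFun E) (v : E) : Module.Dual ℂ E :=
  (exists_differential hf v).choose

theorem differential_apply {f : E → ℂ} (hf : f ∈ polyFun E) (v w : E) :
    differential hf v w = lineDeriv ℂ f v w :=
  ((exists_differential hf v).choose_spec w).lineDeriv.symm

theorem lineDeriv_poly_mul {f g : E → ℂ} (hf : f ∈ polyFun E) (hg : g ∈ polyFun E) (v w : E) :
    lineDeriv ℂ (fun x => f x * g x) v w = lineDeriv ℂ f v w * g v + f v * lineDeriv ℂ g v w := by
  have h := HasDerivAt.mul (hasLineDerivAt hf v w) (hasLineDerivAt hg v w)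
  simp only [zero_smul, add_zero] at h
  exact HasLineDerivAt.lineDeriv h

theorem lineDeriv_poly_add {f g : E → ℂ} (hf : f ∈ polyFun E) (hg : g ∈ polyFun E) (v w : E) :
    lineDeriv ℂ (fun x => f x + g x) v w = lineDeriv ℂ f v w + lineDeriv ℂ g v w :=
  HasLineDerivAt.lineDeriv (HasDerivAt.add (hasLineDerivAt hf v w) (hasLineDerivAt hg v w))

theorem lineDeriv_poly_const (c : ℂ) (v w : E) :
    lineDeriv ℂ (fun _ : E => c) v w = 0 :=
  HasLineDerivAt.lineDeriv (hasDerivAt_const (0 : ℂ) c)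

theorem lineDeriv_dual (l : Module.Dual ℂ E) (v w : E) :
    lineDeriv ℂ (l : E → ℂ) v w = l w := by
  have h : HasDerivAt (fun t : ℂ => l v + t * l w) (1 * l w) 0 :=
    ((hasDerivAt_id (0 : ℂ)).mul_const (l w)).const_add (l v)
  refine HasLineDerivAt.lineDeriv ?_
  simpa [HasLineDerivAt] using h

/-- The chain rule along a curve. -/
theorem hasDerivAt_poly_comp {f : E → ℂ} (hf : f ∈ polyFun E) {γ : ℂ → E} {u : E}
    (hγ : ∀ l : Module.Dual ℂ E, HasDerivAt (fun t => l (γ t)) (l u) 0) :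
    HasDerivAt (fun t => f (γ t)) (lineDeriv ℂ f (γ 0) u) 0 := by
  induction hf using Algebra.adjoin_induction with
  | mem f hf => obtain ⟨l, rfl⟩ := hf; rw [lineDeriv_dual]; exact hγ l
  | algebraMap c =>
    have := lineDeriv_poly_const (E := E) c (γ 0) u
    erw [this]
    exact hasDerivAt_const 0 c
  | add f g hf hg ihf ihg =>
    have := lineDeriv_poly_add hf hg (γ 0) u
    erw [this]
    exact ihf.add ihg
  | mul f g hf hg ihf ihg =>
    have := lineDeriv_poly_mul hf hg (γ 0) u
    erw [this]
    exact ihf.mul ihg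

theorem lineDeriv_mem_polyFun {f : E → ℂ} (hf : f ∈ polyFun E) (w : E) :
    (fun v => lineDeriv ℂ f v w) ∈ polyFun E := by
  induction hf using Algebra.adjoin_induction with
  | mem f hf => obtain ⟨l, rfl⟩ := hf; simp_rw [lineDeriv_dual]; exact const_mem_polyFun _
  | algebraMap c =>
    have : (fun v => lineDeriv ℂ (algebraMap ℂ (E → ℂ) c) v w) = fun _ => 0 := by
      ext v; exact lineDeriv_poly_const (E := E) c v w
    rw [this]; exact const_mem_polyFun _
  | add f g hf hg ihf ihg =>
    convert add_mem_polyFun ihf ihg using 2 with v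
    exact lineDeriv_poly_add hf hg v w
  | mul f g hf hg ihf ihg =>
    convert add_mem_polyFun (mul_mem_polyFun ihf hg) (mul_mem_polyFun hf ihg) using 2 with v
    exact lineDeriv_poly_mul hf hg v w

/-- `u` is the derivative at `0` of the curve `t ↦ φ (v + t w)`. -/
def HasPolyDeriv (φ : E → F) (v w : E) (u : F) : Prop :=
  ∀ l : Module.Dual ℂ F, lineDeriv ℂ (fun x => l (φ x)) v w = l u

theorem lineDeriv_comp {φ : E → F} (hφ : IsPolyMap φ) {v w : E} {u : F}
    (hu : HasPolyDeriv φ v w u) {f : F → ℂ} (hf : f ∈ polyFun F) :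
    lineDeriv ℂ (fun x => f (φ x)) v w = lineDeriv ℂ f (φ v) u := by
  have := hasDerivAt_poly_comp hf (γ := fun t => φ (v + t • w)) (u := u) (fun l => by
    rw [← hu l]; exact hasLineDerivAt (hφ l) v w)
  simp only [zero_smul, add_zero] at this
  exact HasLineDerivAt.lineDeriv this

theorem hasPolyDeriv_linear (φ : E →ₗ[ℂ] F) (v w : E) : HasPolyDeriv φ v w (φ w) := fun l =>
  lineDeriv_dual (l.comp φ) v w

theorem HasPolyDeriv.smul {φ : E → F} (hφ : IsPolyMap φ) {f : E → ℂ} (hf : f ∈ polyFun E)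
    {v w : E} {u : F} (hu : HasPolyDeriv φ v w u) :
    HasPolyDeriv (fun x => f x • φ x) v w (lineDeriv ℂ f v w • φ v + f v • u) := fun l => by
  simp only [map_smul, smul_eq_mul, map_add]
  rw [lineDeriv_poly_mul hf (hφ l), hu l]

theorem HasPolyDeriv.add {φ ψ : E → F} (hφ : IsPolyMap φ) (hψ : IsPolyMap ψ)
    {v w : E} {u u' : F} (hu : HasPolyDeriv φ v w u) (hu' : HasPolyDeriv ψ v w u') :
    HasPolyDeriv (fun x => φ x + ψ x) v w (u + u') := fun l => by
  simp only [map_add]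
  rw [lineDeriv_poly_add (hφ l) (hψ l), hu l, hu' l]

theorem tangentSpace_mono {Z Z' : Set E} (h : Z ⊆ Z') (v : E) :
    tangentSpace Z v ≤ tangentSpace Z' v := fun _ hw f hf hZ =>
  hw f hf fun z hz => hZ z (h hz)

/-- Polynomial maps between sets map tangent vectors to tangent vectors. -/
theorem mem_tangentSpace_of_mapsTo {φ : E → F} (hφ : IsPolyMap φ) {Z : Set E} {Z' : Set F}
    (hZ : ∀ z ∈ Z, φ z ∈ Z') {v w : E} {u : F} (hu : HasPolyDeriv φ v w u)
    (hw : w ∈ tangentSpace Z v) : u ∈ tangentSpace Z' (φ v) := fun f hf hf0 => by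
  rw [← lineDeriv_comp hφ hu hf]
  exact hw _ (comp_mem_polyFun hφ hf) fun z hz => hf0 _ (hZ z hz)

theorem mem_tangentSpace_of_mapsTo_linear (φ : E →ₗ[ℂ] F) {Z : Set E} {Z' : Set F}
    (hZ : ∀ z ∈ Z, φ z ∈ Z') {v w : E} (hw : w ∈ tangentSpace Z v) :
    φ w ∈ tangentSpace Z' (φ v) :=
  mem_tangentSpace_of_mapsTo (isPolyMap_linear φ) hZ (hasPolyDeriv_linear φ v w) hw

end PolyFun

/-! ### Zariski closed and irreducible sets in terms of polynomials -/

section Zariski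

variable {E F : Type*} [AddCommGroup E] [Module ℂ E] [AddCommGroup F] [Module ℂ F]

/-- The function `f` vanishes on the set `Z`. -/
def VanishesOn (f : E → ℂ) (Z : Set E) : Prop := ∀ z ∈ Z, f z = 0

/-- The Zariski closure of a set: the common zeros of the polynomials that vanish on it. -/
def zariskiClosure (Z : Set E) : Set E := {v | ∀ f ∈ polyFun E, VanishesOn f Z → f v = 0}

/-- Zariski closed sets, as the sets of common zeros of polynomials. -/
def ZClosed (Z : Set E) : Prop := ∀ v ∈ zariskiClosure Z, v ∈ Z

/-- Irreducible sets, not necessarily closed: the polynomials vanishing on them form a prime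
ideal. -/
def ZIrred (Z : Set E) : Prop := Z.Nonempty ∧ ∀ f ∈ polyFun E, ∀ g ∈ polyFun E,
  VanishesOn (fun v => f v * g v) Z → VanishesOn f Z ∨ VanishesOn g Z

theorem subset_zariskiClosure (Z : Set E) : Z ⊆ zariskiClosure Z := fun _ hz _ _ h => h _ hz

theorem vanishesOn_zariskiClosure {f : E → ℂ} (hf : f ∈ polyFun E) {Z : Set E} :
    VanishesOn f (zariskiClosure Z) ↔ VanishesOn f Z :=
  ⟨fun h z hz => h z (subset_zariskiClosure Z hz), fun h _ hz => hz f hf h⟩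

theorem zclosed_zariskiClosure (Z : Set E) : ZClosed (zariskiClosure Z) := fun _ hv f hf h =>
  hv f hf ((vanishesOn_zariskiClosure hf).2 h)

theorem ZIrred.zariskiClosure {Z : Set E} (hZ : ZIrred Z) : ZIrred (zariskiClosure Z) := by
  refine ⟨hZ.1.mono (subset_zariskiClosure Z), fun f hf g hg h => ?_⟩
  rw [vanishesOn_zariskiClosure (mul_mem_polyFun hf hg)] at h
  rw [vanishesOn_zariskiClosure hf, vanishesOn_zariskiClosure hg]
  exact hZ.2 f hf g hg h

theorem ZClosed.zariskiClosure_subset {Z Z' : Set E} (hZ' : ZClosed Z') (h : Z ⊆ Z') :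
    zariskiClosure Z ⊆ Z' := fun v hv =>
  hZ' v fun f hf hf' => hv f hf fun z hz => hf' z (h hz)

theorem ZClosed.exists_of_notMem {Z : Set E} (hZ : ZClosed Z) {v : E} (hv : v ∉ Z) :
    ∃ f ∈ polyFun E, VanishesOn f Z ∧ f v ≠ 0 := by
  by_contra! h
  exact hv (hZ v fun f hf hf' => h f hf hf')

theorem zclosed_zero {f : E → ℂ} (hf : f ∈ polyFun E) : ZClosed {v | f v = 0} := fun _ hv =>
  hv f hf fun _ hz => hz

theorem ZClosed.inter {Z Z' : Set E} (hZ : ZClosed Z) (hZ' : ZClosed Z') : ZClosed (Z ∩ Z') :=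
  fun v hv => ⟨hZ v fun f hf h => hv f hf fun _ hz => h _ hz.1,
    hZ' v fun f hf h => hv f hf fun _ hz => h _ hz.2⟩

theorem ZClosed.union {Z Z' : Set E} (hZ : ZClosed Z) (hZ' : ZClosed Z') : ZClosed (Z ∪ Z') := by
  intro v hv
  by_contra hn
  rw [Set.mem_union, not_or] at hn
  obtain ⟨f, hf, hfZ, hfv⟩ := hZ.exists_of_notMem hn.1
  obtain ⟨g, hg, hgZ, hgv⟩ := hZ'.exists_of_notMem hn.2
  refine mul_ne_zero hfv hgv (hv _ (mul_mem_polyFun hf hg) fun z hz => ?_)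
  rcases hz with hz | hz
  · simp [hfZ z hz]
  · simp [hgZ z hz]

theorem ZClosed.preimage {φ : E → F} (hφ : IsPolyMap φ) {Z : Set F} (hZ : ZClosed Z) :
    ZClosed (φ ⁻¹' Z) := fun v hv => hZ _ fun f hf h =>
  hv _ (comp_mem_polyFun hφ hf) fun z hz => h _ hz

theorem zclosed_empty : ZClosed (∅ : Set E) := fun v hv => by
  have := hv _ (const_mem_polyFun 1) (fun _ h => h.elim)
  simp at this

theorem zclosed_singleton [FiniteDimensional ℂ E] (v : E) : ZClosed ({v} : Set E) := fun w hw => by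
  rw [Set.mem_singleton_iff, ← sub_eq_zero, ← Module.forall_dual_apply_eq_zero_iff ℂ]
  intro l
  have := hw _ (sub_mem_polyFun (dual_mem_polyFun l) (const_mem_polyFun (l v)))
    (by rintro z rfl; simp)
  simpa using this

theorem ZIrred.image {φ : E → F} (hφ : IsPolyMap φ) {Z : Set E} (hZ : ZIrred Z) :
    ZIrred (φ '' Z) := by
  refine ⟨hZ.1.image φ, fun f hf g hg h => ?_⟩
  refine (hZ.2 _ (comp_mem_polyFun hφ hf) _ (comp_mem_polyFun hφ hg) fun z hz =>
    h _ ⟨z, hz, rfl⟩).imp ?_ ?_ <;> rintro h _ ⟨z, hz, rfl⟩ <;> exact h z hz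

/-- Two polynomials that do not vanish on an irreducible set are both non-zero at some point of it. -/
theorem ZIrred.exists_ne_zero {Z : Set E} (hZ : ZIrred Z) {f g : E → ℂ} (hf : f ∈ polyFun E)
    (hg : g ∈ polyFun E) (hf0 : ∃ z ∈ Z, f z ≠ 0) (hg0 : ∃ z ∈ Z, g z ≠ 0) :
    ∃ z ∈ Z, f z ≠ 0 ∧ g z ≠ 0 := by
  by_contra! h
  rcases hZ.2 f hf g hg fun z hz => by
    by_cases hfz : f z = 0
    · simp [hfz]
    · simp [h z hz hfz] with h | h
  · obtain ⟨z, hz, hne⟩ := hf0; exact hne (h z hz)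
  · obtain ⟨z, hz, hne⟩ := hg0; exact hne (h z hz)

theorem ZIrred.subset_or_subset {Z A B : Set E} (hZ : ZIrred Z) (hA : ZClosed A) (hB : ZClosed B)
    (h : Z ⊆ A ∪ B) : Z ⊆ A ∨ Z ⊆ B := by
  by_contra! hn
  obtain ⟨⟨a, haZ, ha⟩, ⟨b, hbZ, hb⟩⟩ := And.imp Set.not_subset.1 Set.not_subset.1 hn
  obtain ⟨f, hf, hfA, hfa⟩ := hA.exists_of_notMem ha
  obtain ⟨g, hg, hgB, hgb⟩ := hB.exists_of_notMem hb
  obtain ⟨z, hz, hfz, hgz⟩ := hZ.exists_ne_zero hf hg ⟨a, haZ, hfa⟩ ⟨b, hbZ, hgb⟩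
  rcases h hz with h | h
  · exact hfz (hfA z h)
  · exact hgz (hgB z h)

theorem zirred_of_subset_or_subset {Z : Set E} (hne : Z.Nonempty)
    (h : ∀ A B : Set E, ZClosed A → ZClosed B → Z ⊆ A ∪ B → Z ⊆ A ∨ Z ⊆ B) : ZIrred Z := by
  refine ⟨hne, fun f hf g hg hfg => ?_⟩
  exact h _ _ (zclosed_zero hf) (zclosed_zero hg) fun z hz => mul_eq_zero.1 (hfg z hz)

theorem ZIrred.exists_subset_of_finite {Z : Set E} (hZ : ZIrred Z) {S : Set (Set E)}
    (hS : S.Finite) (hc : ∀ A ∈ S, ZClosed A) (h : Z ⊆ ⋃₀ S) : ∃ A ∈ S, Z ⊆ A := by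
  induction S, hS using Set.Finite.induction_on generalizing Z with
  | empty => simp only [Set.sUnion_empty] at h; exact absurd (hZ.1.mono h) (by simp)
  | @insert a s ha hs ih =>
    rw [Set.sUnion_insert] at h
    have hcl : ZClosed (⋃₀ s) := by
      clear ih h ha
      induction s, hs using Set.Finite.induction_on with
      | empty => simpa using zclosed_empty
      | @insert b t _ _ ih =>
        rw [Set.sUnion_insert]
        exact (hc b (by simp)).union (ih fun A hA => hc A (by
          rcases hA with rfl | hA
          · simp
          · simp [hA]))
    rcases hZ.subset_or_subset (hc a (by simp)) hcl h with h | h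
    · exact ⟨a, by simp, h⟩
    · obtain ⟨A, hA, hZA⟩ := ih hZ (fun A hA => hc A (by simp [hA])) h
      exact ⟨A, by simp [hA], hZA⟩

/-! ### Comparison with the topologies -/

theorem isTopologicalBasis_affineZariski :
    @TopologicalSpace.IsTopologicalBasis E (affineZariski E)
      {U | ∃ f ∈ polyFun E, U = {v | f v ≠ 0}} := by
  let _ := affineZariski E
  refine ⟨?_, ?_, rfl⟩
  · rintro _ ⟨f, hf, rfl⟩ _ ⟨g, hg, rfl⟩ v hv
    refine ⟨_, ⟨_, mul_mem_polyFun hf hg, rfl⟩, mul_ne_zero hv.1 hv.2, fun w hw => ?_⟩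
    exact ⟨left_ne_zero_of_mul hw, right_ne_zero_of_mul hw⟩
  · refine Set.eq_univ_of_forall fun v => ⟨_, ⟨_, const_mem_polyFun 1, rfl⟩, ?_⟩
    simp

theorem isClosed_iff_zclosed {Z : Set E} : IsClosed[affineZariski E] Z ↔ ZClosed Z := by
  let _ := affineZariski E
  rw [← isOpen_compl_iff, isTopologicalBasis_affineZariski.isOpen_iff]
  constructor
  · intro h v hv
    by_contra hn
    obtain ⟨_, ⟨f, hf, rfl⟩, hfv, hsub⟩ := h v hn
    exact hfv (hv f hf fun z hz => by
      by_contra hfz; exact hsub hfz hz)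
  · intro h v hv
    obtain ⟨f, hf, hfZ, hfv⟩ := h.exists_of_notMem hv
    exact ⟨_, ⟨f, hf, rfl⟩, hfv, fun w hw hwZ => hw (hfZ w hwZ)⟩

theorem isIrreducible_iff_zirred {Z : Set E} :
    @IsIrreducible E (affineZariski E) Z ↔ ZIrred Z := by
  let _ := affineZariski E
  constructor
  · rintro ⟨hne, h⟩
    refine zirred_of_subset_or_subset hne fun A B hA hB hAB => ?_
    exact isPreirreducible_iff_isClosed_union_isClosed.1 h A B (isClosed_iff_zclosed.2 hA)
      (isClosed_iff_zclosed.2 hB) hAB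
  · intro h
    refine ⟨h.1, isPreirreducible_iff_isClosed_union_isClosed.2 fun A B hA hB hAB => ?_⟩
    exact h.subset_or_subset (isClosed_iff_zclosed.1 hA) (isClosed_iff_zclosed.1 hB) hAB

/-- The ideal of the polynomials vanishing on a set. -/
def vanIdeal (Z : Set E) : Ideal (polyFun E) where
  carrier := {f | VanishesOn f.1 Z}
  zero_mem' := fun _ _ => rfl
  add_mem' := fun {f g} hf hg z hz => by
    have h1 := hf z hz
    have h2 := hg z hz
    simp [h1, h2]
  smul_mem' := fun c f hf z hz => by
    have h1 := hf z hz
    simp [h1]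

theorem mem_vanIdeal {Z : Set E} {f : polyFun E} : f ∈ vanIdeal Z ↔ VanishesOn f.1 Z := Iff.rfl

theorem isPrime_vanIdeal {Z : Set E} (hZ : ZIrred Z) : (vanIdeal Z).IsPrime := by
  refine ⟨fun h => ?_, fun {f g} h => ?_⟩
  · obtain ⟨z, hz⟩ := hZ.1
    have : (1 : polyFun E) ∈ vanIdeal Z := h ▸ trivial
    simpa using this z hz
  · exact hZ.2 f.1 f.2 g.1 g.2 h

/-- The zero set of an ideal. -/
def zeroSet (I : Ideal (polyFun E)) : Set E := {v | ∀ f ∈ I, f.1 v = 0}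

theorem zclosed_zeroSet (I : Ideal (polyFun E)) : ZClosed (zeroSet I) := fun _ hv f hf =>
  hv f.1 f.2 fun _ hz => hz f hf

variable [FiniteDimensional ℂ E]

theorem polyFun_eq_adjoin_basis {ι : Type*} [Finite ι] (b : Module.Basis ι ℂ (Module.Dual ℂ E)) :
    polyFun E = Algebra.adjoin ℂ (Set.range fun i => (b i : E → ℂ)) := by
  have := Fintype.ofFinite ι
  refine le_antisymm (Algebra.adjoin_le ?_) (Algebra.adjoin_le ?_)
  · rintro _ ⟨l, rfl⟩
    have h : (l : E → ℂ) = ∑ i, b.repr l i • (b i : E → ℂ) := by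
      conv_lhs => rw [← b.sum_repr l]
      ext v; simp only [LinearMap.sum_apply, LinearMap.smul_apply, Finset.sum_apply, Pi.smul_apply]
    simp only [SetLike.mem_coe]
    rw [h]
    refine Subalgebra.sum_mem _ fun i _ => Subalgebra.smul_mem _ ?_ _
    exact Algebra.subset_adjoin (Set.mem_range_self i)
  · rintro _ ⟨i, rfl⟩
    exact dual_mem_polyFun _

instance finiteType_polyFun : Algebra.FiniteType ℂ (polyFun E) := by
  rw [polyFun_eq_adjoin_basis (Module.finBasis ℂ (Module.Dual ℂ E)), ← Subalgebra.fg_iff_finiteType]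
  exact Subalgebra.fg_def.2 ⟨_, Set.finite_range _, rfl⟩

instance isNoetherianRing_polyFun : IsNoetherianRing (polyFun E) :=
  Algebra.FiniteType.isNoetherianRing ℂ _

theorem noetherianSpace_affineZariski : @TopologicalSpace.NoetherianSpace E (affineZariski E) := by
  let _ := affineZariski E
  rw [((TopologicalSpace.noetherianSpace_TFAE E).out 0 1 :)]
  refine ⟨(InvImage.wf (fun Z : TopologicalSpace.Closeds E => vanIdeal (Z : Set E))
    (wellFounded_gt (α := Ideal (polyFun E)))).mono ?_⟩
  intro A B hAB
  refine lt_of_le_of_ne (fun f hf z hz => hf z (hAB.le hz)) fun heq => hAB.not_ge fun z hz => ?_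
  refine isClosed_iff_zclosed.1 A.2 z fun f hf hfA => ?_
  have : (⟨f, hf⟩ : polyFun E) ∈ vanIdeal (B : Set E) := by
      rw [show vanIdeal (B : Set E) = vanIdeal (A : Set E) from heq]; exact hfA
  exact this z hz

/-- Every set is a finite union of irreducible subsets. -/
theorem exists_finite_zirred (Z : Set E) : ∃ S : Set (Set E), S.Finite ∧
    (∀ A ∈ S, ZIrred A ∧ A ⊆ Z) ∧ Z = ⋃₀ S := by
  let _ := affineZariski E
  have := noetherianSpace_affineZariski (E := E)
  have : TopologicalSpace.NoetherianSpace Z := Topology.IsInducing.subtypeVal.noetherianSpace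
  refine ⟨(Subtype.val '' ·) '' irreducibleComponents Z,
    TopologicalSpace.NoetherianSpace.finite_irreducibleComponents.image _, ?_, ?_⟩
  · rintro _ ⟨A, hA, rfl⟩
    exact ⟨isIrreducible_iff_zirred.1 (hA.1.image _ continuous_subtype_val.continuousOn),
      by rintro _ ⟨z, _, rfl⟩; exact z.2⟩
  · refine Set.Subset.antisymm (fun z hz => ?_) ?_
    · exact ⟨_, ⟨irreducibleComponent (⟨z, hz⟩ : Z), irreducibleComponent_mem_irreducibleComponents _,
        rfl⟩, ⟨z, hz⟩, mem_irreducibleComponent, rfl⟩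
    · rintro _ ⟨_, ⟨A, hA, rfl⟩, ⟨z, _, rfl⟩⟩
      exact z.2

/-- Every point of a closed set lies in an irreducible closed subset from a finite list. -/
theorem ZClosed.exists_finite_zirred {Z : Set E} (hZ : ZClosed Z) : ∃ S : Set (Set E), S.Finite ∧
    (∀ A ∈ S, ZIrred A ∧ ZClosed A ∧ A ⊆ Z) ∧ Z = ⋃₀ S := by
  obtain ⟨S, hS, hA, hU⟩ := LegendrianSection.exists_finite_zirred Z
  refine ⟨zariskiClosure '' S, hS.image _, ?_, Set.Subset.antisymm ?_ ?_⟩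
  · rintro _ ⟨A, hAS, rfl⟩
    exact ⟨(hA A hAS).1.zariskiClosure, zclosed_zariskiClosure A,
      hZ.zariskiClosure_subset (hA A hAS).2⟩
  · intro z hz
    rw [hU] at hz
    obtain ⟨A, hAS, hzA⟩ := hz
    exact ⟨_, ⟨A, hAS, rfl⟩, subset_zariskiClosure A hzA⟩
  · rintro z ⟨_, ⟨A, hAS, rfl⟩, hz⟩
    exact hZ.zariskiClosure_subset (hA A hAS).2 hz

/-- The Nullstellensatz for points: a maximal ideal consists of the polynomials vanishing at a
point. -/
theorem exists_point_of_isMaximal (M : Ideal (polyFun E)) [hM : M.IsMaximal] :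
    ∃ v : E, M = vanIdeal {v} := by
  let _ : Field (polyFun E ⧸ M) := Ideal.Quotient.field M
  have : Algebra.FiniteType ℂ (polyFun E ⧸ M) :=
    Algebra.FiniteType.of_surjective (Ideal.Quotient.mkₐ ℂ M) (Ideal.Quotient.mkₐ_surjective ℂ M)
  have : Module.Finite ℂ (polyFun E ⧸ M) := finite_of_finite_type_of_isJacobsonRing ℂ _
  have hint : Algebra.IsIntegral ℂ (polyFun E ⧸ M) := Algebra.IsIntegral.of_finite ℂ _
  have hb : Function.Bijective (algebraMap ℂ (polyFun E ⧸ M)) :=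
    IsAlgClosed.algebraMap_bijective_of_isIntegral
  let e : (polyFun E ⧸ M) ≃ₐ[ℂ] ℂ := (AlgEquiv.ofBijective (Algebra.ofId ℂ _) hb).symm
  let ε : polyFun E →ₐ[ℂ] ℂ := e.toAlgHom.comp (Ideal.Quotient.mkₐ ℂ M)
  have hε : ∀ f, ε f = 0 ↔ f ∈ M := fun f => by
    rw [← Ideal.Quotient.eq_zero_iff_mem]
    exact map_eq_zero_iff e e.injective
  let lin : Module.Dual ℂ E →ₗ[ℂ] ℂ :=
    { toFun := fun l => ε ⟨l, dual_mem_polyFun l⟩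
      map_add' := fun l m => by rw [← map_add]; rfl
      map_smul' := fun c l => by rw [RingHom.id_apply, ← map_smul]; rfl }
  obtain ⟨v, hv⟩ := (Module.evalEquiv ℂ E).surjective lin
  have key : ∀ f : polyFun E, ε f = f.1 v := by
    rintro ⟨f, hf⟩
    induction hf using Algebra.adjoin_induction with
    | mem f hf =>
      obtain ⟨l, rfl⟩ := hf
      have := congrArg (fun m => m l) hv
      exact this.symm
    | algebraMap c => exact ε.commutes c
    | add f g hf hg ihf ihg =>
      have : (⟨f + g, add_mem hf hg⟩ : polyFun E) = ⟨f, hf⟩ + ⟨g, hg⟩ := rfl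
      erw [this, map_add, ihf, ihg]; rfl
    | mul f g hf hg ihf ihg =>
      have : (⟨f * g, mul_mem hf hg⟩ : polyFun E) = ⟨f, hf⟩ * ⟨g, hg⟩ := rfl
      erw [this, map_mul, ihf, ihg]; rfl
  refine ⟨v, Ideal.ext fun f => ?_⟩
  rw [← hε, key, mem_vanIdeal]
  exact ⟨fun h z hz => by rw [hz]; exact h, fun h => h v rfl⟩

/-- The Nullstellensatz for prime ideals. -/
theorem vanIdeal_zeroSet (P : Ideal (polyFun E)) [hP : P.IsPrime] : vanIdeal (zeroSet P) = P := by
  refine le_antisymm (fun f hf => ?_) fun f hf z hz => hz f hf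
  have hR : IsJacobsonRing (polyFun E) := isJacobsonRing_of_finiteType (A := ℂ)
  have hJ := IsJacobsonRing.out hR hP.isRadical
  rw [← hJ, Ideal.jacobson, Ideal.mem_sInf]
  rintro M ⟨hPM, hM⟩
  obtain ⟨v, rfl⟩ := exists_point_of_isMaximal M
  rintro z rfl
  exact hf z fun g hg => hPM hg z rfl

theorem zirred_zeroSet (P : Ideal (polyFun E)) [hP : P.IsPrime] : ZIrred (zeroSet P) := by
  have h := vanIdeal_zeroSet P
  refine ⟨?_, fun f hf g hg hfg => ?_⟩
  · by_contra hn
    rw [Set.not_nonempty_iff_eq_empty] at hn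
    refine hP.ne_top ((Ideal.eq_top_iff_one _).2 ?_)
    rw [← h, mem_vanIdeal, hn]
    exact fun _ h => h.elim
  · have : (⟨f, hf⟩ * ⟨g, hg⟩ : polyFun E) ∈ P := by rw [← h]; exact hfg
    refine (hP.mem_or_mem this).imp ?_ ?_ <;> (intro h'; rw [← h] at h'; exact h')

end Zariski

/-! ### Transcendence degree of affine domains -/

section Trdeg

universe u

variable {k : Type*} [Field k]

/-- A proper quotient of an affine domain that is again a domain has smaller transcendence
degree. -/
theorem trdeg_lt_of_surjective {A B : Type u} [CommRing A] [CommRing B] [IsDomain A] [IsDomain B]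
    [Algebra k A] [Algebra k B] [Algebra.FiniteType k A] (f : A →ₐ[k] B)
    (hf : Function.Surjective f) (hn : ¬ Function.Injective f) :
    (Algebra.trdeg k B).toNat < (Algebra.trdeg k A).toNat := by
  have : Algebra.FiniteType k B := Algebra.FiniteType.of_surjective f hf
  have hA := trdeg_lt_aleph0_of_finiteType (R := k) (S := A)
  have hB := trdeg_lt_aleph0_of_finiteType (R := k) (S := B)
  obtain ⟨s, hs⟩ := exists_isTranscendenceBasis k B
  have hcard := hs.cardinalMk_eq_trdeg
  have : Finite s := Cardinal.lt_aleph0_iff_finite.1 (hcard ▸ hB)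
  choose x hx using fun b : s => hf b
  have hfx : (f ∘ x) = ((↑) : s → B) := funext hx
  have hxi : AlgebraicIndependent k x := AlgebraicIndependent.of_comp f (hfx ▸ hs.1)
  by_contra hle
  rw [not_lt] at hle
  have hb : IsTranscendenceBasis k x := by
    refine hxi.isTranscendenceBasis_of_lift_trdeg_le_of_finite ?_
    rw [Cardinal.lift_le, hcard]
    exact (Cardinal.toNat_le_iff_le_of_lt_aleph0 hA hB).1 hle
  have := hb.isAlgebraic
  rw [injective_iff_map_eq_zero] at hn
  push Not at hn
  obtain ⟨a, ha, ha0⟩ := hn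
  have hker : a ∈ RingHom.ker f := ha
  obtain ⟨r, hr, hr0⟩ := Submodule.exists_mem_ne_zero_of_ne_bot
    (Ideal.comap_ne_bot_of_algebraic_mem (R := Algebra.adjoin k (Set.range x)) ha0 hker
      (this.isAlgebraic a))
  obtain ⟨r, hr'⟩ := r
  rw [Algebra.adjoin_range_eq_range_aeval] at hr'
  obtain ⟨q, rfl⟩ := hr'
  have h0 : f (MvPolynomial.aeval x q) = 0 := hr
  rw [← AlgHom.comp_apply, MvPolynomial.comp_aeval] at h0
  have hq : q = 0 := by
    have hi := hs.1
    rw [← hfx] at hi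
    exact hi.eq_zero_of_aeval_eq_zero q h0
  exact hr0 (Subtype.ext (by simp [hq]))

/-- Modulo a non-constant prime polynomial, all variables but one remain algebraically
independent. -/
theorem eq_zero_of_rename_mem_span {σ : Type*} {g : MvPolynomial σ k} {j : σ} (hj : j ∈ g.vars)
    {p : MvPolynomial {i // i ≠ j} k}
    (hp : MvPolynomial.rename Subtype.val p ∈ Ideal.span {g}) : p = 0 := by
  rw [Ideal.mem_span_singleton] at hp
  obtain ⟨c, hc⟩ := hp
  by_contra hp0
  have hr0 : MvPolynomial.rename (Subtype.val : {i // i ≠ j} → σ) p ≠ 0 := fun h =>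
    hp0 (MvPolynomial.rename_injective _ Subtype.val_injective (by simpa using h))
  have hg0 : g ≠ 0 := by rintro rfl; simp at hc; exact hr0 (by simpa using hc)
  have hc0 : c ≠ 0 := by rintro rfl; simp at hc; exact hr0 (by simpa using hc)
  have h2 : (MvPolynomial.rename (Subtype.val : {i // i ≠ j} → σ) p).degreeOf j = 0 := by
    by_contra h
    rw [← ne_eq, ← MvPolynomial.mem_vars_iff_degreeOf_ne_zero] at h
    obtain ⟨i, _, hi⟩ := MvPolynomial.mem_vars_rename _ _ h
    exact i.2 hi
  rw [hc, MvPolynomial.degreeOf_mul_eq hg0 hc0] at h2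
  rw [MvPolynomial.mem_vars_iff_degreeOf_ne_zero] at hj
  omega

/-- Cutting an affine domain by one equation lowers the transcendence degree by at most one. -/
theorem trdeg_le_trdeg_quotient_add_one {A : Type*} [CommRing A] [IsDomain A] [Algebra k A]
    [Algebra.FiniteType k A] {f : A} {P : Ideal A} (hP : P ∈ (Ideal.span {f}).minimalPrimes) :
    (Algebra.trdeg k A).toNat ≤ (Algebra.trdeg k (A ⧸ P)).toNat + 1 := by
  have hPp : P.IsPrime := hP.isPrime
  have : IsNoetherianRing A := Algebra.FiniteType.isNoetherianRing k A
  have hht : P.height ≤ 1 :=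
    Ideal.height_le_one_of_isPrincipal_of_mem_minimalPrimes (Ideal.span {f}) P hP
  obtain ⟨s, φ, hφi, hφ⟩ := exists_integral_inj_algHom_of_fg k A
  let B := MvPolynomial (Fin s) k
  algebraize [φ.toRingHom]
  have : FaithfulSMul B A := (faithfulSMul_iff_algebraMap_injective B A).2 hφi
  have : Algebra.IsIntegral B A := ⟨hφ⟩
  have htA : Algebra.trdeg k A = s := by
    have h := lift_trdeg_add_eq k B A
    rw [trdeg_eq_zero (R := B), MvPolynomial.trdeg_of_isDomain] at h
    simpa using h.symm
  rw [htA]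
  have hAP := trdeg_lt_aleph0_of_finiteType (R := k) (S := A ⧸ P)
  -- it suffices to find `s - 1` independent elements of `A ⧸ P`
  suffices h : ∃ (ι : Type) (_ : Fintype ι) (x : ι → A ⧸ P), AlgebraicIndependent k x ∧
      s ≤ Fintype.card ι + 1 by
    obtain ⟨ι, _, x, hx, hs⟩ := h
    have h1 := hx.lift_cardinalMk_le_trdeg
    have h2 := Cardinal.toNat_le_toNat h1 (by simpa using hAP)
    simp at h2 ⊢
    omega
  let p := P.under B
  have hinj : Function.Injective (algebraMap (B ⧸ p) (A ⧸ P)) :=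
    Ideal.algebraMap_quotient_injective
  by_cases hp : p = ⊥
  · refine ⟨Fin s, inferInstance, fun i => Ideal.Quotient.mk P (φ (MvPolynomial.X i)), ?_, by simp⟩
    rw [algebraicIndependent_iff]
    intro q hq
    have h1 : Ideal.Quotient.mk P (φ q) = 0 := by
      rw [← hq]
      have : (Ideal.Quotient.mkₐ k P).comp φ = MvPolynomial.aeval
        (fun i => Ideal.Quotient.mk P (φ (MvPolynomial.X i))) := by
        ext i; simp
      rw [← this]; rfl
    have h2 : q ∈ p := by
      rw [Ideal.Quotient.eq_zero_iff_mem] at h1; exact h1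
    rw [hp] at h2; exact h2
  · obtain ⟨g, hgp, hg⟩ := Ideal.IsPrime.exists_mem_prime_of_ne_bot (I := p) inferInstance hp
    have hgprime : (Ideal.span {g}).IsPrime := (Ideal.span_singleton_prime hg.ne_zero).2 hg
    have hle : Ideal.span {g} ≤ p := (Ideal.span_singleton_le_iff_mem _).2 hgp
    have heq : Ideal.span {g} = p := by
      by_contra hne
      obtain ⟨Q, hQ, hQp, hQo⟩ := Ideal.exists_ideal_lt_liesOver_of_lt (S := A) P (q := p)
        (lt_of_le_of_ne hle hne)
      have hQ0 : ⊥ < Q := by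
        refine bot_lt_iff_ne_bot.2 fun h => hg.ne_zero ?_
        have h1 : g ∈ Q.under B := by rw [← hQo.over]; exact Ideal.mem_span_singleton_self g
        rw [h] at h1
        exact hφi (by rw [map_zero]; exact h1)
      have h1 := Ideal.height_add_one_le_of_lt_of_isPrime hQ
      have h2 := Ideal.height_add_one_le_of_lt_of_isPrime (I := (⊥ : Ideal A)) hQ0
      have h3 : (1 : ℕ∞) + 1 ≤ 1 := by
        calc (1 : ℕ∞) + 1 ≤ Q.height + 1 := by
              gcongr; exact le_trans (by simp) h2
          _ ≤ _ := h1
          _ ≤ 1 := hht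
      exact absurd h3 (by decide)
    obtain ⟨j, hj⟩ : g.vars.Nonempty := by
      rw [Finset.nonempty_iff_ne_empty]
      intro h
      rw [MvPolynomial.vars_eq_empty_iff_eq_C] at h
      have hu : IsUnit (g.coeff 0) := by
        rw [isUnit_iff_ne_zero]; intro h0; rw [h0, map_zero] at h; exact hg.ne_zero h
      exact hg.not_isUnit (h ▸ hu.map MvPolynomial.C)
    have hs : 0 < s := Fin.pos j
    refine ⟨{i // i ≠ j}, inferInstance,
      fun i => Ideal.Quotient.mk P (φ (MvPolynomial.X i)), ?_, by simp; omega⟩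
    rw [algebraicIndependent_iff]
    intro q hq
    refine eq_zero_of_rename_mem_span hj ?_
    rw [heq]
    change φ (MvPolynomial.rename Subtype.val q) ∈ P
    rw [← Ideal.Quotient.eq_zero_iff_mem, ← hq]
    have h : ((Ideal.Quotient.mkₐ k P).comp φ).comp (MvPolynomial.rename Subtype.val) =
        MvPolynomial.aeval
          (fun i : {i // i ≠ j} => Ideal.Quotient.mk P (φ (MvPolynomial.X i.1))) := by
      ext i; simp
    rw [← h]; rfl

/-- A form of the principal ideal theorem for affine algebras: below a prime `M` containing `f`
there is a prime containing `f` that cuts the transcendence degree by at most one. -/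
theorem exists_prime_trdeg_le {R A : Type u} [CommRing R] [CommRing A] [IsDomain A] [Algebra k R]
    [Algebra k A] [Algebra.FiniteType k A] (φ : R →ₐ[k] A) (hφ : Function.Surjective φ)
    {M : Ideal R} [hM : M.IsPrime] (hker : RingHom.ker φ ≤ M) {f : R} (hf : f ∈ M) :
    ∃ P : Ideal R, P.IsPrime ∧ RingHom.ker φ ≤ P ∧ P ≤ M ∧ f ∈ P ∧
      (Algebra.trdeg k A).toNat ≤ (Algebra.trdeg k (R ⧸ P)).toNat + 1 := by
  have : (M.map φ).IsPrime := Ideal.map_isPrime_of_surjective hφ hker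
  have hfM : Ideal.span {φ f} ≤ M.map φ :=
    (Ideal.span_singleton_le_iff_mem _).2 (Ideal.mem_map_of_mem _ hf)
  obtain ⟨P, hP, hPM⟩ := Ideal.exists_minimalPrimes_le hfM
  have hPp : P.IsPrime := hP.isPrime
  refine ⟨P.comap φ, inferInstance, fun g hg => ?_, fun g hg => ?_, ?_, ?_⟩
  · rw [Ideal.mem_comap, (RingHom.mem_ker).1 hg]
    exact P.zero_mem
  · obtain ⟨g', hg', hgg'⟩ := (Ideal.mem_map_iff_of_surjective φ hφ).1 (hPM hg)
    have h2 : g - g' ∈ RingHom.ker φ := by rw [RingHom.mem_ker, map_sub, hgg', sub_self]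
    simpa using M.add_mem (hker h2) hg'
  · exact hP.1.2 (Ideal.mem_span_singleton_self _)
  · refine (trdeg_le_trdeg_quotient_add_one hP).trans (Nat.add_le_add_right ?_ 1)
    have hfin : Algebra.FiniteType k (R ⧸ P.comap φ) := by
      have he : Function.Injective (Ideal.quotientMapₐ P φ (le_refl (P.comap φ))) :=
        Ideal.quotientMap_injective
      have he' : Function.Surjective (Ideal.quotientMapₐ P φ (le_refl (P.comap φ))) :=
        Ideal.quotientMap_surjective (H := le_refl (P.comap φ)) hφ
      exact Algebra.FiniteType.equiv inferInstance (AlgEquiv.ofBijective _ ⟨he, he'⟩).symm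
    exact Cardinal.toNat_le_toNat
      (trdeg_le_of_surjective (Ideal.quotientMapₐ P φ (le_refl (P.comap φ)))
        (Ideal.quotientMap_surjective (H := le_refl (P.comap φ)) hφ)) trdeg_lt_aleph0_of_finiteType

end Trdeg

/-! ### Dimension -/

section Dimension

open TopologicalSpace (IrreducibleCloseds)

/-- If every irreducible closed subset of `X` is contained, strictly, in one of `Y`, then the
dimension of `X` is smaller than that of `Y`. -/
theorem topologicalKrullDim_add_one_le {X Y : Type*} [TopologicalSpace X] [TopologicalSpace Y]
    {f : X → Y} (hf : Topology.IsInducing f)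
    (h : ∀ Z : IrreducibleCloseds X, ∃ Z' : IrreducibleCloseds Y,
      IrreducibleCloseds.map f hf.continuous Z < Z') :
    topologicalKrullDim X + 1 ≤ topologicalKrullDim Y := by
  unfold topologicalKrullDim
  cases isEmpty_or_nonempty (IrreducibleCloseds X) with
  | inl _ => rw [Order.krullDim_eq_bot]; simp
  | inr hne =>
    obtain ⟨Z⟩ := hne
    have : Nonempty (IrreducibleCloseds Y) := ⟨(h Z).choose⟩
    have : Nonempty (IrreducibleCloseds X) := ⟨Z⟩
    rw [Order.krullDim_eq_iSup_length, Order.krullDim_eq_iSup_length]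
    norm_cast
    rw [ENat.iSup_add]
    refine iSup_le fun p => ?_
    obtain ⟨Z', hZ'⟩ := h p.last
    let q : LTSeries (IrreducibleCloseds Y) :=
      (p.map _ (IrreducibleCloseds.map_strictMono_of_isInducing hf)).snoc Z' hZ'
    have hq : ((q.length : ℕ) : ℕ∞) = p.length + 1 := rfl
    rw [← hq]
    exact le_iSup (fun q : LTSeries (IrreducibleCloseds Y) => (q.length : ℕ∞)) q

variable {E F : Type*} [AddCommGroup E] [Module ℂ E] [AddCommGroup F] [Module ℂ F]

/-- The dimension of an irreducible set, as the transcendence degree of its coordinate ring. -/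
noncomputable def zdim (Z : Set E) : ℕ := (Algebra.trdeg ℂ (polyFun E ⧸ vanIdeal Z)).toNat

theorem vanIdeal_anti {Z Z' : Set E} (h : Z ⊆ Z') : vanIdeal Z' ≤ vanIdeal Z :=
  fun _ hf z hz => hf z (h hz)

theorem isDomain_coordinateRing {Z : Set E} (hZ : ZIrred Z) :
    IsDomain (polyFun E ⧸ vanIdeal Z) :=
  have := isPrime_vanIdeal hZ
  Ideal.Quotient.isDomain _

theorem zdim_singleton (v : E) : zdim ({v} : Set E) = 0 := by
  have : Algebra.IsAlgebraic ℂ (polyFun E ⧸ vanIdeal {v}) := by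
    refine ⟨fun a => ?_⟩
    obtain ⟨f, rfl⟩ := Ideal.Quotient.mk_surjective a
    have h : Ideal.Quotient.mk (vanIdeal {v}) f =
        algebraMap ℂ (polyFun E ⧸ vanIdeal {v}) (f.1 v) := by
      rw [← Ideal.Quotient.mk_algebraMap, Ideal.Quotient.mk_eq_mk_iff_sub_mem, mem_vanIdeal]
      rintro z rfl
      exact sub_self _
    rw [h]; exact isAlgebraic_algebraMap _
  rw [zdim, trdeg_eq_zero]; simp

theorem topologicalKrullDim_subtype_add_one_le {W W' : Set E} (hW : ZIrred W)
    (hW'c : ZClosed W') (h : W' ⊆ W) (hne : W' ≠ W) :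
    dimOf (affineZariski E) W' + 1 ≤ dimOf (affineZariski E) W := by
  let _ := affineZariski E
  have hi : Topology.IsInducing (Set.inclusion h) := by
    rw [← Topology.IsInducing.of_comp_iff (Topology.IsInducing.subtypeVal)]
    exact Topology.IsInducing.subtypeVal
  refine topologicalKrullDim_add_one_le hi fun Z => ?_
  have : IrreducibleSpace W := Subtype.irreducibleSpace (isIrreducible_iff_zirred.2 hW)
  refine ⟨⟨Set.univ, IrreducibleSpace.isIrreducible_univ W, isClosed_univ⟩,
    lt_of_le_of_ne (fun _ _ => trivial) fun heq => hne (h.antisymm fun w hw => ?_)⟩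
  have h1 : (⟨w, hw⟩ : W) ∈ (IrreducibleCloseds.map (Set.inclusion h) hi.continuous Z : Set W) := by
    rw [heq]; trivial
  have h2 : (IrreducibleCloseds.map (Set.inclusion h) hi.continuous Z : Set W) ⊆
      Subtype.val ⁻¹' W' := by
    refine closure_minimal ?_ ((isClosed_iff_zclosed.2 hW'c).preimage continuous_subtype_val)
    rintro _ ⟨z, _, rfl⟩
    exact z.2
  exact h2 h1

variable [FiniteDimensional ℂ E]

theorem zdim_lt {W W' : Set E} (hW : ZIrred W) (hW' : ZIrred W') (hW'c : ZClosed W')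
    (h : W' ⊆ W) (hne : W' ≠ W) : zdim W' < zdim W := by
  have := isDomain_coordinateRing hW
  have := isDomain_coordinateRing hW'
  refine trdeg_lt_of_surjective (Ideal.Quotient.factorₐ ℂ (vanIdeal_anti h))
    (Ideal.Quotient.factor_surjective (vanIdeal_anti h)) fun hinj => hne (h.antisymm fun w hw => ?_)
  refine hW'c w fun f hf hfW => ?_
  have h1 : Ideal.Quotient.mk (vanIdeal W) ⟨f, hf⟩ = 0 := by
    refine hinj ?_
    rw [map_zero]
    change Ideal.Quotient.mk (vanIdeal W') ⟨f, hf⟩ = 0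
    rw [Ideal.Quotient.eq_zero_iff_mem]; exact hfW
  rw [Ideal.Quotient.eq_zero_iff_mem] at h1
  exact h1 w hw

theorem zdim_mono {W W' : Set E} (hW : ZIrred W) (hW' : ZIrred W') (hW'c : ZClosed W')
    (h : W' ⊆ W) : zdim W' ≤ zdim W := by
  by_cases hne : W' = W
  · rw [hne]
  · exact (zdim_lt hW hW' hW'c h hne).le

theorem eq_of_zdim_le {W W' : Set E} (hW : ZIrred W) (hW' : ZIrred W') (hW'c : ZClosed W')
    (h : W' ⊆ W) (hd : zdim W ≤ zdim W') : W' = W := by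
  by_contra hne
  exact (zdim_lt hW hW' hW'c h hne).not_ge hd

/-- The principal ideal theorem: through every point of a hypersurface section of an irreducible
closed set passes an irreducible closed subset of the section, of codimension at most one. -/
theorem exists_zirred_hypersurface {W : Set E} (hW : ZIrred W) (hWc : ZClosed W) {f : E → ℂ}
    (hf : f ∈ polyFun E) {w : E} (hw : w ∈ W) (hfw : f w = 0) :
    ∃ W' : Set E, ZIrred W' ∧ ZClosed W' ∧ W' ⊆ W ∧ (∀ v ∈ W', f v = 0) ∧ w ∈ W' ∧
      zdim W ≤ zdim W' + 1 := by
  have := isDomain_coordinateRing hW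
  have : (vanIdeal ({w} : Set E)).IsPrime := isPrime_vanIdeal ⟨⟨w, rfl⟩, fun g _ h _ hgh => by
    refine (mul_eq_zero.1 (hgh w rfl)).imp ?_ ?_ <;> (rintro h _ rfl; exact h)⟩
  have hker : RingHom.ker (Ideal.Quotient.mkₐ ℂ (vanIdeal W)) = vanIdeal W :=
    Ideal.Quotient.mkₐ_ker ℂ _
  obtain ⟨P, hP, h1, h2, h3, h4⟩ := exists_prime_trdeg_le (k := ℂ) (A := polyFun E ⧸ vanIdeal W)
    (Ideal.Quotient.mkₐ ℂ (vanIdeal W)) (Ideal.Quotient.mkₐ_surjective ℂ (vanIdeal W)) (M := vanIdeal {w})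
    (by rw [hker]; exact vanIdeal_anti (by simpa using hw)) (f := ⟨f, hf⟩)
    (by rintro _ rfl; exact hfw)
  rw [hker] at h1
  refine ⟨zeroSet P, zirred_zeroSet P, zclosed_zeroSet P, fun v hv => ?_, fun v hv => hv _ h3,
    fun g hg => h2 hg w rfl, ?_⟩
  · exact hWc v fun g hg hgW => hv ⟨g, hg⟩ (h1 hgW)
  · rw [zdim, zdim, vanIdeal_zeroSet P]
    exact h4

/-- The topological dimension of an irreducible closed set is the transcendence degree of its
coordinate ring. -/
theorem dimOf_eq_zdim {W : Set E} (hW : ZIrred W) (hWc : ZClosed W) :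
    dimOf (affineZariski E) W = zdim W := by
  let _ := affineZariski E
  apply le_antisymm
  · refine iSup_le fun p => ?_
    let δ : IrreducibleCloseds W → ℕ := fun Z => zdim (Subtype.val '' (Z : Set W))
    have hcl : ∀ Z : IrreducibleCloseds W, ZClosed (Subtype.val '' (Z : Set W)) := fun Z =>
      isClosed_iff_zclosed.1 ((isClosed_iff_zclosed.2 hWc).isClosedMap_subtype_val _ Z.isClosed)
    have hir : ∀ Z : IrreducibleCloseds W, ZIrred (Subtype.val '' (Z : Set W)) := fun Z =>
      isIrreducible_iff_zirred.1 (Z.isIrreducible.image _ continuous_subtype_val.continuousOn)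
    have hδ : StrictMono δ := fun Z Z' h => by
      refine zdim_lt (hir Z') (hir Z) (hcl Z) (Set.image_mono h.le) fun heq => h.ne ?_
      exact SetLike.coe_injective (Subtype.val_injective.image_injective heq)
    have h1 := (p.map δ hδ).head_add_length_le_nat
    have h2 : (p.map δ hδ).last ≤ zdim W :=
      zdim_mono hW (hir _) (hcl _) (by rintro _ ⟨z, _, rfl⟩; exact z.2)
    have h3 : p.length ≤ zdim W := by
      have : (p.map δ hδ).length = p.length := rfl
      omega
    exact_mod_cast h3
  · suffices h : ∀ m : ℕ, ∀ W : Set E, ZIrred W → ZClosed W → m ≤ zdim W →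
        ((m : ℕ∞) : WithBot ℕ∞) ≤ dimOf (affineZariski E) W from h _ W hW hWc le_rfl
    intro m
    induction m with
    | zero =>
      intro W hW _ _
      have : Nonempty (IrreducibleCloseds W) := by
        have : IrreducibleSpace W := Subtype.irreducibleSpace (isIrreducible_iff_zirred.2 hW)
        exact ⟨⟨Set.univ, IrreducibleSpace.isIrreducible_univ W, isClosed_univ⟩⟩
      exact Order.krullDim_nonneg
    | succ m ih =>
      intro W hW hWc hm
      obtain ⟨w, hw⟩ := hW.1
      have : ∃ v ∈ W, v ≠ w := by
        by_contra! h
        have : W = {w} := Set.eq_singleton_iff_unique_mem.2 ⟨hw, h⟩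
        rw [this, zdim_singleton] at hm
        omega
      obtain ⟨v, hv, hvw⟩ := this
      obtain ⟨l, hl⟩ : ∃ l : Module.Dual ℂ E, l (v - w) ≠ 0 := by
        by_contra! h
        exact hvw (sub_eq_zero.1 ((Module.forall_dual_apply_eq_zero_iff ℂ _).1 h))
      obtain ⟨W', h1, h2, h3, h4, -, h5⟩ := exists_zirred_hypersurface hW hWc
        (sub_mem_polyFun (dual_mem_polyFun l) (const_mem_polyFun (l w))) hw (sub_self _)
      have hne : W' ≠ W := by
        rintro rfl
        have := h4 v hv
        rw [map_sub] at hl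
        exact hl this
      have h6 := ih W' h1 h2 (by omega)
      have h7 := topologicalKrullDim_subtype_add_one_le hW h2 h3 hne
      calc (((m + 1 : ℕ) : ℕ∞) : WithBot ℕ∞) = ((m : ℕ∞) : WithBot ℕ∞) + 1 := by norm_cast
        _ ≤ dimOf (affineZariski E) W' + 1 := by gcongr
        _ ≤ _ := h7

end Dimension

/-! ### Derivations and generic smoothness -/

section Derivation

open scoped IntermediateField.algebraAdjoinAdjoin in
/-- In characteristic zero the partial derivatives with respect to a transcendence basis extend to
the whole field. -/
theorem exists_derivation_of_isTranscendenceBasis {k K ι : Type*} [Field k] [CharZero k] [Field K]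
    [Algebra k K] [DecidableEq ι] {x : ι → K} (hx : IsTranscendenceBasis k x) (j : ι) :
    ∃ D : Derivation k K K, ∀ i, D (x i) = if i = j then 1 else 0 := by
  let B := Algebra.adjoin k (Set.range x)
  let F := IntermediateField.adjoin k (Set.range x)
  have : CharZero F := charZero_of_injective_algebraMap (algebraMap k F).injective
  have : Algebra.IsAlgebraic F K := hx.isAlgebraic_field
  have h1 : Algebra.FormallyEtale B F := .of_isLocalization (nonZeroDivisors _)
  have h2 : Algebra.FormallyEtale F K := .of_isSeparable _ _
  have : Algebra.FormallyEtale B K := .comp B F K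
  let e : MvPolynomial ι k ≃ₐ[k] B := hx.1.aevalEquiv
  let D₁ : Derivation k B B := Derivation.mk'
    (e.toLinearMap ∘ₗ (MvPolynomial.pderiv j : Derivation k _ _).toLinearMap ∘ₗ e.symm.toLinearMap)
    (fun a b => by simp)
  let D₂ : Derivation k B K := (Algebra.linearMap B K).compDer D₁
  let D₃ : Derivation k K K :=
    ((D₂.liftKaehlerDifferential.liftBaseChange K) ∘ₗ
      (KaehlerDifferential.tensorKaehlerEquivOfFormallyEtale k B K).symm.toLinearMap).compDer
      (KaehlerDifferential.D k K)
  have h3 : ∀ b : B, D₃ (algebraMap B K b) = algebraMap B K (D₁ b) := fun b => by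
    change D₂.liftKaehlerDifferential.liftBaseChange K
      ((KaehlerDifferential.tensorKaehlerEquivOfFormallyEtale k B K).symm
        (KaehlerDifferential.D k K (algebraMap B K b))) = _
    rw [KaehlerDifferential.tensorKaehlerEquivOfFormallyEtale_symm_D_algebraMap,
      LinearMap.liftBaseChange_tmul, Derivation.liftKaehlerDifferential_comp_D, one_smul]
    rfl
  refine ⟨D₃, fun i => ?_⟩
  have h4 : x i = algebraMap B K (e (MvPolynomial.X i)) := by
    rw [hx.1.algebraMap_aevalEquiv, MvPolynomial.aeval_X]
  rw [h4, h3]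
  have h5 : D₁ (e (MvPolynomial.X i)) = e (MvPolynomial.pderiv j (MvPolynomial.X i)) := by
    change e (MvPolynomial.pderiv j (e.symm (e (MvPolynomial.X i)))) = _
    rw [AlgEquiv.symm_apply_apply]
  rw [h5, MvPolynomial.pderiv_X, Pi.single_apply]
  split_ifs with h
  · simp
  · simp

end Derivation

section GenericSmoothness

variable {E F : Type*} [AddCommGroup E] [Module ℂ E] [AddCommGroup F] [Module ℂ F]

/-- A derivation of the function field is determined by its values on linear forms. -/
theorem derivation_apply_polyFun {K ι : Type*} [Field K] [Algebra ℂ K] [Fintype ι]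
    (e : Module.Basis ι ℂ E) (ψ : polyFun E →ₐ[ℂ] K) (D : Derivation ℂ K K) {f : E → ℂ}
    (hf : f ∈ polyFun E) :
    D (ψ ⟨f, hf⟩) = ∑ a, ψ ⟨_, lineDeriv_mem_polyFun hf (e a)⟩ *
      D (ψ ⟨_, dual_mem_polyFun (e.coord a)⟩) := by
  induction hf using Algebra.adjoin_induction with
  | mem f hf =>
    obtain ⟨l, rfl⟩ := hf
    have h1 : ∀ a, ψ ⟨_, lineDeriv_mem_polyFun (dual_mem_polyFun l) (e a)⟩ =
        algebraMap ℂ K (l (e a)) := fun a => by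
      rw [← ψ.commutes]
      congr 1
      ext v
      exact lineDeriv_dual l v (e a)
    have h2 : (⟨l, dual_mem_polyFun l⟩ : polyFun E) =
        ∑ a, l (e a) • ⟨_, dual_mem_polyFun (e.coord a)⟩ := by
      ext v
      change l v = _
      conv_lhs => rw [← e.sum_repr v, map_sum]
      simp [mul_comm]
    simp_rw [h1]
    conv_lhs => rw [h2]
    rw [map_sum, map_sum]
    exact Finset.sum_congr rfl fun a _ => by
      rw [map_smul, Derivation.map_smul, Algebra.smul_def]
  | algebraMap c =>
    have h1 : ∀ a, ψ ⟨_, lineDeriv_mem_polyFun (const_mem_polyFun c) (e a)⟩ = 0 := fun a => by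
      rw [← map_zero ψ]
      congr 1
      ext v
      exact lineDeriv_poly_const c v (e a)
    have h2 : D (ψ ⟨_, const_mem_polyFun c⟩) = 0 := by
      have : ψ ⟨_, const_mem_polyFun c⟩ = algebraMap ℂ K c := ψ.commutes c
      rw [this, Derivation.map_algebraMap]
    refine h2.trans (Eq.symm (Finset.sum_eq_zero fun a _ => ?_))
    rw [← zero_mul (D (ψ ⟨_, dual_mem_polyFun (e.coord a)⟩)), ← h1 a]
    rfl
  | add f g hf hg ihf ihg =>
    have h1 : ∀ a, ψ ⟨_, lineDeriv_mem_polyFun (add_mem_polyFun hf hg) (e a)⟩ =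
        ψ ⟨_, lineDeriv_mem_polyFun hf (e a)⟩ + ψ ⟨_, lineDeriv_mem_polyFun hg (e a)⟩ := fun a => by
      rw [← map_add]
      congr 1
      ext v
      exact lineDeriv_poly_add hf hg v (e a)
    have h2 : ψ ⟨_, add_mem_polyFun hf hg⟩ = ψ ⟨f, hf⟩ + ψ ⟨g, hg⟩ := by
      rw [← map_add]; rfl
    calc D (ψ ⟨_, add_mem_polyFun hf hg⟩) = _ := by
          rw [h2, map_add, ihf, ihg, ← Finset.sum_add_distrib]
      _ = _ := Finset.sum_congr rfl fun a _ => by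
          rw [← add_mul, ← h1 a]; rfl
  | mul f g hf hg ihf ihg =>
    have h1 : ∀ a, ψ ⟨_, lineDeriv_mem_polyFun (mul_mem_polyFun hf hg) (e a)⟩ =
        ψ ⟨_, lineDeriv_mem_polyFun hf (e a)⟩ * ψ ⟨g, hg⟩ +
          ψ ⟨f, hf⟩ * ψ ⟨_, lineDeriv_mem_polyFun hg (e a)⟩ := fun a => by
      rw [← map_mul, ← map_mul, ← map_add]
      congr 1
      ext v
      exact lineDeriv_poly_mul hf hg v (e a)
    have h2 : ψ ⟨_, mul_mem_polyFun hf hg⟩ = ψ ⟨f, hf⟩ * ψ ⟨g, hg⟩ := by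
      rw [← map_mul]; rfl
    calc D (ψ ⟨_, mul_mem_polyFun hf hg⟩) = _ := by
          rw [h2, Derivation.leibniz, ihf, ihg, smul_eq_mul, smul_eq_mul, Finset.mul_sum,
            Finset.mul_sum, ← Finset.sum_add_distrib]
      _ = _ := Finset.sum_congr rfl fun a _ => by
          rw [show ψ ⟨fun v => lineDeriv ℂ (f * g) v (e a),
            lineDeriv_mem_polyFun (mul_mem_polyFun hf hg) (e a)⟩ = _ from h1 a]
          ring

/-- Finitely many elements of the function field have a common denominator. -/
theorem exists_common_denominator {R K κ : Type*} [CommRing R] [Field K] [Finite κ] (ψ : R →+* K)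
    (hfrac : ∀ y : K, ∃ a b : R, ψ b ≠ 0 ∧ ψ b * y = ψ a) (y : κ → K) :
    ∃ b : R, ψ b ≠ 0 ∧ ∀ i, ∃ a, ψ b * y i = ψ a := by
  classical
  have := Fintype.ofFinite κ
  choose a b hb hab using fun i => hfrac (y i)
  refine ⟨∏ i, b i, by rw [map_prod]; exact Finset.prod_ne_zero_iff.2 fun i _ => hb i, fun i =>
    ⟨a i * ∏ j ∈ Finset.univ.erase i, b j, ?_⟩⟩
  rw [← Finset.mul_prod_erase _ _ (Finset.mem_univ i), map_mul, map_mul, ← hab i]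
  ring

variable {W : Set E} {K : Type*} [Field K] [Algebra ℂ K] (ψ : polyFun E →ₐ[ℂ] K)
  {ι : Type*} (l : ι → Module.Dual ℂ E)

/-- Polynomial vector fields tangent to `W` that are dual to a transcendence basis of linear
forms. -/
theorem exists_tangent_fields [FiniteDimensional ℂ E] [Finite ι] [DecidableEq ι]
    (hψ : ∀ f : polyFun E, ψ f = 0 ↔ VanishesOn f.1 W)
    (hfrac : ∀ y : K, ∃ a b : polyFun E, ψ b ≠ 0 ∧ ψ b * y = ψ a)
    (hl : IsTranscendenceBasis ℂ fun i => ψ ⟨_, dual_mem_polyFun (l i)⟩) :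
    ∃ g : polyFun E, ψ g ≠ 0 ∧ ∃ u : ι → E → E, ∀ j, ∀ w ∈ W, u j w ∈ tangentSpace W w ∧
      ∀ i, l i (u j w) = if i = j then g.1 w else 0 := by
  let e := Module.finBasis ℂ E
  choose D hD using fun j => exists_derivation_of_isTranscendenceBasis hl j
  obtain ⟨g, hg, hc⟩ := exists_common_denominator (ψ : polyFun E →+* K) hfrac
    (fun p : ι × Fin (Module.finrank ℂ E) => D p.1 (ψ ⟨_, dual_mem_polyFun (e.coord p.2)⟩))
  choose c hc using hc
  -- the fields are the derivations of `K` dual to the basis, with the denominator `g` cleared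
  have key : ∀ j (f : polyFun E),
      ψ (∑ a, ⟨_, lineDeriv_mem_polyFun f.2 (e a)⟩ * c (j, a)) = ψ g * D j (ψ f) := fun j f => by
    rw [derivation_apply_polyFun e ψ (D j) f.2, map_sum, Finset.mul_sum]
    refine Finset.sum_congr rfl fun a _ => ?_
    have := hc (j, a)
    simp only [RingHom.coe_coe] at this
    rw [map_mul, ← this]
    ring
  have hval : ∀ j (f : polyFun E) (w : E),
      lineDeriv ℂ f.1 w (∑ a, (c (j, a)).1 w • e a) =
        (∑ a, ⟨_, lineDeriv_mem_polyFun f.2 (e a)⟩ * c (j, a) : polyFun E).1 w := fun j f w => by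
    rw [← differential_apply f.2, map_sum]
    simp [differential_apply, mul_comm]
  refine ⟨g, hg, fun j w => ∑ a, (c (j, a)).1 w • e a, fun j w hw => ⟨?_, fun i => ?_⟩⟩
  · intro f hf hfW
    rw [hval j ⟨f, hf⟩]
    refine (hψ _).1 ?_ w hw
    rw [key, (hψ ⟨f, hf⟩).2 hfW, map_zero, mul_zero]
  · rw [← lineDeriv_dual (l i) w, hval j ⟨_, dual_mem_polyFun (l i)⟩]
    split_ifs with h
    · rw [← sub_eq_zero]
      refine (hψ (∑ a, _ * c (j, a) - g)).1 ?_ w hw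
      rw [map_sub, key, hD, if_pos h, mul_one, sub_self]
    · refine (hψ _).1 ?_ w hw
      rw [key, hD, if_neg h, mul_zero]

open Polynomial in
/-- At a general point of `W`, a linear form is determined on the tangent space by the linear forms
of a transcendence basis. -/
theorem exists_dual_eq_zero (hψ : ∀ f : polyFun E, ψ f = 0 ↔ VanishesOn f.1 W)
    (hl : IsTranscendenceBasis ℂ fun i => ψ ⟨_, dual_mem_polyFun (l i)⟩) (m : Module.Dual ℂ E) :
    ∃ g : polyFun E, ψ g ≠ 0 ∧ ∀ w ∈ W, g.1 w ≠ 0 → ∀ v ∈ tangentSpace W w,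
      (∀ i, l i v = 0) → m v = 0 := by
  let x : ι → K := fun i => ψ ⟨_, dual_mem_polyFun (l i)⟩
  let y : K := ψ ⟨_, dual_mem_polyFun m⟩
  let α : MvPolynomial ι ℂ →ₐ[ℂ] polyFun E :=
    MvPolynomial.aeval fun i => ⟨_, dual_mem_polyFun (l i)⟩
  have hα : ψ.comp α = MvPolynomial.aeval x := MvPolynomial.comp_aeval _ _
  -- a polynomial relation of minimal degree
  have hex : ∃ n : ℕ, ∃ Q : (MvPolynomial ι ℂ)[X], Q ≠ 0 ∧ Q.natDegree = n ∧
      Q.eval₂ (MvPolynomial.aeval x : MvPolynomial ι ℂ →ₐ[ℂ] K).toRingHom y = 0 := by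
    obtain ⟨p, hp0, hp⟩ := (hl.isAlgebraic).isAlgebraic y
    refine ⟨_, p.map (hl.1.aevalEquiv.symm : _ →+* MvPolynomial ι ℂ), ?_, rfl, ?_⟩
    · exact (Polynomial.map_ne_zero_iff hl.1.aevalEquiv.symm.injective).2 hp0
    · rw [Polynomial.eval₂_map, ← hp, Polynomial.aeval_def]
      congr 1
      ext b
      have := hl.1.algebraMap_aevalEquiv (hl.1.aevalEquiv.symm b)
      rw [AlgEquiv.apply_symm_apply] at this
      rw [this]; rfl
  classical
  obtain ⟨Q, hQ0, hQn, hQ⟩ := Nat.find_spec hex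
  have hmin : ∀ Q' : (MvPolynomial ι ℂ)[X], Q'.natDegree < Nat.find hex →
      Q'.eval₂ (MvPolynomial.aeval x : MvPolynomial ι ℂ →ₐ[ℂ] K).toRingHom y = 0 → Q' = 0 := by
    intro Q' hQ' h
    by_contra h0
    exact Nat.find_min hex hQ' ⟨Q', h0, rfl, h⟩
  have heval : ∀ Q' : (MvPolynomial ι ℂ)[X], ψ (Q'.eval₂ α.toRingHom ⟨_, dual_mem_polyFun m⟩) =
      Q'.eval₂ (MvPolynomial.aeval x : MvPolynomial ι ℂ →ₐ[ℂ] K).toRingHom y := fun Q' => by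
    have h := Polynomial.hom_eval₂ Q' α.toRingHom ψ.toRingHom ⟨_, dual_mem_polyFun m⟩
    have h2 : ψ.toRingHom.comp α.toRingHom =
      (MvPolynomial.aeval x : MvPolynomial ι ℂ →ₐ[ℂ] K).toRingHom := by rw [← hα]; rfl
    rw [h2] at h
    exact h
  have hder0 : Polynomial.derivative Q ≠ 0 := by
    intro h
    have h1 := Polynomial.derivative_eq_zero.1 h
    rw [Polynomial.eq_C_of_natDegree_eq_zero h1, Polynomial.eval₂_C] at hQ
    refine hQ0 ?_
    rw [Polynomial.eq_C_of_natDegree_eq_zero h1, hl.1.eq_zero_of_aeval_eq_zero _ hQ, map_zero]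
  -- The derivative of the minimal relation does not vanish at `y`, so that differentiating the
  -- relation along a tangent vector determines the value of `m` on it.
  refine ⟨(Polynomial.derivative Q).eval₂ α.toRingHom ⟨_, dual_mem_polyFun m⟩, fun h => ?_,
    fun w hw hgw v hv hlv => ?_⟩
  · rw [heval] at h
    refine hder0 (hmin _ ?_ h)
    rw [← hQn]
    refine Polynomial.natDegree_derivative_lt fun h0 => hder0 ?_
    rw [Polynomial.eq_C_of_natDegree_eq_zero h0, Polynomial.derivative_C]
  · have hα0 : ∀ p : MvPolynomial ι ℂ, lineDeriv ℂ (α p).1 w v = 0 := fun p => by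
      induction p using MvPolynomial.induction_on with
      | C c =>
        have : (α (MvPolynomial.C c)).1 = fun _ => c := by
          rw [← MvPolynomial.algebraMap_eq, α.commutes]; rfl
        rw [this]; exact lineDeriv_poly_const c w v
      | add p q hp hq =>
        rw [map_add]
        exact (lineDeriv_poly_add (α p).2 (α q).2 w v).trans (by rw [hp, hq, add_zero])
      | mul_X p i hp =>
        rw [map_mul]
        refine (lineDeriv_poly_mul (α p).2 (α (MvPolynomial.X i)).2 w v).trans ?_
        have : (α (MvPolynomial.X i)).1 = l i := by simp [α]
        rw [hp, this, lineDeriv_dual, hlv i]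
        ring
    have hQd : ∀ Q' : (MvPolynomial ι ℂ)[X],
        lineDeriv ℂ (Q'.eval₂ α.toRingHom ⟨_, dual_mem_polyFun m⟩).1 w v =
          ((Polynomial.derivative Q').eval₂ α.toRingHom ⟨_, dual_mem_polyFun m⟩).1 w * m v := by
      intro Q'
      induction Q' using Polynomial.induction_on' with
      | add p q hp hq =>
        rw [Polynomial.eval₂_add, Polynomial.derivative_add, Polynomial.eval₂_add]
        refine (lineDeriv_poly_add (Subtype.prop _) (Subtype.prop _) w v).trans ?_
        rw [hp, hq, ← add_mul]; rfl
      | monomial n p =>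
        induction n with
        | zero =>
          rw [Polynomial.monomial_zero_left, Polynomial.eval₂_C, Polynomial.derivative_C,
            Polynomial.eval₂_zero]
          rw [show (0 : polyFun E).1 w = 0 from rfl, zero_mul]
          exact hα0 p
        | succ n ih =>
          rw [← Polynomial.monomial_mul_X, Polynomial.eval₂_mul, Polynomial.eval₂_X,
            Polynomial.derivative_mul, Polynomial.derivative_X, mul_one, Polynomial.eval₂_add,
            Polynomial.eval₂_mul, Polynomial.eval₂_X]
          refine (lineDeriv_poly_mul (Subtype.prop _) (dual_mem_polyFun m) w v).trans ?_
          rw [ih, lineDeriv_dual]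
          simp only [AddMemClass.coe_add, MulMemClass.coe_mul, Pi.add_apply, Pi.mul_apply]
          ring
    have h1 := hv _ (Subtype.prop (Q.eval₂ α.toRingHom ⟨_, dual_mem_polyFun m⟩))
      ((hψ _).1 ((heval Q).trans hQ))
    rw [hQd] at h1
    exact (mul_eq_zero.1 h1).resolve_left hgw

/-- An algebraically independent family in the function field that consists of the coordinates of
a dominant linear map. -/
theorem algebraicIndependent_coord {A ι : Type*} [CommRing A] [Algebra ℂ A] [Fintype ι]
    (b : Module.Basis ι ℂ F) (φ : E →ₗ[ℂ] F) (mk : polyFun E →ₐ[ℂ] A)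
    (hmk : ∀ f : polyFun E, mk f = 0 → VanishesOn f.1 W)
    (hdom : ∀ g ∈ polyFun F, (∀ w ∈ W, g (φ w) = 0) → ∀ y, g y = 0) :
    AlgebraicIndependent ℂ fun i => mk ⟨_, dual_mem_polyFun (b.coord i ∘ₗ φ)⟩ := by
  rw [algebraicIndependent_iff]
  intro p hp
  let α : MvPolynomial ι ℂ →ₐ[ℂ] polyFun F :=
    MvPolynomial.aeval fun i => ⟨_, dual_mem_polyFun (b.coord i)⟩
  let β : MvPolynomial ι ℂ →ₐ[ℂ] polyFun E :=
    MvPolynomial.aeval fun i => ⟨_, dual_mem_polyFun (b.coord i ∘ₗ φ)⟩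
  have h1 : mk (β p) = 0 := by
    rw [← hp, ← AlgHom.comp_apply, MvPolynomial.comp_aeval]
  have h2 : ∀ w, (β p).1 w = (α p).1 (φ w) := fun w => by
    let ev : polyFun E →ₐ[ℂ] ℂ := (Pi.evalAlgHom ℂ (fun _ : E => ℂ) w).comp (polyFun E).val
    let ev' : polyFun F →ₐ[ℂ] ℂ := (Pi.evalAlgHom ℂ (fun _ : F => ℂ) (φ w)).comp (polyFun F).val
    have : ev.comp β = ev'.comp α := by
      ext i; simp [ev, ev', α, β]
    exact congrArg (fun f => f p) this
  have h3 := hdom _ (α p).2 fun w hw => by rw [← h2]; exact hmk _ h1 w hw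
  refine MvPolynomial.funext fun c => ?_
  rw [map_zero, ← h3 (∑ i, c i • b i)]
  let ev' : polyFun F →ₐ[ℂ] ℂ :=
    (Pi.evalAlgHom ℂ (fun _ : F => ℂ) (∑ i, c i • b i)).comp (polyFun F).val
  have : (MvPolynomial.aeval c : MvPolynomial ι ℂ →ₐ[ℂ] ℂ) = ev'.comp α := by
    refine MvPolynomial.algHom_ext fun i => ?_
    rw [AlgHom.comp_apply, MvPolynomial.aeval_X, MvPolynomial.aeval_X]
    exact (congrFun (b.repr_sum_self c) i).symm
  exact congrArg (fun f => f p) this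

/-- Generic smoothness, for a domain `A` presented as the coordinate ring of `W`. -/
theorem generic_smoothness_of_domain {A : Type*} [CommRing A] [IsDomain A] [Algebra ℂ A]
    [FiniteDimensional ℂ E] [FiniteDimensional ℂ F] (mk : polyFun E →ₐ[ℂ] A)
    (hsurj : Function.Surjective mk) (hmk : ∀ f, mk f = 0 ↔ VanishesOn f.1 W)
    (φ : E →ₗ[ℂ] F) (hdom : ∀ g ∈ polyFun F, (∀ w ∈ W, g (φ w) = 0) → ∀ y, g y = 0) :
    ∃ g ∈ polyFun E, (∃ w ∈ W, g w ≠ 0) ∧ ∀ w ∈ W, g w ≠ 0 →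
      Module.finrank ℂ (tangentSpace W w) = Cardinal.toNat (Algebra.trdeg ℂ A) ∧
      ∀ y, ∃ v ∈ tangentSpace W w, φ v = y := by
  classical
  have : Algebra.FiniteType ℂ A := Algebra.FiniteType.of_surjective mk hsurj
  let K := FractionRing A
  let ψ : polyFun E →ₐ[ℂ] K := (IsScalarTower.toAlgHom ℂ A K).comp mk
  have hψA : ∀ f, ψ f = algebraMap A K (mk f) := fun f => rfl
  have hψ : ∀ f : polyFun E, ψ f = 0 ↔ VanishesOn f.1 W := fun f => by
    rw [← hmk, hψA, map_eq_zero_iff _ (IsFractionRing.injective A K)]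
  have hfrac : ∀ y : K, ∃ a b : polyFun E, ψ b ≠ 0 ∧ ψ b * y = ψ a := fun y => by
    obtain ⟨a, b, hb, rfl⟩ := IsFractionRing.div_surjective (A := A) y
    obtain ⟨a, rfl⟩ := hsurj a
    obtain ⟨b, rfl⟩ := hsurj b
    have hb0 : ψ b ≠ 0 := by
      rw [hψA, Ne, map_eq_zero_iff _ (IsFractionRing.injective A K)]
      exact nonZeroDivisors.ne_zero hb
    refine ⟨a, b, hb0, ?_⟩
    change ψ b * (ψ a / ψ b) = ψ a
    rw [mul_comm, div_mul_cancel₀ _ hb0]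
  let bF := Module.finBasis ℂ F
  have hind := algebraicIndependent_coord bF φ mk (fun f => (hmk f).1) hdom
  have hadj : Algebra.adjoin ℂ
      (Set.range fun l : Module.Dual ℂ E => mk ⟨_, dual_mem_polyFun l⟩) = ⊤ := by
    rw [eq_top_iff]
    rintro a -
    obtain ⟨⟨f, hf⟩, rfl⟩ := hsurj a
    induction hf using Algebra.adjoin_induction with
    | mem f hf =>
      obtain ⟨l, rfl⟩ := hf
      exact Algebra.subset_adjoin ⟨l, rfl⟩
    | algebraMap c =>
      have := Subalgebra.algebraMap_mem (Algebra.adjoin ℂ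
        (Set.range fun l : Module.Dual ℂ E => mk ⟨_, dual_mem_polyFun l⟩)) c
      rwa [← mk.commutes c] at this
    | add f g hf hg ihf ihg =>
      have h := Subalgebra.add_mem _ ihf ihg
      rw [← map_add] at h
      exact h
    | mul f g hf hg ihf ihg =>
      have h := Subalgebra.mul_mem _ ihf ihg
      rw [← map_mul] at h
      exact h
  have : Algebra.IsAlgebraic (Algebra.adjoin ℂ
      (Set.range fun l : Module.Dual ℂ E => mk ⟨_, dual_mem_polyFun l⟩)) A := by
    refine ⟨fun a => ?_⟩
    exact isAlgebraic_algebraMap (A := A) (⟨a, by rw [hadj]; trivial⟩ : Algebra.adjoin ℂ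
      (Set.range fun l : Module.Dual ℂ E => mk ⟨_, dual_mem_polyFun l⟩))
  -- extend the coordinates of `φ` to a transcendence basis that consists of linear forms
  obtain ⟨s, hzs, hst, hs⟩ := exists_isTranscendenceBasis_between (R := ℂ)
    (Set.range fun i => mk ⟨_, dual_mem_polyFun (bF.coord i ∘ₗ φ)⟩)
    (Set.range fun l : Module.Dual ℂ E => mk ⟨_, dual_mem_polyFun l⟩)
    (by rintro _ ⟨i, rfl⟩; exact ⟨_, rfl⟩) hind.coe_range
  have hcard := hs.cardinalMk_eq_trdeg
  have : Finite s := Cardinal.lt_aleph0_iff_finite.1 (hcard ▸ trdeg_lt_aleph0_of_finiteType)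
  have := Fintype.ofFinite s
  choose l hl using fun a : s => hst a.2
  have : Algebra.IsAlgebraic A K :=
    (IsFractionRing.comap_isAlgebraic_iff (A := A) (K := K) (C := K)).2 inferInstance
  have hK : IsTranscendenceBasis ℂ fun i => ψ ⟨_, dual_mem_polyFun (l i)⟩ := by
    have h := hs.algebraMap_comp (A := K)
    convert h using 1
    ext a
    rw [hψA]
    exact congrArg _ (hl a)
  obtain ⟨g₁, hg₁, u, hu⟩ := exists_tangent_fields ψ l hψ hfrac hK
  choose g₂ hg₂ hgv using fun a => exists_dual_eq_zero ψ l hψ hK ((Module.finBasis ℂ E).coord a)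
  have hne : ψ (g₁ * ∏ a, g₂ a) ≠ 0 := by
    rw [map_mul, map_prod]
    exact mul_ne_zero hg₁ (Finset.prod_ne_zero_iff.2 fun a _ => hg₂ a)
  refine ⟨_, (g₁ * ∏ a, g₂ a).2, ?_, fun w hw hgw => ?_⟩
  · rw [Ne, hψ] at hne
    unfold VanishesOn at hne
    push Not at hne
    exact hne
  have hg₁w : g₁.1 w ≠ 0 := fun h => hgw (by
    rw [show (g₁ * ∏ a, g₂ a : polyFun E).1 w = g₁.1 w * (∏ a, g₂ a : polyFun E).1 w from rfl, h,
      zero_mul])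
  have hg₂w : ∀ a, (g₂ a).1 w ≠ 0 := fun a h => hgw (by
    rw [← Finset.mul_prod_erase _ _ (Finset.mem_univ a), show (g₁ * (g₂ a *
      ∏ x ∈ Finset.univ.erase a, g₂ x) : polyFun E).1 w = g₁.1 w * ((g₂ a).1 w *
      (∏ x ∈ Finset.univ.erase a, g₂ x : polyFun E).1 w) from rfl, h]
    ring)
  have hinj : ∀ v ∈ tangentSpace W w, (∀ i, l i v = 0) → v = 0 := fun v hv h =>
    (Module.finBasis ℂ E).ext_elem fun a => by
      have := hgv a w hw (hg₂w a) v hv h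
      simpa using this
  have hlift : ∀ c : s → ℂ, ∃ v ∈ tangentSpace W w, ∀ i, l i v = c i := fun c => by
    refine ⟨∑ j, (c j / g₁.1 w) • u j w, Submodule.sum_mem _ fun j _ =>
      Submodule.smul_mem _ _ (hu j w hw).1, fun i => ?_⟩
    rw [map_sum, Finset.sum_eq_single i]
    · rw [map_smul, (hu i w hw).2, if_pos rfl, smul_eq_mul, div_mul_cancel₀ _ hg₁w]
    · intro j _ hj
      rw [map_smul, (hu j w hw).2, if_neg hj.symm, smul_zero]
    · simp
  constructor
  · let L : tangentSpace W w →ₗ[ℂ] (s → ℂ) := (LinearMap.pi l) ∘ₗ (tangentSpace W w).subtype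
    have hL : Function.Bijective L := by
      refine ⟨(injective_iff_map_eq_zero L).2 fun v hv => ?_, fun c => ?_⟩
      · exact Subtype.ext (hinj v v.2 fun i => congrFun hv i)
      · obtain ⟨v, hv, hvc⟩ := hlift c
        exact ⟨⟨v, hv⟩, funext hvc⟩
    rw [(LinearEquiv.ofBijective L hL).finrank_eq, Module.finrank_fintype_fun_eq_card,
      ← hcard, Cardinal.mk_fintype, Cardinal.toNat_natCast]
  · intro y
    let c : s → ℂ := fun a => if h : ∃ i, mk ⟨_, dual_mem_polyFun (bF.coord i ∘ₗ φ)⟩ = a.1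
      then bF.coord h.choose y else 0
    obtain ⟨v, hv, hvc⟩ := hlift c
    refine ⟨v, hv, bF.ext_elem fun i => ?_⟩
    let a : s := ⟨_, hzs ⟨i, rfl⟩⟩
    have hex : ∃ i, mk ⟨_, dual_mem_polyFun (bF.coord i ∘ₗ φ)⟩ = a.1 := ⟨i, rfl⟩
    have h1 : c a = bF.coord i y := by
      have : hex.choose = i := hind.injective hex.choose_spec
      simp only [c, dif_pos hex, this]
    have h2 : mk ⟨_, dual_mem_polyFun (l a - bF.coord i ∘ₗ φ)⟩ = 0 := by
      have h : (⟨_, dual_mem_polyFun (l a - bF.coord i ∘ₗ φ)⟩ : polyFun E) =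
        ⟨_, dual_mem_polyFun (l a)⟩ - ⟨_, dual_mem_polyFun (bF.coord i ∘ₗ φ)⟩ := rfl
      rw [h, map_sub, sub_eq_zero]
      exact hl a
    have h3 := hv _ (dual_mem_polyFun _) ((hmk _).1 h2)
    rw [lineDeriv_dual, LinearMap.sub_apply, sub_eq_zero, hvc, h1] at h3
    simpa using h3.symm

/-- Generic smoothness: for a dominant linear map `φ` on an irreducible set `W`, the tangent
spaces at general points of `W` have the dimension of `W` and map onto the target. -/
theorem generic_smoothness [FiniteDimensional ℂ E] [FiniteDimensional ℂ F] (hW : ZIrred W)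
    (φ : E →ₗ[ℂ] F) (hdom : ∀ g ∈ polyFun F, (∀ w ∈ W, g (φ w) = 0) → ∀ y, g y = 0) :
    ∃ g ∈ polyFun E, (∃ w ∈ W, g w ≠ 0) ∧ ∀ w ∈ W, g w ≠ 0 →
      Module.finrank ℂ (tangentSpace W w) = zdim W ∧
      ∀ y, ∃ v ∈ tangentSpace W w, φ v = y := by
  have := isDomain_coordinateRing hW
  let mk : polyFun E →ₐ[ℂ] polyFun E ⧸ vanIdeal W := Ideal.Quotient.mkₐ ℂ (vanIdeal W)
  have hmk : ∀ f, mk f = 0 ↔ VanishesOn f.1 W := fun f => by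
    rw [← mem_vanIdeal]
    exact Ideal.Quotient.eq_zero_iff_mem
  have hsurj : Function.Surjective mk := Ideal.Quotient.mk_surjective
  exact generic_smoothness_of_domain mk hsurj hmk φ hdom

end GenericSmoothness

/-! ### Semicontinuity of tangent spaces -/

section Semicontinuity

open scoped Matrix

variable {E : Type*} [AddCommGroup E] [Module ℂ E]

/-- The differential at `v` of the polynomials that vanish on `Z`, as a linear map. -/
noncomputable def conormalMap (Z : Set E) (v : E) : vanIdeal Z →ₗ[ℂ] Module.Dual ℂ E where
  toFun f := differential f.1.2 v
  map_add' f g := by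
    ext w
    rw [LinearMap.add_apply, differential_apply, differential_apply, differential_apply]
    exact lineDeriv_poly_add f.1.2 g.1.2 v w
  map_smul' c f := by
    ext w
    rw [LinearMap.smul_apply, differential_apply, differential_apply]
    have h := lineDeriv_poly_mul (const_mem_polyFun c) f.1.2 v w
    rw [lineDeriv_poly_const, zero_mul, zero_add] at h
    exact h

theorem tangentSpace_eq_dualCoannihilator (Z : Set E) (v : E) :
    tangentSpace Z v = (LinearMap.range (conormalMap Z v)).dualCoannihilator := by
  ext w
  rw [Submodule.mem_dualCoannihilator]
  constructor
  · rintro hw _ ⟨f, rfl⟩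
    exact (differential_apply f.1.2 v w).trans (hw f.1.1 f.1.2 f.2)
  · intro hw f hf hZ
    have h := hw _ ⟨⟨⟨f, hf⟩, hZ⟩, rfl⟩
    exact (differential_apply hf v w).symm.trans h

/-- Tangent spaces near a point `z₀`: their dimension is semicontinuous, and where it is that of
the tangent space at `z₀`, a tangent vector at `z₀` extends to a tangent polynomial vector field. -/
theorem exists_tangent_extension [FiniteDimensional ℂ E] (Z : Set E) (z₀ : E) :
    ∃ Δ ∈ polyFun E, Δ z₀ ≠ 0 ∧
      (∀ z, Δ z ≠ 0 → Module.finrank ℂ (tangentSpace Z z) ≤ Module.finrank ℂ (tangentSpace Z z₀)) ∧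
      ∀ u ∈ tangentSpace Z z₀, ∃ û : E → E, IsPolyMap û ∧ û z₀ = u ∧ ∀ z, Δ z ≠ 0 →
        Module.finrank ℂ (tangentSpace Z z₀) ≤ Module.finrank ℂ (tangentSpace Z z) →
        û z ∈ tangentSpace Z z := by
  let A := LinearMap.range (conormalMap Z z₀)
  let r := Module.finrank ℂ A
  let b : Module.Basis (Fin r) ℂ A := Module.finBasis ℂ A
  choose f hf using fun i => (b i).2
  have hfi : ∀ i w, lineDeriv ℂ (f i).1.1 z₀ w = (b i).1 w := fun i w => by
    rw [← hf]; exact (differential_apply (f i).1.2 z₀ w).symm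
  -- vectors dual to the basis of differentials
  have hsurj : Function.Surjective (LinearMap.pi fun i => (b i).1 : E →ₗ[ℂ] (Fin r → ℂ)) := by
    have hli : LinearIndependent ℂ fun i => (b i).1 :=
      b.linearIndependent.map' A.subtype A.ker_subtype
    rw [← LinearMap.dualMap_injective_iff, ← LinearMap.ker_eq_bot, LinearMap.ker_eq_bot']
    intro l hl
    have h := Fintype.linearIndependent_iff.1 hli (fun i => l (Pi.single i 1)) (by
      ext v
      have := LinearMap.congr_fun hl v
      rw [LinearMap.dualMap_apply, LinearMap.zero_apply, ← LinearMap.sum_single_apply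
        (fun _ : Fin r => ℂ) (LinearMap.pi (fun i => (b i).1) v), map_sum] at this
      rw [LinearMap.zero_apply, ← this, LinearMap.sum_apply]
      refine Finset.sum_congr rfl fun i _ => ?_
      have hs : (Pi.single i ((b i).1 v) : Fin r → ℂ) = (b i).1 v • Pi.single i 1 := by
        rw [← Pi.single_smul, smul_eq_mul, mul_one]
      rw [LinearMap.pi_apply, hs, map_smul, LinearMap.smul_apply, smul_eq_mul, smul_eq_mul,
        mul_comm])
    refine LinearMap.pi_ext' fun i => LinearMap.ext_ring ?_
    exact h i
  choose w hw using fun j => hsurj (Pi.single j 1)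
  have hbw : ∀ i j, (b i).1 (w j) = if i = j then 1 else 0 := fun i j => by
    have := congrFun (hw j) i
    rw [LinearMap.pi_apply] at this
    rw [this, Pi.single_apply]
  let M : Matrix (Fin r) (Fin r) (polyFun E) := fun i j => ⟨_, lineDeriv_mem_polyFun (f i).1.2 (w j)⟩
  let ev : E → polyFun E →+* ℂ := fun z => (Pi.evalRingHom (fun _ : E => ℂ) z).comp
    (polyFun E).val.toRingHom
  let G : E → E →ₗ[ℂ] (Fin r → ℂ) := fun z => LinearMap.pi fun i => differential (f i).1.2 z
  have hG : ∀ z v i, G z v i = lineDeriv ℂ (f i).1.1 z v := fun z v i => by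
    simp only [G, LinearMap.pi_apply]
    exact differential_apply _ _ _
  have hM : ∀ z i j, (ev z).mapMatrix M i j = G z (w j) i := fun z i j => (hG z (w j) i).symm
  have hdet : ∀ z, M.det.1 z = ((ev z).mapMatrix M).det := fun z => (ev z).map_det M
  have hadj : ∀ z i j, (M.adjugate i j).1 z = ((ev z).mapMatrix M).adjugate i j := fun z i j => by
    rw [← RingHom.map_adjugate]; rfl
  -- The tangent space at `z` lies in the kernel of `G z`, of the dimension of the tangent space at
  -- `z₀` where `M` is invertible; Cramer's rule gives polynomial sections of the kernels.
  have hle : ∀ z, tangentSpace Z z ≤ LinearMap.ker (G z) := fun z v hv => by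
    rw [LinearMap.mem_ker]
    ext i
    rw [hG]
    exact hv _ (f i).1.2 (f i).2
  have hGw : ∀ z (c : Fin r → ℂ), G z (∑ j, c j • w j) = (ev z).mapMatrix M *ᵥ c := fun z c => by
    ext i
    rw [map_sum, Finset.sum_apply, Matrix.mulVec, dotProduct]
    refine Finset.sum_congr rfl fun j _ => ?_
    rw [map_smul, Pi.smul_apply, hM, smul_eq_mul, mul_comm]
  have hker : ∀ z, M.det.1 z ≠ 0 →
      Module.finrank ℂ (LinearMap.ker (G z)) = Module.finrank ℂ (tangentSpace Z z₀) := fun z hz => by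
    have h1 : Function.Surjective (G z) := fun c => by
      refine ⟨∑ j, (((ev z).mapMatrix M)⁻¹ *ᵥ c) j • w j, ?_⟩
      rw [hGw, Matrix.mulVec_mulVec, Matrix.mul_nonsing_inv, Matrix.one_mulVec]
      rw [← hdet]; exact isUnit_iff_ne_zero.2 hz
    have h2 := (G z).finrank_range_add_finrank_ker
    rw [LinearMap.range_eq_top.2 h1, finrank_top, Module.finrank_fintype_fun_eq_card,
      Fintype.card_fin] at h2
    have h3 := Subspace.finrank_add_finrank_dualCoannihilator_eq A
    rw [← tangentSpace_eq_dualCoannihilator] at h3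
    change r + _ = _ at h3
    omega
  refine ⟨M.det.1, M.det.2, ?_, fun z hz => ?_, fun u hu => ?_⟩
  · rw [hdet]
    have : (ev z₀).mapMatrix M = 1 := by
      ext i j
      rw [hM, hG, hfi, hbw, Matrix.one_apply]
    rw [this, Matrix.det_one]
    exact one_ne_zero
  · rw [← hker z hz]
    exact Submodule.finrank_mono (hle z)
  · have hu0 : G z₀ u = 0 := hle z₀ hu
    refine ⟨fun z => M.det.1 z • u - ∑ j, (∑ i, (M.adjugate j i).1 z * G z u i) • w j, ?_, ?_, ?_⟩
    · refine (IsPolyMap.smul M.det.2 (isPolyMap_const u)).sub (IsPolyMap.sum _ fun j _ =>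
        IsPolyMap.smul (sum_mem_polyFun _ fun i _ => mul_mem_polyFun (M.adjugate j i).2 ?_)
          (isPolyMap_const _))
      simp_rw [hG]
      exact lineDeriv_mem_polyFun (f i).1.2 u
    · have : (ev z₀).mapMatrix M = 1 := by
        ext i j
        rw [hM, hG, hfi, hbw, Matrix.one_apply]
      simp only [hu0, hdet, this, Matrix.det_one, one_smul]
      simp
    · intro z hz hd
      have h : tangentSpace Z z = LinearMap.ker (G z) :=
        Submodule.eq_of_le_of_finrank_le (hle z) (by rw [hker z hz]; exact hd)
      have h1 := hGw z (((ev z).mapMatrix M).adjugate *ᵥ G z u)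
      rw [Matrix.mulVec_mulVec, Matrix.mul_adjugate, Matrix.smul_mulVec, Matrix.one_mulVec,
        ← hdet] at h1
      have h2 : ∑ j, (∑ i, (M.adjugate j i).1 z * G z u i) • w j =
          ∑ j, (((ev z).mapMatrix M).adjugate *ᵥ G z u) j • w j :=
        Finset.sum_congr rfl fun j _ => congrArg (· • w j)
          (Finset.sum_congr rfl fun i _ => congrArg (· * G z u i) (hadj z j i))
      rw [h, LinearMap.mem_ker]
      beta_reduce
      rw [h2, map_sub, map_smul, h1, sub_self]

end Semicontinuity

/-! ### Local dimensions -/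

section LocalDim

variable {E F : Type*} [AddCommGroup E] [Module ℂ E] [AddCommGroup F] [Module ℂ F]

theorem exists_finrank_eq_zdim [FiniteDimensional ℂ E] {W : Set E} (hW : ZIrred W) :
    ∃ g ∈ polyFun E, (∃ w ∈ W, g w ≠ 0) ∧ ∀ w ∈ W, g w ≠ 0 →
      Module.finrank ℂ (tangentSpace W w) = zdim W := by
  obtain ⟨g, hg, hgW, h⟩ := generic_smoothness hW (0 : E →ₗ[ℂ] (Fin 0 → ℂ)) fun g _ h y => by
    obtain ⟨w, hw⟩ := hW.1
    rw [Subsingleton.elim y ((0 : E →ₗ[ℂ] (Fin 0 → ℂ)) w)]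
    exact h w hw
  exact ⟨g, hg, hgW, fun w hw hgw => (h w hw hgw).1⟩

theorem zdim_le_finrank_tangentSpace [FiniteDimensional ℂ E] {W : Set E} (hW : ZIrred W) {w : E}
    (hw : w ∈ W) : zdim W ≤ Module.finrank ℂ (tangentSpace W w) := by
  obtain ⟨g, hg, hgW, h⟩ := exists_finrank_eq_zdim hW
  obtain ⟨Δ, hΔ, hΔw, hle, -⟩ := exists_tangent_extension W w
  obtain ⟨z, hz, hgz, hΔz⟩ := hW.exists_ne_zero hg hΔ hgW ⟨w, hw, hΔw⟩
  rw [← h z hz hgz]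
  exact hle z hΔz

/-- Injective linear maps are closed. -/
theorem ZClosed.image_of_injective [FiniteDimensional ℂ F] {φ : E →ₗ[ℂ] F} (hφ : Function.Injective φ) {W : Set E}
    (hW : ZClosed W) : ZClosed (φ '' W) := by
  obtain ⟨s, hs⟩ := LinearMap.exists_leftInverse_of_injective φ (LinearMap.ker_eq_bot.2 hφ)
  have hs' : ∀ v, s (φ v) = v := fun v => LinearMap.congr_fun hs v
  have : φ '' W = s ⁻¹' W ∩ ((LinearMap.id - φ ∘ₗ s : F →ₗ[ℂ] F) : F → F) ⁻¹' {0} := by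
    ext y
    constructor
    · rintro ⟨w, hw, rfl⟩
      exact ⟨by rwa [Set.mem_preimage, hs'], by simp [hs']⟩
    · rintro ⟨h1, h2⟩
      exact ⟨s y, h1, (sub_eq_zero.1 (show y - φ (s y) = 0 from h2)).symm⟩
  rw [this]
  exact (hW.preimage (isPolyMap_linear s)).inter
    ((zclosed_singleton (0 : F)).preimage (isPolyMap_linear _))

/-- The irreducible closed subsets of `Z` through `v` have maximal dimension `d`. -/
def HasDimAt (Z : Set E) (v : E) (d : ℕ) : Prop :=
  (∀ W, ZIrred W → ZClosed W → W ⊆ Z → v ∈ W → zdim W ≤ d) ∧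
    ∃ W, ZIrred W ∧ ZClosed W ∧ W ⊆ Z ∧ v ∈ W ∧ zdim W = d

theorem zirred_image_iff {φ : E →ₗ[ℂ] F} {C : Set E} (hinj : Set.InjOn φ C)
    (hc : ∀ W ⊆ C, ZClosed W → ZClosed (φ '' W)) {W : Set E} (hW : W ⊆ C) (hWc : ZClosed W) :
    ZIrred (φ '' W) ↔ ZIrred W := by
  refine ⟨fun h => zirred_of_subset_or_subset (Set.image_nonempty.1 h.1) fun A B hA hB hAB => ?_,
    fun h => h.image (isPolyMap_linear φ)⟩
  have h1 : φ '' W ⊆ φ '' (W ∩ A) ∪ φ '' (W ∩ B) := by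
    rw [← Set.image_union, ← Set.inter_union_distrib_left, Set.inter_eq_left.2 hAB]
  have h2 : ∀ A, φ '' W ⊆ φ '' (W ∩ A) → W ⊆ A := fun A h w hw => by
    obtain ⟨w', hw', he⟩ := h ⟨w, hw, rfl⟩
    rw [← hinj (hW hw'.1) (hW hw) he]
    exact hw'.2
  exact (h.subset_or_subset (hc _ (Set.inter_subset_left.trans hW) (hWc.inter hA))
    (hc _ (Set.inter_subset_left.trans hW) (hWc.inter hB)) h1).imp (h2 A) (h2 B)

variable [FiniteDimensional ℂ E]

theorem HasDimAt.localDim_eq {Z : Set E} {v : E} {d : ℕ} (h : HasDimAt Z v d) :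
    localDim Z v = d := by
  obtain ⟨h1, W, hW, hWc, hWZ, hv, hd⟩ := h
  refine le_antisymm (iSup₂_le fun W' hW' => ?_) ?_
  · obtain ⟨h2, h3, h4, h5⟩ := hW'
    rw [isClosed_iff_zclosed] at h4
    rw [isIrreducible_iff_zirred] at h5
    rw [dimOf_eq_zdim h5 h4]
    exact_mod_cast h1 W' h5 h4 h2 h3
  · rw [← hd, ← dimOf_eq_zdim hW hWc]
    exact le_iSup₂_of_le W ⟨hWZ, hv, isClosed_iff_zclosed.2 hWc, isIrreducible_iff_zirred.2 hW⟩
      le_rfl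

theorem HasDimAt.isSmoothAt_iff {Z : Set E} {v : E} {d : ℕ} (h : HasDimAt Z v d) (hv : v ∈ Z) :
    IsSmoothAt Z v ↔ Module.finrank ℂ (tangentSpace Z v) = d := by
  rw [IsSmoothAt, h.localDim_eq]
  refine ⟨fun h => ?_, fun h => ⟨hv, by rw [h]⟩⟩
  exact_mod_cast h.2

theorem HasDimAt.le_finrank {Z : Set E} {v : E} {d : ℕ} (h : HasDimAt Z v d) :
    d ≤ Module.finrank ℂ (tangentSpace Z v) := by
  obtain ⟨-, W, hW, hWc, hWZ, hv, rfl⟩ := h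
  exact (zdim_le_finrank_tangentSpace hW hv).trans (Submodule.finrank_mono (tangentSpace_mono hWZ v))

theorem ZIrred.hasDimAt {Z : Set E} (hZ : ZIrred Z) (hZc : ZClosed Z) {v : E} (hv : v ∈ Z) :
    HasDimAt Z v (zdim Z) :=
  ⟨fun _ hW hWc hWZ _ => zdim_mono hZ hW hWc hWZ, Z, hZ, hZc, subset_rfl, hv, rfl⟩

variable [FiniteDimensional ℂ F]

theorem zdim_image {φ : E →ₗ[ℂ] F} {C : Set E} (hinj : Set.InjOn φ C)
    (hc : ∀ W ⊆ C, ZClosed W → ZClosed (φ '' W)) {W : Set E} (hW : W ⊆ C) (hWc : ZClosed W)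
    (hWi : ZIrred W) : zdim (φ '' W) = zdim W := by
  have h : dimOf (affineZariski F) (φ '' W) = dimOf (affineZariski E) W := by
    let _ := affineZariski E
    let _ := affineZariski F
    symm
    let f : W → φ '' W := fun w => ⟨φ w, w, w.2, rfl⟩
    have hcl : ∀ {Z : Set F}, IsClosed Z ↔ ZClosed Z := isClosed_iff_zclosed
    have hcl' : ∀ {Z : Set E}, IsClosed Z ↔ ZClosed Z := isClosed_iff_zclosed
    refine IsHomeomorph.topologicalKrullDim_eq f ?_
    rw [isHomeomorph_iff_continuous_isClosedMap_bijective]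
    refine ⟨?_, ?_, ?_, ?_⟩
    · refine Continuous.subtype_mk (Continuous.comp ?_ continuous_subtype_val) _
      exact continuous_iff_isClosed.2 fun Z hZ =>
        hcl'.2 ((hcl.1 hZ).preimage (isPolyMap_linear φ))
    · intro S hS
      obtain ⟨A, hA, rfl⟩ := isClosed_induced_iff.1 hS
      refine isClosed_induced_iff.2 ⟨φ '' (W ∩ A), hcl.2 (hc _ (Set.inter_subset_left.trans hW)
        (hWc.inter (hcl'.1 hA))), ?_⟩
      ext y
      constructor
      · rintro ⟨w, hw, he⟩
        exact ⟨⟨w, hw.1⟩, hw.2, Subtype.ext he⟩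
      · rintro ⟨w, hw, rfl⟩
        exact ⟨w, ⟨w.2, hw⟩, rfl⟩
    · intro w w' h
      exact Subtype.ext (hinj (hW w.2) (hW w'.2) (congrArg Subtype.val h))
    · rintro ⟨_, w, hw, rfl⟩
      exact ⟨⟨w, hw⟩, rfl⟩
  rw [dimOf_eq_zdim hWi hWc, dimOf_eq_zdim ((zirred_image_iff hinj hc hW hWc).2 hWi)
    (hc W hW hWc)] at h
  exact_mod_cast h

/-- Local dimensions are preserved by linear maps that are injective and closed. -/
theorem hasDimAt_image_iff {φ : E →ₗ[ℂ] F} {C : Set E} (hCc : ZClosed C) (hinj : Set.InjOn φ C)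
    (hc : ∀ W ⊆ C, ZClosed W → ZClosed (φ '' W)) {v : E} (hv : v ∈ C) {d : ℕ} :
    HasDimAt (φ '' C) (φ v) d ↔ HasDimAt C v d := by
  have hpre : ∀ W' ⊆ φ '' C, ZClosed W' → ∃ W ⊆ C, ZClosed W ∧ φ '' W = W' := fun W' h hW' => by
    refine ⟨C ∩ φ ⁻¹' W', Set.inter_subset_left, hCc.inter (hW'.preimage (isPolyMap_linear φ)), ?_⟩
    rw [Set.image_inter_preimage, Set.inter_eq_right.2 h]
  have hmem : ∀ W ⊆ C, φ v ∈ φ '' W → v ∈ W := fun W hW => by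
    rintro ⟨w, hw, he⟩
    rwa [← hinj (hW hw) hv he]
  constructor
  · rintro ⟨h1, W', hW', hW'c, hWC, hvW, hd⟩
    refine ⟨fun W hW hWc hWC hvW => ?_, ?_⟩
    · rw [← zdim_image hinj hc hWC hWc hW]
      exact h1 _ (hW.image (isPolyMap_linear φ)) (hc W hWC hWc) (Set.image_mono hWC) ⟨v, hvW, rfl⟩
    · obtain ⟨W, hW, hWc, rfl⟩ := hpre W' hWC hW'c
      have hWi := (zirred_image_iff hinj hc hW hWc).1 hW'
      exact ⟨W, hWi, hWc, hW, hmem W hW hvW, by rw [← zdim_image hinj hc hW hWc hWi, hd]⟩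
  · rintro ⟨h1, W, hW, hWc, hWC, hvW, hd⟩
    refine ⟨fun W' hW' hW'c hWC' hvW' => ?_, ?_⟩
    · obtain ⟨W, hW, hWc, rfl⟩ := hpre W' hWC' hW'c
      have hWi := (zirred_image_iff hinj hc hW hWc).1 hW'
      rw [zdim_image hinj hc hW hWc hWi]
      exact h1 W hWi hWc hW (hmem W hW hvW')
    · exact ⟨φ '' W, hW.image (isPolyMap_linear φ), hc W hWC hWc, Set.image_mono hWC,
        ⟨v, hvW, rfl⟩, by rw [zdim_image hinj hc hWC hWc hW, hd]⟩

end LocalDim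

/-! ### Cones and homogeneous components -/

section Cone

open Polynomial

variable {E F : Type*} [AddCommGroup E] [Module ℂ E] [AddCommGroup F] [Module ℂ F]

/-- Evaluation of polynomial functions at a point. -/
def evalAt (v : E) : polyFun E →ₐ[ℂ] ℂ :=
  (Pi.evalAlgHom ℂ (fun _ : E => ℂ) v).comp (polyFun E).val

/-- The restriction of a polynomial function to a line with a parametrization that depends
linearly on `v`, as a polynomial in the parameter with coefficients that are polynomial in `v`. -/
theorem exists_polynomial_eval (π : E →ₗ[ℂ] F) (τ : E →ₗ[ℂ] ℂ) (s : F →ₗ[ℂ] E) (e : E)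
    (hsτ : ∀ v, s (π v) + τ v • e = v) {f : E → ℂ} (hf : f ∈ polyFun E) :
    ∃ P : (polyFun F)[X], ∀ v, (P.map (evalAt (π v)).toRingHom).eval (τ v) = f v := by
  induction hf using Algebra.adjoin_induction with
  | mem f hf =>
    obtain ⟨l, rfl⟩ := hf
    refine ⟨C ⟨_, dual_mem_polyFun (l ∘ₗ s)⟩ + X * C (algebraMap ℂ _ (l e)), fun v => ?_⟩
    have h : (evalAt (π v)).toRingHom ⟨_, dual_mem_polyFun (l ∘ₗ s)⟩ = l (s (π v)) := rfl
    have h' : (evalAt (π v)).toRingHom (algebraMap ℂ _ (l e)) = l e := (evalAt (π v)).commutes _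
    rw [Polynomial.map_add, Polynomial.map_mul, map_X, map_C, map_C, eval_add, eval_mul, eval_X,
      eval_C, eval_C, h, h', ← smul_eq_mul, ← map_smul, ← map_add, hsτ]
  | algebraMap c =>
    refine ⟨C (algebraMap ℂ _ c), fun v => ?_⟩
    have h' : (evalAt (π v)).toRingHom (algebraMap ℂ _ c) = c := (evalAt (π v)).commutes _
    rw [map_C, eval_C, h']; rfl
  | add f g _ _ ihf ihg =>
    obtain ⟨P, hP⟩ := ihf
    obtain ⟨Q, hQ⟩ := ihg
    exact ⟨P + Q, fun v => by rw [Polynomial.map_add, eval_add, hP, hQ]; rfl⟩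
  | mul f g _ _ ihf ihg =>
    obtain ⟨P, hP⟩ := ihf
    obtain ⟨Q, hQ⟩ := ihg
    exact ⟨P * Q, fun v => by rw [Polynomial.map_mul, eval_mul, hP, hQ]; rfl⟩

/-- The homogeneous components of a polynomial function, as the coefficients of a polynomial. -/
theorem exists_graded {f : E → ℂ} (hf : f ∈ polyFun E) :
    ∃ P : (polyFun E)[X], (∀ v t, (P.map (evalAt v).toRingHom).eval t = f (t • v)) ∧
      ∀ d, IsHomog (P.coeff d).1 d := by
  suffices h : ∃ P : (polyFun E)[X], ∀ v t, (P.map (evalAt v).toRingHom).eval t = f (t • v) by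
    obtain ⟨P, hP⟩ := h
    refine ⟨P, hP, fun d t v => ?_⟩
    have h : P.map (evalAt (t • v)).toRingHom =
        (P.map (evalAt v).toRingHom).comp (C t * X) := by
      refine Polynomial.funext fun r => ?_
      rw [hP, eval_comp, eval_mul, eval_C, eval_X, hP, smul_smul, mul_comm]
    have h2 := congrArg (fun p => p.coeff d) h
    simp only [comp_C_mul_X_coeff, coeff_map] at h2
    exact h2.trans (mul_comm _ _)
  induction hf using Algebra.adjoin_induction with
  | mem f hf =>
    obtain ⟨l, rfl⟩ := hf
    refine ⟨X * C ⟨_, dual_mem_polyFun l⟩, fun v t => ?_⟩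
    have h : (evalAt v).toRingHom ⟨_, dual_mem_polyFun l⟩ = l v := rfl
    rw [Polynomial.map_mul, map_X, map_C, eval_mul, eval_X, eval_C, h, ← smul_eq_mul,
      ← map_smul]
  | algebraMap c =>
    refine ⟨C (algebraMap ℂ _ c), fun v t => ?_⟩
    have h' : (evalAt v).toRingHom (algebraMap ℂ _ c) = c := (evalAt v).commutes _
    rw [map_C, eval_C, h']; rfl
  | add f g _ _ ihf ihg =>
    obtain ⟨P, hP⟩ := ihf
    obtain ⟨Q, hQ⟩ := ihg
    exact ⟨P + Q, fun v t => by rw [Polynomial.map_add, eval_add, hP, hQ]; rfl⟩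
  | mul f g _ _ ihf ihg =>
    obtain ⟨P, hP⟩ := ihf
    obtain ⟨Q, hQ⟩ := ihg
    exact ⟨P * Q, fun v t => by rw [Polynomial.map_mul, eval_mul, hP, hQ]; rfl⟩

/-- A nonzero value of a polynomial function is witnessed by a homogeneous component. -/
theorem exists_homog_component {f : E → ℂ} (hf : f ∈ polyFun E) {v : E} (hv : f v ≠ 0) :
    ∃ g ∈ polyFun E, ∃ d, IsHomog g d ∧ g v ≠ 0 ∧
      ∀ w, (∀ t : ℂ, t ≠ 0 → f (t • w) = 0) → g w = 0 := by
  obtain ⟨P, hP, hd⟩ := exists_graded hf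
  have h : P.map (evalAt v).toRingHom ≠ 0 := fun h0 => hv (by
    rw [← one_smul ℂ v, ← hP, h0, eval_zero])
  obtain ⟨d, hdv⟩ : ∃ d, (P.map (evalAt v).toRingHom).coeff d ≠ 0 := by
    by_contra! hn
    exact h (Polynomial.ext fun n => by rw [hn, coeff_zero])
  rw [coeff_map] at hdv
  refine ⟨_, (P.coeff d).2, d, hd d, hdv, fun w hw => ?_⟩
  have h0 : P.map (evalAt w).toRingHom = 0 := by
    refine eq_zero_of_infinite_isRoot _ (Set.Infinite.mono ?_ (Set.finite_singleton (0 : ℂ)).infinite_compl)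
    intro t ht
    exact (hP w t).trans (hw t ht)
  have := congrArg (fun p => p.coeff d) h0
  simp only [coeff_map, coeff_zero] at this
  exact this

/-- A line through the origin is irreducible. -/
theorem eq_zero_or_eq_zero_on_line {f g : E → ℂ} (hf : f ∈ polyFun E) (hg : g ∈ polyFun E) {v : E}
    (h : ∀ t : ℂ, f (t • v) * g (t • v) = 0) : (∀ t : ℂ, f (t • v) = 0) ∨ ∀ t : ℂ, g (t • v) = 0 := by
  obtain ⟨P, hP, -⟩ := exists_graded hf
  obtain ⟨Q, hQ, -⟩ := exists_graded hg
  have h0 : P.map (evalAt v).toRingHom * Q.map (evalAt v).toRingHom = 0 :=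
    Polynomial.funext fun t => by rw [eval_mul, hP, hQ, h, eval_zero]
  refine (mul_eq_zero.1 h0).imp (fun h t => ?_) fun h t => ?_
  · rw [← hP, h, eval_zero]
  · rw [← hQ, h, eval_zero]

theorem zirred_univ : ZIrred (Set.univ : Set E) := by
  refine ⟨⟨0, trivial⟩, fun f hf g hg h => ?_⟩
  by_contra! hn
  unfold VanishesOn at hn
  push Not at hn
  obtain ⟨⟨v, -, hv⟩, ⟨w, -, hw⟩⟩ := hn
  have hφ : IsPolyMap fun x : E => v + x := (isPolyMap_const v).add isPolyMap_id
  have hpoly : ∀ {f : E → ℂ}, f ∈ polyFun E → ∃ p : ℂ[X], ∀ t : ℂ, p.eval t = f (v + t • (w - v)) := by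
    intro f hf
    obtain ⟨P, hP, -⟩ := exists_graded (comp_mem_polyFun hφ hf)
    exact ⟨_, hP (w - v)⟩
  obtain ⟨p, hp⟩ := hpoly hf
  obtain ⟨q, hq⟩ := hpoly hg
  have h0 : p * q = 0 := Polynomial.funext fun t => by
    rw [eval_mul, hp, hq, eval_zero]; exact h _ trivial
  rcases mul_eq_zero.1 h0 with h0 | h0
  · apply hv
    have := hp 0
    rwa [h0, eval_zero, zero_smul, add_zero, eq_comm] at this
  · apply hw
    have := hq 1
    rwa [h0, eval_zero, one_smul, add_sub_cancel, eq_comm] at this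

/-- Sets stable under scaling. -/
def IsCone (C : Set E) : Prop := ∀ t : ℂ, ∀ v ∈ C, t • v ∈ C

theorem IsHomog.mul {f g : E → ℂ} {c d : ℕ} (hf : IsHomog f c) (hg : IsHomog g d) :
    IsHomog (fun v => f v * g v) (c + d) := fun t v => by
  simp only [hf t v, hg t v, smul_eq_mul]; ring

/-- A point outside a closed cone is separated from it by a homogeneous polynomial. -/
theorem IsCone.exists_homog {C : Set E} (hC : IsCone C) (hCc : ZClosed C) {v : E} (hv : v ∉ C) :
    ∃ g ∈ polyFun E, ∃ d, IsHomog g d ∧ g v ≠ 0 ∧ VanishesOn g C := by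
  obtain ⟨f, hf, hfC, hfv⟩ := hCc.exists_of_notMem hv
  obtain ⟨g, hg, d, hd, hgv, h⟩ := exists_homog_component hf hfv
  exact ⟨g, hg, d, hd, hgv, fun w hw => h w fun t _ => hfC _ (hC t w hw)⟩

/-- Multiples of a vector have the same tangent spaces to a cone. -/
theorem IsCone.tangentSpace_smul {C : Set E} (hC : IsCone C) {c : ℂ} (hc : c ≠ 0) (v : E) :
    tangentSpace C (c • v) = tangentSpace C v := by
  have key : ∀ (c : ℂ) (_ : c ≠ 0) (v : E), tangentSpace C v ≤ tangentSpace C (c • v) := by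
    intro c hc v w hw
    have h := mem_tangentSpace_of_mapsTo_linear (c • LinearMap.id : E →ₗ[ℂ] E) (hC c) hw
    have h2 := (tangentSpace C (c • v)).smul_mem c⁻¹ h
    rwa [LinearMap.smul_apply, LinearMap.id_apply, smul_smul, inv_mul_cancel₀ hc, one_smul] at h2
  refine le_antisymm ?_ (key c hc v)
  have := key c⁻¹ (inv_ne_zero hc) (c • v)
  rwa [smul_smul, inv_mul_cancel₀ hc, one_smul] at this

theorem IsCone.mem_tangentSpace {C : Set E} (hC : IsCone C) {v : E} (hv : v ∈ C) :
    v ∈ tangentSpace C v := by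
  intro f hf hfC
  have h : HasLineDerivAt ℂ f 0 v v := by
    have : (fun t : ℂ => f (v + t • v)) = fun _ => 0 := funext fun t => by
      have h := hfC _ (hC (1 + t) v hv)
      rwa [add_smul, one_smul] at h
    unfold HasLineDerivAt
    rw [this]
    exact hasDerivAt_const 0 0
  exact h.lineDeriv

/-! ### Closed subsets of projective space -/

theorem isCone_cone (X : Set (ℙ ℂ E)) : IsCone (cone X) := by
  intro t v hv h
  have hv0 : v ≠ 0 := fun h0 => h (by rw [h0, smul_zero])
  have ht : t ≠ 0 := fun h0 => h (by rw [h0, zero_smul])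
  rw [show Projectivization.mk ℂ (t • v) h = Projectivization.mk ℂ v hv0 from
    (Projectivization.mk_eq_mk_iff' ℂ _ _ _ _).2 ⟨t, rfl⟩]
  exact hv hv0

theorem zero_mem_cone (X : Set (ℙ ℂ E)) : (0 : E) ∈ cone X := fun h => absurd rfl h

theorem rep_mem_cone {X : Set (ℙ ℂ E)} {p : ℙ ℂ E} : p.rep ∈ cone X ↔ p ∈ X :=
  ⟨fun h => by have := h p.rep_nonzero; rwa [p.mk_rep] at this, fun h _ => by rwa [p.mk_rep]⟩

theorem exists_smul_rep {v : E} (hv : v ≠ 0) :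
    ∃ c : ℂ, c ≠ 0 ∧ (Projectivization.mk ℂ v hv).rep = c • v := by
  obtain ⟨a, ha⟩ := Projectivization.exists_smul_eq_mk_rep ℂ v hv
  exact ⟨a, a.ne_zero, ha.symm⟩

theorem IsCone.smul_mem_iff {C : Set E} (hC : IsCone C) {c : ℂ} (hc : c ≠ 0) {v : E} :
    c • v ∈ C ↔ v ∈ C :=
  ⟨fun h => by simpa [smul_smul, hc] using hC c⁻¹ _ h, hC c v⟩

theorem IsHomog.eq_zero_iff {f : E → ℂ} {d : ℕ} (hf : IsHomog f d) {c : ℂ} (hc : c ≠ 0) (v : E) :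
    f (c • v) = 0 ↔ f v = 0 := by
  rw [hf c v, smul_eq_zero]
  simp [hc]

theorem isTopologicalBasis_projZariski :
    @TopologicalSpace.IsTopologicalBasis (ℙ ℂ E) (projZariski E)
      {U | ∃ f ∈ polyFun E, ∃ d : ℕ, IsHomog f d ∧ U = {p : ℙ ℂ E | f p.rep ≠ 0}} := by
  let _ := projZariski E
  refine ⟨?_, ?_, rfl⟩
  · rintro _ ⟨f, hf, c, hc, rfl⟩ _ ⟨g, hg, d, hd, rfl⟩ p hp
    exact ⟨_, ⟨_, mul_mem_polyFun hf hg, c + d, hc.mul hd, rfl⟩, mul_ne_zero hp.1 hp.2,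
      fun q hq => ⟨left_ne_zero_of_mul hq, right_ne_zero_of_mul hq⟩⟩
  · refine Set.eq_univ_of_forall fun p => Set.mem_sUnion.2 ⟨_, ⟨_, const_mem_polyFun 1, 0,
      fun t v => by simp, rfl⟩, ?_⟩
    exact one_ne_zero

theorem isClosed_projZariski_iff {X : Set (ℙ ℂ E)} :
    IsClosed[projZariski E] X ↔ ∀ p, p ∉ X →
      ∃ f ∈ polyFun E, ∃ d : ℕ, IsHomog f d ∧ f p.rep ≠ 0 ∧ ∀ q ∈ X, f q.rep = 0 := by
  let _ := projZariski E
  rw [← isOpen_compl_iff, isTopologicalBasis_projZariski.isOpen_iff]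
  refine forall₂_congr fun p hp => ⟨?_, ?_⟩
  · rintro ⟨_, ⟨f, hf, d, hd, rfl⟩, hp, h⟩
    refine ⟨f, hf, d, hd, hp, fun q hq => ?_⟩
    by_contra hn
    exact h hn hq
  · rintro ⟨f, hf, d, hd, hp, h⟩
    exact ⟨_, ⟨f, hf, d, hd, rfl⟩, hp, fun q hq hqX => hq (h q hqX)⟩

/-- Closed subsets of projective space are those with a closed cone. -/
theorem isClosed_iff_zclosed_cone {X : Set (ℙ ℂ E)} :
    IsClosed[projZariski E] X ↔ ZClosed (cone X) := by
  rw [isClosed_projZariski_iff]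
  constructor
  · intro h v hv
    by_contra hvX
    have hv0 : v ≠ 0 := fun h0 => hvX (h0 ▸ zero_mem_cone X)
    obtain ⟨c, hc, hrep⟩ := exists_smul_rep hv0
    obtain ⟨f, hf, d, hd, hfv, hfX⟩ := h (Projectivization.mk ℂ v hv0) fun hX => hvX fun _ => hX
    rw [hrep, Ne, hd.eq_zero_iff hc] at hfv
    obtain ⟨l, hl⟩ := Module.Projective.exists_dual_ne_zero ℂ hv0
    -- the linear factor takes care of the origin
    have h2 := hv _ (mul_mem_polyFun hf (dual_mem_polyFun l)) fun w hw => by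
      by_cases hw0 : w = 0
      · simp [hw0]
      · obtain ⟨c, hc, hrep⟩ := exists_smul_rep hw0
        have := hfX _ (hw hw0)
        rw [hrep, hd.eq_zero_iff hc] at this
        rw [this, zero_mul]
    exact mul_ne_zero hfv hl h2
  · intro h p hp
    obtain ⟨f, hf, d, hd, hfp, hfX⟩ := (isCone_cone X).exists_homog h (v := p.rep)
      (fun h => hp (rep_mem_cone.1 h))
    exact ⟨f, hf, d, hd, hfp, fun q hq => hfX _ (rep_mem_cone.2 hq)⟩

theorem isClosed_setOf_rep_mem {C : Set E} (hC : IsCone C) (hCc : ZClosed C) :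
    IsClosed[projZariski E] {p : ℙ ℂ E | p.rep ∈ C} := by
  rw [isClosed_projZariski_iff]
  intro p hp
  obtain ⟨f, hf, d, hd, hfp, hfX⟩ := hC.exists_homog hCc hp
  exact ⟨f, hf, d, hd, hfp, fun q hq => hfX _ hq⟩

/-- The cone over an irreducible set is irreducible, since the lines in it are: if a product of two
polynomials vanishes on the cone, then one of them vanishes on the line of each point. -/
theorem zirred_cone {X : Set (ℙ ℂ E)} (hX : @IsIrreducible _ (projZariski E) X) :
    ZIrred (cone X) := by
  let _ := projZariski E
  refine ⟨⟨0, zero_mem_cone X⟩, fun f hf g hg h => ?_⟩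
  have hcl : ∀ f ∈ polyFun E, IsClosed {p : ℙ ℂ E | ∀ t : ℂ, f (t • p.rep) = 0} := fun f hf => by
    rw [isClosed_projZariski_iff]
    intro p hp
    have hp : ¬ ∀ t : ℂ, f (t • p.rep) = 0 := hp
    push Not at hp
    obtain ⟨t, ht⟩ := hp
    obtain ⟨g, hg, d, hd, hgv, h⟩ := exists_homog_component hf ht
    refine ⟨g, hg, d, hd, fun h0 => hgv ?_, fun q hq => h _ fun t _ => hq t⟩
    rw [hd t, h0, smul_zero]
  have hsub : X ⊆ {p : ℙ ℂ E | ∀ t : ℂ, f (t • p.rep) = 0} ∪ {p | ∀ t : ℂ, g (t • p.rep) = 0} :=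
    fun p hp => eq_zero_or_eq_zero_on_line hf hg fun t =>
      h _ (isCone_cone X t _ (rep_mem_cone.2 hp))
  have hvan : ∀ f : E → ℂ, X ⊆ {p : ℙ ℂ E | ∀ t : ℂ, f (t • p.rep) = 0} → VanishesOn f (cone X) := by
    intro f hf v hv
    by_cases hv0 : v = 0
    · obtain ⟨p, hp⟩ := hX.nonempty
      have := hf hp 0
      rwa [zero_smul, ← hv0] at this
    · obtain ⟨c, hc, hrep⟩ := exists_smul_rep hv0
      have := hf (hv hv0) c⁻¹
      rwa [hrep, smul_smul, inv_mul_cancel₀ hc, one_smul] at this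
  exact (isPreirreducible_iff_isClosed_union_isClosed.1 hX.isPreirreducible _ _ (hcl f hf) (hcl g hg)
    hsub).imp (hvan f) (hvan g)

theorem noetherianSpace_projZariski [FiniteDimensional ℂ E] :
    @TopologicalSpace.NoetherianSpace (ℙ ℂ E) (projZariski E) := by
  let _ := affineZariski E
  let _ := projZariski E
  have := noetherianSpace_affineZariski (E := E)
  have : TopologicalSpace.NoetherianSpace {v : E // v ≠ 0} :=
    Topology.IsInducing.subtypeVal.noetherianSpace
  refine TopologicalSpace.noetherianSpace_of_surjective
    (fun v : {v : E // v ≠ 0} => Projectivization.mk ℂ v.1 v.2) ?_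
    fun p => ⟨⟨p.rep, p.rep_nonzero⟩, p.mk_rep⟩
  refine isTopologicalBasis_projZariski.continuous_iff.2 ?_
  rintro _ ⟨f, hf, d, hd, rfl⟩
  have h : IsOpen {v : E | f v ≠ 0} := TopologicalSpace.isOpen_generateFrom_of_mem ⟨f, hf, rfl⟩
  convert h.preimage continuous_subtype_val using 1
  ext v
  obtain ⟨c, hc, hrep⟩ := exists_smul_rep v.2
  change f (Projectivization.mk ℂ v.1 v.2).rep ≠ 0 ↔ _
  rw [hrep, Ne, hd.eq_zero_iff hc]
  rfl

/-! ### General hyperplanes -/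

/-- A property holds for a general hyperplane if it follows from the non-vanishing of a nonzero
polynomial at some equation of the hyperplane. -/
theorem forGeneralHyperplane_of_ne_zero (Φ : E ≃ₗ[ℂ] Module.Dual ℂ E) [Nontrivial E]
    {f : E → ℂ} (hf : f ∈ polyFun E) (hf0 : ∃ v, f v ≠ 0) {P : ℙ ℂ (Module.Dual ℂ E) → Prop}
    (hP : ∀ H e (c : ℂ), f e ≠ 0 → c ≠ 0 → Φ e = c • H.rep → P H) : ForGeneralHyperplane P := by
  obtain ⟨w, hw⟩ := exists_ne (0 : E)
  obtain ⟨l, hl⟩ := Module.Projective.exists_dual_ne_zero ℂ hw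
  obtain ⟨v, -, hfv, hlv⟩ := zirred_univ.exists_ne_zero hf (dual_mem_polyFun l)
    (hf0.imp fun _ h => ⟨trivial, h⟩) ⟨w, trivial, hl⟩
  obtain ⟨g, hg, d, hd, hgv, h⟩ := exists_homog_component hf hfv
  have hv0 : Φ v ≠ 0 := fun h0 => hlv (by rw [(map_eq_zero_iff _ Φ.injective).1 h0, map_zero])
  have hd' : IsHomog (fun m => g (Φ.symm m)) d := fun t m => by
    simp only [map_smul]; exact hd t _
  refine ⟨{H | g (Φ.symm H.rep) ≠ 0}, TopologicalSpace.isOpen_generateFrom_of_mem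
    ⟨_, comp_mem_polyFun (isPolyMap_linear Φ.symm.toLinearMap) hg, d, hd', rfl⟩,
    ⟨Projectivization.mk ℂ (Φ v) hv0, ?_⟩, fun H hH => ?_⟩
  · obtain ⟨c, hc, hrep⟩ := exists_smul_rep hv0
    change g (Φ.symm (Projectivization.mk ℂ (Φ v) hv0).rep) ≠ 0
    rw [hrep, map_smul, Φ.symm_apply_apply, Ne, hd.eq_zero_iff hc]
    exact hgv
  · obtain ⟨t, ht, hft⟩ : ∃ t : ℂ, t ≠ 0 ∧ f (t • Φ.symm H.rep) ≠ 0 := by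
      by_contra! hn
      exact hH (h _ hn)
    exact hP H _ t hft ht (by rw [map_smul, Φ.apply_symm_apply])

end Cone

/-! ### Linear projections of cones from a point -/

section Projection

open Polynomial

variable {E Q : Type*} [AddCommGroup E] [Module ℂ E] [AddCommGroup Q] [Module ℂ Q]

/-- Nakayama's lemma for quotients of `A[X]` by a submodule `N` that contains the multiples of a
monic polynomial: if the fibre of the quotient at `φ` vanishes, then so does the quotient after
multiplication by a suitable `g` with `φ g = 1`. -/
theorem exists_smul_mem_of_fibre {A k : Type*} [CommRing A] [CommRing k] [Nontrivial k] (φ : A →+* k) {P : A[X]}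
    (hP : P.Monic) (N : Submodule A A[X]) (hN : ∀ R, P * R ∈ N)
    (h : ∀ R : A[X], ∃ S ∈ N, R.map φ = S.map φ) : ∃ g : A, φ g = 1 ∧ ∀ R : A[X], g • R ∈ N := by
  classical
  have := φ.domain_nontrivial
  have hm : ∀ R : A[X], R.map φ = 0 → R ∈ RingHom.ker φ • (⊤ : Submodule A A[X]) := fun R hR => by
    rw [← R.sum_monomial_eq, Polynomial.sum]
    refine Submodule.sum_mem _ fun i _ => ?_
    rw [← mul_one (R.coeff i), ← smul_eq_mul, ← smul_monomial]
    refine Submodule.smul_mem_smul ?_ trivial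
    have := congrArg (fun p => p.coeff i) hR
    rw [RingHom.mem_ker]
    simpa only [coeff_map, coeff_zero] using this
  have hfg : (degreeLT A P.natDegree).FG := by
    rw [degreeLT_eq_span_X_pow]
    exact ⟨_, rfl⟩
  have h1 : (⊤ : Submodule A A[X]) ≤ N ⊔ degreeLT A P.natDegree := fun R _ => by
    rw [← modByMonic_add_div R P, add_comm]
    refine Submodule.add_mem_sup (hN _) ?_
    rw [mem_degreeLT, ← degree_eq_natDegree hP.ne_zero]
    exact degree_modByMonic_lt R hP
  have h2 : RingHom.ker φ • (⊤ : Submodule A A[X]) ≤ N ⊔ RingHom.ker φ • degreeLT A P.natDegree := by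
    refine (Submodule.smul_mono le_rfl h1).trans ?_
    rw [Submodule.smul_sup]
    exact sup_le_sup_right Submodule.smul_le_right _
  have h3 : (⊤ : Submodule A A[X]) ≤ N ⊔ RingHom.ker φ • degreeLT A P.natDegree := fun R _ => by
    obtain ⟨S, hS, hRS⟩ := h R
    rw [← sub_add_cancel R S]
    exact Submodule.add_mem _ (h2 (hm _ (by rw [Polynomial.map_sub, hRS, sub_self])))
      (Submodule.mem_sup_left hS)
  obtain ⟨g, hg, hgN⟩ := Submodule.exists_sub_one_mem_and_smul_le_of_fg_of_le_sup hfg le_top h3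
  refine ⟨g, ?_, fun R => hgN (Submodule.smul_mem_pointwise_smul R g _ trivial)⟩
  rwa [RingHom.mem_ker, map_sub, map_one, sub_eq_zero] at hg

/-- A splitting of a linear projection `π` whose kernel is the line spanned by `e`: a section `s`
and a coordinate `τ` along the kernel. -/
structure LineSplitting (π : E →ₗ[ℂ] Q) (e : E) where
  /-- The section of the projection. -/
  s : Q →ₗ[ℂ] E
  /-- The coordinate along the kernel. -/
  τ : E →ₗ[ℂ] ℂ
  proj : ∀ (y : Q) (t : ℂ), π (s y + t • e) = y
  coord : ∀ (y : Q) (t : ℂ), τ (s y + t • e) = t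
  split : ∀ v : E, s (π v) + τ v • e = v

theorem LineSplitting.nonempty {π : E →ₗ[ℂ] Q} (hπ : Function.Surjective π) {e : E} (he : e ≠ 0)
    (hker : LinearMap.ker π = ℂ ∙ e) : Nonempty (LineSplitting π e) := by
  obtain ⟨s, hs⟩ := π.exists_rightInverse_of_surjective (LinearMap.range_eq_top.2 hπ)
  have hs : ∀ y, π (s y) = y := fun y => LinearMap.congr_fun hs y
  have hπe : π e = 0 := by
    rw [← LinearMap.mem_ker, hker]; exact Submodule.mem_span_singleton_self e
  obtain ⟨l, hl⟩ := Module.Projective.exists_dual_ne_zero ℂ he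
  let τ : E →ₗ[ℂ] ℂ := (l e)⁻¹ • (l - l ∘ₗ s ∘ₗ π)
  have hτ : ∀ v, τ v = (l e)⁻¹ * (l v - l (s (π v))) := fun v => rfl
  refine ⟨⟨s, τ, fun y t => ?_, fun y t => ?_, fun v => ?_⟩⟩
  · rw [map_add, hs, map_smul, hπe, smul_zero, add_zero]
  · rw [hτ, map_add π, hs, map_smul π, hπe, smul_zero, add_zero, map_add, map_smul, smul_eq_mul]
    field_simp
    ring
  · have : v - s (π v) ∈ ℂ ∙ e := by
      rw [← hker, LinearMap.mem_ker, map_sub, hs, sub_self]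
    obtain ⟨c, hc⟩ := Submodule.mem_span_singleton.1 this
    rw [hτ, ← map_sub, ← hc, map_smul, smul_eq_mul, mul_comm c, inv_mul_cancel_left₀ hl, hc]
    abel

variable {π : E →ₗ[ℂ] Q} {e : E} (σ : LineSplitting π e)

namespace LineSplitting

theorem proj_s (y : Q) : π (σ.s y) = y := by simpa using σ.proj y 0

theorem proj_e (σ : LineSplitting π e) : π e = 0 := by simpa using σ.proj 0 1

/-- The value at `v` of a polynomial in the coordinate along the kernel of the projection, with
coefficients that are polynomial functions on the target. -/
noncomputable def evalPoly (v : E) : (polyFun Q)[X] →+* ℂ :=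
  eval₂RingHom (evalAt (π v)).toRingHom (σ.τ v)

theorem evalPoly_eq (v : E) (P : (polyFun Q)[X]) :
    σ.evalPoly v P = (P.map (evalAt (π v)).toRingHom).eval (σ.τ v) := by
  rw [eval_map]; rfl

theorem evalPoly_C (v : E) (a : polyFun Q) : σ.evalPoly v (C a) = a.1 (π v) :=
  eval₂_C _ _

theorem evalPoly_X (v : E) : σ.evalPoly v X = σ.τ v := eval₂_X _ _

theorem exists_evalPoly {f : E → ℂ} (hf : f ∈ polyFun E) :
    ∃ P : (polyFun Q)[X], ∀ v, σ.evalPoly v P = f v := by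
  obtain ⟨P, hP⟩ := exists_polynomial_eval π σ.τ σ.s e σ.split hf
  exact ⟨P, fun v => by rw [evalPoly_eq, hP]⟩

/-- The ideal of `Z` in the coordinate ring `(polyFun Q)[X]` of the source of the projection. -/
noncomputable def idealOn (Z : Set E) : Ideal (polyFun Q)[X] :=
  ⨅ v ∈ Z, RingHom.ker (σ.evalPoly v)

theorem mem_idealOn {Z : Set E} {P : (polyFun Q)[X]} :
    P ∈ σ.idealOn Z ↔ ∀ v ∈ Z, σ.evalPoly v P = 0 := by
  simp [idealOn, Submodule.mem_iInf, RingHom.mem_ker]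

theorem evalPoly_line (y : Q) (t : ℂ) (P : (polyFun Q)[X]) :
    σ.evalPoly (σ.s y + t • e) P = (P.map (evalAt y).toRingHom).eval t := by
  rw [evalPoly_eq, σ.proj, σ.coord]

/-- A cone without the centre `e` of the projection satisfies a monic equation: a homogeneous
equation of the cone that does not vanish at `e` has constant leading coefficient along `e`. -/
theorem exists_monic {Z : Set E} (hZ : IsCone Z) (hZc : ZClosed Z) (he : e ∉ Z) :
    ∃ P ∈ σ.idealOn Z, P.Monic := by
  obtain ⟨F, hF, d, hd, hFe, hFZ⟩ := hZ.exists_homog hZc he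
  obtain ⟨P, hP⟩ := σ.exists_evalPoly hF
  have hline : ∀ y t, (P.map (evalAt y).toRingHom).eval t = F (σ.s y + t • e) := fun y t => by
    rw [← σ.evalPoly_line, hP]
  -- homogeneity of `F` gives the degrees of the coefficients
  have hcoef : ∀ k y (r : ℂ), r ^ k * (P.coeff k).1 (r • y) = r ^ d * (P.coeff k).1 y := by
    intro k y r
    have h : (P.map (evalAt (r • y)).toRingHom).comp (C r * X) =
        C (r ^ d) * P.map (evalAt y).toRingHom := by
      refine Polynomial.funext fun t => ?_
      rw [eval_comp, eval_mul, eval_C, eval_X, hline, eval_mul, eval_C, hline, map_smul, mul_smul,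
        ← smul_add, hd, smul_eq_mul]
    have h2 := congrArg (fun p => p.coeff k) h
    simp only [comp_C_mul_X_coeff, coeff_map, coeff_C_mul] at h2
    rw [mul_comm]
    exact h2
  have hcoef' : ∀ k y, ∃ p : ℂ[X], X ^ k * p = C ((P.coeff k).1 y) * X ^ d ∧
      ∀ r, p.eval r = (P.coeff k).1 (r • y) := by
    intro k y
    obtain ⟨R, hR, -⟩ := exists_graded (P.coeff k).2
    refine ⟨_, Polynomial.funext fun r => ?_, hR y⟩
    rw [eval_mul, eval_pow, eval_X, hR y, hcoef, eval_mul, eval_C, eval_pow, eval_X, mul_comm]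
  have hgt : ∀ k, d < k → P.coeff k = 0 := fun k hk => by
    ext y
    obtain ⟨p, hp, -⟩ := hcoef' k y
    have := congrArg (fun p => p.coeff d) hp
    simp only [coeff_C_mul, coeff_X_pow, if_true, mul_one, coeff_X_pow_mul', if_neg hk.not_ge] at this
    exact this.symm
  have hconst : ∀ y, (P.coeff d).1 y = F e := fun y => by
    obtain ⟨p, hp, hpr⟩ := hcoef' d y
    rw [mul_comm (C _)] at hp
    have hp : p = C ((P.coeff d).1 y) := mul_left_cancel₀ (pow_ne_zero d X_ne_zero) hp
    have h0 := hpr 0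
    rw [hp, eval_C, zero_smul] at h0
    rw [h0]
    have hq : P.map (evalAt (0 : Q)).toRingHom = C (F e) * X ^ d := by
      refine Polynomial.funext fun t => ?_
      rw [hline, map_zero, zero_add, hd, eval_mul, eval_C, eval_pow, eval_X, smul_eq_mul, mul_comm]
    have := congrArg (fun p => p.coeff d) hq
    simp only [coeff_map, coeff_C_mul, coeff_X_pow, if_true, mul_one] at this
    exact this
  refine ⟨C (algebraMap ℂ _ (F e)⁻¹) * P, Ideal.mul_mem_left _ _ (σ.mem_idealOn.2 fun v hv => ?_),
    monic_of_natDegree_le_of_coeff_eq_one d ?_ ?_⟩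
  · rw [hP]; exact hFZ v hv
  · refine natDegree_C_mul_le _ _ |>.trans (natDegree_le_iff_coeff_eq_zero.2 fun k hk => hgt k hk)
  · rw [coeff_C_mul]
    ext y
    have : (algebraMap ℂ (polyFun Q) (F e)⁻¹ * P.coeff d).1 y = (F e)⁻¹ * (P.coeff d).1 y := rfl
    rw [this, hconst, inv_mul_cancel₀ hFe]; rfl

/-- The restriction to the fibre over `y` of the ideal of a closed set is generated by one polynomial,
whose roots are points of the set. -/
theorem exists_generator_fibre {Z : Set E} (hZc : ZClosed Z) (y : Q) :
    ∃ p : ℂ[X], (∃ P ∈ σ.idealOn Z, P.map (evalAt y).toRingHom = p) ∧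
      (∀ P ∈ σ.idealOn Z, p ∣ P.map (evalAt y).toRingHom) ∧
      ∀ t, p.eval t = 0 → σ.s y + t • e ∈ Z := by
  let I := (σ.idealOn Z).map (mapRingHom (evalAt y).toRingHom)
  have hsurj : Function.Surjective (mapRingHom (evalAt y).toRingHom) :=
    map_surjective _ fun c => ⟨algebraMap ℂ _ c, (evalAt y).commutes c⟩
  obtain ⟨p, hp⟩ := (IsPrincipalIdealRing.principal I).principal
  have hpI : p ∈ I := by rw [hp]; exact Submodule.mem_span_singleton_self p
  have hdvd : ∀ P ∈ σ.idealOn Z, p ∣ P.map (evalAt y).toRingHom := fun P hP => by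
    have : mapRingHom (evalAt y).toRingHom P ∈ I := Ideal.mem_map_of_mem _ hP
    rw [hp] at this
    exact Ideal.mem_span_singleton.1 this
  refine ⟨p, ?_, hdvd, fun t ht => hZc _ fun f hf hfZ => ?_⟩
  · obtain ⟨P, hP, h⟩ := (Ideal.mem_map_iff_of_surjective _ hsurj).1 hpI
    exact ⟨P, hP, h⟩
  · obtain ⟨P, hP⟩ := σ.exists_evalPoly hf
    obtain ⟨q, hq⟩ := hdvd P (σ.mem_idealOn.2 fun v hv => by rw [hP]; exact hfZ v hv)
    rw [← hP, evalPoly_line, hq, eval_mul, ht, zero_mul]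

/-- The projection of a cone from a point outside it is closed: over a point `y` outside the image
the fibre of the coordinate ring vanishes, so by Nakayama's lemma the coordinate ring is killed by a
polynomial that is `1` at `y`. -/
theorem zclosed_image (σ : LineSplitting π e) {Z : Set E} (hZ : IsCone Z) (hZc : ZClosed Z) (he : e ∉ Z) {W : Set E}
    (hWZ : W ⊆ Z) (hW : ZClosed W) : ZClosed (π '' W) := by
  intro y hy
  by_contra hn
  obtain ⟨P, hP, hPm⟩ := σ.exists_monic hZ hZc he
  obtain ⟨p, ⟨R₀, hR₀, hR₀p⟩, hdvd, hroot⟩ := σ.exists_generator_fibre hW y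
  have hPW : P ∈ σ.idealOn W := σ.mem_idealOn.2 fun v hv => σ.mem_idealOn.1 hP v (hWZ hv)
  have hp0 : p ≠ 0 := fun h0 => by
    have := hdvd P hPW
    rw [h0, zero_dvd_iff] at this
    exact (hPm.map _).ne_zero this
  have hpu : IsUnit p := by
    by_contra hu
    obtain ⟨t, ht⟩ := IsAlgClosed.exists_root p fun h => hu (isUnit_iff_degree_eq_zero.2 h)
    exact hn ⟨_, hroot t ht, σ.proj y t⟩
  obtain ⟨q, hq⟩ := hpu.exists_right_inv
  obtain ⟨g, hgy, hg⟩ := exists_smul_mem_of_fibre (evalAt y).toRingHom hPm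
    ((σ.idealOn W).restrictScalars (polyFun Q)) (fun R => Ideal.mul_mem_right _ _ hPW) fun R => ⟨R * R₀ * q.map (algebraMap ℂ (polyFun Q)),
      Ideal.mul_mem_right _ _ (Ideal.mul_mem_left _ _ hR₀), by
      have : (q.map (algebraMap ℂ (polyFun Q))).map (evalAt y).toRingHom = q := by
        rw [Polynomial.map_map]
        convert Polynomial.map_id
        ext c
        exact (evalAt y).commutes c
      rw [Polynomial.map_mul, Polynomial.map_mul, hR₀p, this, mul_assoc, hq, mul_one]⟩
  have hgy : g.1 y = 1 := hgy
  refine one_ne_zero (hgy.symm.trans (hy g.1 g.2 ?_))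
  rintro _ ⟨v, hv, rfl⟩
  have := σ.mem_idealOn.1 (hg 1) v hv
  rwa [smul_eq_C_mul, mul_one, evalPoly_C] at this

/-- The inverse of an injective projection of a cone is given, near a point at which the centre is
not a tangent direction, by a quotient of homogeneous polynomials: the fibre through the point is
then reduced to it as a scheme, so by Nakayama's lemma the coordinate ring is generated by `1` over
the functions on the target, locally. -/
theorem exists_local_inverse {Z : Set E} (hZ : IsCone Z) (hZc : ZClosed Z) (he : e ∉ Z)
    (hinj : Set.InjOn π Z) {x : E} (hx : x ∈ Z) (hex : e ∉ tangentSpace Z x) :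
    ∃ g ∈ polyFun Q, ∃ b ∈ polyFun Q, ∃ d, IsHomog g d ∧ IsHomog b (d + 1) ∧ g (π x) ≠ 0 ∧
      ∀ v ∈ Z, g (π v) * σ.τ v = b (π v) := by
  obtain ⟨P, hP, hPm⟩ := σ.exists_monic hZ hZc he
  obtain ⟨p, ⟨R₀, hR₀, hR₀p⟩, hdvd, hroot⟩ := σ.exists_generator_fibre hZc (π x)
  have hp0 : p ≠ 0 := fun h0 => by
    have := hdvd P hP
    rw [h0, zero_dvd_iff] at this
    exact (hPm.map _).ne_zero this
  have hroot' : ∀ t, p.eval t = 0 → t = σ.τ x := fun t ht => by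
    have h1 := hinj (hroot t ht) hx (σ.proj _ t)
    rw [← h1, σ.coord]
  -- the fibre is a reduced point since the centre is not tangent
  have hnd : ¬ (X - C (σ.τ x)) ^ 2 ∣ p := by
    intro h
    apply hex
    intro f hf hfZ
    obtain ⟨R, hR⟩ := σ.exists_evalPoly hf
    obtain ⟨q, hq⟩ := h.trans (hdvd R (σ.mem_idealOn.2 fun v hv => by rw [hR]; exact hfZ v hv))
    have hline : ∀ t : ℂ, f (x + t • e) = t * (t * q.eval (σ.τ x + t)) := fun t => by
      have h1 := σ.evalPoly_line (π x) (σ.τ x + t) R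
      rw [hR, add_smul, ← add_assoc, σ.split, hq] at h1
      rw [h1]
      simp
      ring
    have hder : HasDerivAt (fun t : ℂ => t * (t * q.eval (σ.τ x + t)))
        (1 * (0 * q.eval (σ.τ x + 0)) + 0 * deriv (fun t : ℂ => t * q.eval (σ.τ x + t)) 0) 0 := by
      refine HasDerivAt.mul (hasDerivAt_id (0 : ℂ)) (DifferentiableAt.hasDerivAt ?_)
      fun_prop
    have : HasLineDerivAt ℂ f 0 x e := by
      unfold HasLineDerivAt
      simp_rw [hline]
      simpa using hder
    exact this.lineDeriv
  have hline : ∀ R : (polyFun Q)[X],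
      (R.map (evalAt (π x)).toRingHom).eval (σ.τ x) = σ.evalPoly x R := fun R => by
    rw [← σ.evalPoly_line, σ.split]
  obtain ⟨q, hq⟩ : X - C (σ.τ x) ∣ p := by
    rw [dvd_iff_isRoot, IsRoot, ← hR₀p, hline]
    exact σ.mem_idealOn.1 hR₀ x hx
  have hq0 : q ≠ 0 := fun h => hp0 (by rw [hq, h, mul_zero])
  -- by injectivity the fibre has no other point either, so `X - τ x` generates its ideal
  have hqu : IsUnit q := by
    by_contra hu
    obtain ⟨t, ht⟩ := IsAlgClosed.exists_root q fun h => hu (isUnit_iff_degree_eq_zero.2 h)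
    rw [hroot' t (by rw [hq, eval_mul, ht.eq_zero, mul_zero])] at ht
    obtain ⟨q', hq'⟩ := dvd_iff_isRoot.2 ht
    exact hnd ⟨q', by rw [hq, hq', pow_two, mul_assoc]⟩
  obtain ⟨q', hq'⟩ := hqu.exists_right_inv
  have hlift : ∀ q : ℂ[X], (q.map (algebraMap ℂ (polyFun Q))).map (evalAt (π x)).toRingHom = q := by
    intro q
    rw [Polynomial.map_map]
    convert Polynomial.map_id
    ext c
    exact (evalAt (π x)).commutes c
  obtain ⟨g, hgx, hg⟩ := exists_smul_mem_of_fibre (evalAt (π x)).toRingHom hPm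
    ((σ.idealOn Z).restrictScalars (polyFun Q) ⊔ (polyFun Q) ∙ (1 : (polyFun Q)[X]))
    (fun R => Submodule.mem_sup_left (Ideal.mul_mem_right _ _ hP)) fun R => by
      obtain ⟨r, hr⟩ : X - C (σ.τ x) ∣ R.map (evalAt (π x)).toRingHom - C (σ.evalPoly x R) := by
        rw [dvd_iff_isRoot, IsRoot, eval_sub, eval_C, hline, sub_self]
      refine ⟨R₀ * (q' * r).map (algebraMap ℂ (polyFun Q)) +
        (algebraMap ℂ (polyFun Q) (σ.evalPoly x R)) • 1, Submodule.add_mem_sup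
        (Ideal.mul_mem_right _ _ hR₀) (Submodule.smul_mem _ _ (Submodule.mem_span_singleton_self _)),
        ?_⟩
      have h1 : (evalAt (π x)).toRingHom (algebraMap ℂ (polyFun Q) (σ.evalPoly x R)) =
        σ.evalPoly x R := (evalAt (π x)).commutes _
      rw [Polynomial.map_add, Polynomial.map_mul, hlift, hR₀p, hq, mul_assoc, ← mul_assoc q, hq',
        one_mul, ← hr, smul_eq_C_mul, mul_one, map_C, h1, sub_add_cancel]
  obtain ⟨R, hR, S, hS, hRS⟩ := Submodule.mem_sup.1 (hg X)
  obtain ⟨b, rfl⟩ := Submodule.mem_span_singleton.1 hS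
  have hgb : ∀ v ∈ Z, g.1 (π v) * σ.τ v = b.1 (π v) := fun v hv => by
    have h := congrArg (σ.evalPoly v) hRS
    rw [map_add, σ.mem_idealOn.1 hR v hv, zero_add, smul_eq_C_mul, mul_one, smul_eq_C_mul, map_mul,
      evalPoly_C, evalPoly_C, evalPoly_X] at h
    exact h.symm
  -- homogeneous components of `g` and `b`
  obtain ⟨G, hG, hGd⟩ := exists_graded g.2
  obtain ⟨B, hB, hBd⟩ := exists_graded b.2
  obtain ⟨d, hd⟩ : ∃ d, (G.map (evalAt (π x)).toRingHom).coeff d ≠ 0 := by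
    by_contra! hn
    have h0 : G.map (evalAt (π x)).toRingHom = 0 := Polynomial.ext fun n => by rw [hn, coeff_zero]
    have hgx : g.1 (π x) = 1 := hgx
    refine one_ne_zero (hgx.symm.trans ?_)
    rw [← one_smul ℂ (π x), ← hG, h0, eval_zero]
  rw [coeff_map] at hd
  refine ⟨_, (G.coeff d).2, _, (B.coeff (d + 1)).2, d, hGd d, hBd (d + 1), hd, fun v hv => ?_⟩
  have h : X * (G.map (evalAt (π v)).toRingHom * C (σ.τ v)) = B.map (evalAt (π v)).toRingHom := by
    refine Polynomial.funext fun t => ?_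
    rw [eval_mul, eval_mul, eval_X, eval_C, hG, hB, ← map_smul, ← hgb _ (hZ t v hv), map_smul σ.τ,
      smul_eq_mul]
    ring
  have h2 := congrArg (fun p => p.coeff (d + 1)) h
  simp only [coeff_X_mul, coeff_mul_C, coeff_map] at h2
  exact h2

end LineSplitting
end Projection

/-! ### Tangent spaces of projections, and projections that are isomorphisms -/

section ProjectionGeometry

variable {E Q : Type*} [AddCommGroup E] [Module ℂ E] [AddCommGroup Q] [Module ℂ Q]
  {π : E →ₗ[ℂ] Q} {e : E}

namespace LineSplitting

/-- The tangent spaces of the projection of a cone are the projections of its tangent spaces, where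
the centre is not tangent: the local inverse maps tangent vectors back. -/
theorem tangentSpace_image (σ : LineSplitting π e) {Z : Set E} (hZ : IsCone Z) (hZc : ZClosed Z)
    (he : e ∉ Z) (hinj : Set.InjOn π Z) {x : E} (hx : x ∈ Z) (hex : e ∉ tangentSpace Z x) :
    tangentSpace (π '' Z) (π x) = (tangentSpace Z x).map π := by
  refine le_antisymm (fun u hu => ?_) ?_
  · obtain ⟨g, hg, b, hb, d, hgd, hbd, hgx, hgb⟩ := σ.exists_local_inverse hZ hZc he hinj hx hex
    -- the polynomial lift `y ↦ g y • s y + b y • e` of the cone `π '' Z`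
    have h1 := HasPolyDeriv.add (IsPolyMap.smul hg (isPolyMap_linear σ.s))
      (IsPolyMap.smul hb (isPolyMap_const e))
      (HasPolyDeriv.smul (isPolyMap_linear σ.s) hg (hasPolyDeriv_linear σ.s (π x) u))
      (HasPolyDeriv.smul (isPolyMap_const e) hb (u := 0) fun l => by
        rw [lineDeriv_poly_const, map_zero])
    have hlift : ∀ v ∈ Z, g (π v) • σ.s (π v) + b (π v) • e = g (π v) • v := fun v hv => by
      rw [← hgb v hv, mul_smul, ← smul_add, σ.split]
    have h2 := mem_tangentSpace_of_mapsTo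
      ((IsPolyMap.smul hg (isPolyMap_linear σ.s)).add (IsPolyMap.smul hb (isPolyMap_const e)))
      (Z' := Z) (by rintro _ ⟨v, hv, rfl⟩; rw [hlift v hv]; exact hZ _ _ hv) h1 hu
    rw [hlift x hx, hZ.tangentSpace_smul hgx] at h2
    have h3 := (tangentSpace Z x).sub_mem h2
      ((tangentSpace Z x).smul_mem (lineDeriv ℂ g (π x) u) (hZ.mem_tangentSpace hx))
    refine ⟨_, (tangentSpace Z x).smul_mem (g (π x))⁻¹ h3, ?_⟩
    simp only [map_smul, map_sub, map_add, σ.proj_e, σ.proj_s, smul_zero, add_zero]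
    rw [add_sub_cancel_left, smul_smul, inv_mul_cancel₀ hgx, one_smul]
  · rintro _ ⟨v, hv, rfl⟩
    exact mem_tangentSpace_of_mapsTo_linear π (fun z hz => Set.mem_image_of_mem π hz) hv

theorem finrank_map_eq (σ : LineSplitting π e) {T : Submodule ℂ E} (he : e ∉ T) :
    Module.finrank ℂ (T.map π) = Module.finrank ℂ T := by
  have hinj : Function.Injective (π.domRestrict T) := by
    refine (injective_iff_map_eq_zero _).2 fun v hv => Subtype.ext ?_
    have h1 : π v = 0 := hv
    have h2 := σ.split v
    rw [h1, map_zero, zero_add] at h2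
    by_contra hv0
    have hτ : σ.τ v ≠ 0 := fun h => hv0 (by rw [← h2, h, zero_smul]; rfl)
    apply he
    have h3 := T.smul_mem (σ.τ v)⁻¹ v.2
    rwa [show (σ.τ v)⁻¹ • (v : E) = (σ.τ v)⁻¹ • (σ.τ v • e) by rw [h2], smul_smul,
      inv_mul_cancel₀ hτ, one_smul] at h3
  rw [← LinearMap.finrank_range_of_inj hinj, LinearMap.range_domRestrict]

end LineSplitting

theorem cone_projImage (π : E →ₗ[ℂ] Q) (S : Set (ℙ ℂ E)) :
    cone (projImage π S) = π '' cone S := by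
  ext v
  constructor
  · intro hv
    by_cases hv0 : v = 0
    · exact ⟨0, zero_mem_cone S, by rw [map_zero, hv0]⟩
    · obtain ⟨p, hp, hp0, h⟩ := hv hv0
      obtain ⟨c, hc⟩ := (Projectivization.mk_eq_mk_iff' ℂ _ _ _ _).1 h
      exact ⟨c • p.rep, isCone_cone S c _ (rep_mem_cone.2 hp), by rw [map_smul, hc]⟩
  · rintro ⟨x, hx, rfl⟩ hv0
    have hx0 : x ≠ 0 := fun h => hv0 (by rw [h, map_zero])
    obtain ⟨c, hc, hrep⟩ := exists_smul_rep hx0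
    refine ⟨_, hx hx0, by rw [hrep, map_smul]; exact smul_ne_zero hc hv0, ?_⟩
    rw [Projectivization.mk_eq_mk_iff']
    exact ⟨c⁻¹, by rw [hrep, map_smul, smul_smul, inv_mul_cancel₀ hc, one_smul]⟩

/-- An injective projection of a cone is an isomorphism over the points at which the centre of the
projection is not a tangent direction. -/
theorem LineSplitting.projectsIsomorphically (σ : LineSplitting π e) {Z : Set E} (hZ : IsCone Z)
    (hZc : ZClosed Z) (he : e ∉ Z) (hinj : Set.InjOn π Z) {S : Set (ℙ ℂ E)}
    (hS : ∀ p ∈ S, p.rep ∈ Z ∧ e ∉ tangentSpace Z p.rep) :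
    ProjectsIsomorphically π S (projImage π S) := by
  have h0 : ∀ p : S, π p.1.rep ≠ 0 := fun p h => p.1.rep_nonzero
    (hinj (hS p p.2).1 (by simpa using hZ 0 _ (hS p p.2).1) (by rw [h, map_zero]))
  let f : S → projImage π S := fun p => ⟨Projectivization.mk ℂ _ (h0 p), p, p.2, h0 p, rfl⟩
  have hf : Function.Bijective f := by
    refine ⟨fun p q h => ?_, ?_⟩
    · obtain ⟨c, hc⟩ := (Projectivization.mk_eq_mk_iff' ℂ _ _ _ _).1 (congrArg Subtype.val h)
      rw [← map_smul] at hc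
      have h1 := hinj (hZ c _ (hS q q.2).1) (hS p p.2).1 hc
      refine Subtype.ext ?_
      rw [← p.1.mk_rep, ← q.1.mk_rep, Projectivization.mk_eq_mk_iff']
      exact ⟨c, h1⟩
    · rintro ⟨_, p, hp, hp0, rfl⟩
      exact ⟨⟨p, hp⟩, rfl⟩
  let eqv := Equiv.ofBijective f hf
  refine ⟨eqv, fun p => ⟨h0 p, rfl⟩, fun p => ?_, fun q => ?_⟩
  · refine ⟨Set.univ, @isOpen_univ _ (projZariski E), trivial, π, 1, isPolyMap_linear π,
      fun t v => by rw [map_smul, pow_one], fun q _ => ⟨h0 q, rfl⟩⟩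
  · obtain ⟨p, rfl⟩ := eqv.surjective q
    obtain ⟨hpZ, hpe⟩ := hS p p.2
    obtain ⟨g, hg, b, hb, d, hgd, hbd, hgx, hgb⟩ := σ.exists_local_inverse hZ hZc he hinj hpZ hpe
    have hlift : ∀ v ∈ Z, g (π v) • σ.s (π v) + b (π v) • e = g (π v) • v := fun v hv => by
      rw [← hgb v hv, mul_smul, ← smul_add, σ.split]
    have hrep : ∀ p : S, ∃ c : ℂ, c ≠ 0 ∧ (eqv p).1.rep = π (c • p.1.rep) := fun p => by
      obtain ⟨c, hc, h⟩ := exists_smul_rep (h0 p)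
      exact ⟨c, hc, by rw [map_smul]; exact h⟩
    refine ⟨{q | g q.rep ≠ 0}, TopologicalSpace.isOpen_generateFrom_of_mem ⟨g, hg, d, hgd, rfl⟩, ?_,
      fun y => g y • σ.s y + b y • e, d + 1,
      (IsPolyMap.smul hg (isPolyMap_linear σ.s)).add (IsPolyMap.smul hb (isPolyMap_const e)),
      fun t y => ?_, fun q hq => ?_⟩
    · obtain ⟨c, hc, h⟩ := hrep p
      change g (eqv p).1.rep ≠ 0
      rw [h, map_smul, Ne, hgd.eq_zero_iff hc]
      exact hgx
    · beta_reduce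
      rw [hgd, hbd, map_smul, smul_eq_mul, smul_eq_mul, smul_add, smul_smul, smul_smul, smul_smul]
      ring_nf
    · obtain ⟨p', rfl⟩ := eqv.surjective q
      obtain ⟨c, hc, h⟩ := hrep p'
      have hq : g (eqv p').1.rep ≠ 0 := hq
      have h1 : g (eqv p').1.rep • σ.s (eqv p').1.rep + b (eqv p').1.rep • e =
          (g (eqv p').1.rep * c) • p'.1.rep := by
        rw [h, hlift _ (hZ c _ (hS p' p'.2).1), smul_smul]
      refine ⟨by beta_reduce; rw [h1]; exact smul_ne_zero (mul_ne_zero hq hc) p'.1.rep_nonzero, ?_⟩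
      beta_reduce
      rw [eqv.symm_apply_apply]
      conv_lhs => rw [← p'.1.mk_rep]
      rw [Projectivization.mk_eq_mk_iff']
      refine ⟨(g (eqv p').1.rep * c)⁻¹, ?_⟩
      rw [h1, smul_smul, inv_mul_cancel₀ (mul_ne_zero hq hc), one_smul]

end ProjectionGeometry

/-! ### Lagrangian subspaces -/

section Lagrangian

variable {V : Type*} [AddCommGroup V] [Module ℂ V] [FiniteDimensional ℂ V]
  {ω : LinearMap.BilinForm ℂ V}

theorem orthogonal_eq_of_isotropic (hω : IsSymplectic ω) {T : Submodule ℂ V}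
    (hT : ∀ u ∈ T, ∀ w ∈ T, ω u w = 0) (hd : 2 * Module.finrank ℂ T = Module.finrank ℂ V) :
    ω.orthogonal T = T := by
  symm
  refine Submodule.eq_of_le_of_finrank_eq (fun w hw => ?_) ?_
  · rw [LinearMap.BilinForm.mem_orthogonal_iff]
    exact fun u hu => hT u hu w hw
  · rw [LinearMap.BilinForm.finrank_orthogonal hω.nondegenerate]
    omega

/-- Lagrangian subspaces are maximal isotropic; half the dimension of the space is enough. -/
theorem isLagrangian_of_isotropic (hω : IsSymplectic ω) {T : Submodule ℂ V}
    (hT : ∀ u ∈ T, ∀ w ∈ T, ω u w = 0) (hd : 2 * Module.finrank ℂ T = Module.finrank ℂ V) :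
    IsLagrangian ω T := by
  refine ⟨hT, fun M hM hTM u hu => ?_⟩
  rw [← orthogonal_eq_of_isotropic hω hT hd, LinearMap.BilinForm.mem_orthogonal_iff]
  exact fun w hw => hM w (hTM hw) u hu

/-- A Lagrangian subspace equals its orthogonal, since it contains each vector orthogonal to it. -/
theorem IsLagrangian.finrank_eq (hω : IsSymplectic ω) {L : Submodule ℂ V}
    (hL : IsLagrangian ω L) : 2 * Module.finrank ℂ L = Module.finrank ℂ V := by
  have h1 : ω.orthogonal L = L := by
    refine le_antisymm (fun x hx => ?_) fun w hw => ?_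
    · rw [LinearMap.BilinForm.mem_orthogonal_iff] at hx
      refine hL.2 (y := L ⊔ ℂ ∙ x) (fun u hu w hw => ?_) le_sup_left
        (Submodule.mem_sup_right (Submodule.mem_span_singleton_self x))
      obtain ⟨u, hu', _, hx', rfl⟩ := Submodule.mem_sup.1 hu
      obtain ⟨w, hw', _, hx'', rfl⟩ := Submodule.mem_sup.1 hw
      obtain ⟨a, rfl⟩ := Submodule.mem_span_singleton.1 hx'
      obtain ⟨b, rfl⟩ := Submodule.mem_span_singleton.1 hx''
      have hxw : ω x w = 0 := hω.alt.isRefl _ _ (hx w hw')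
      have hxx : ω x x = 0 := hω.alt x
      simp [hL.1 u hu' w hw', hx u hu', hxw, hxx]
    · rw [LinearMap.BilinForm.mem_orthogonal_iff]
      exact fun u hu => hL.1 u hu w hw
  have h2 := LinearMap.BilinForm.finrank_orthogonal hω.nondegenerate L
  rw [h1] at h2
  have := Submodule.finrank_le L
  omega

/-- The equation `ω x y = 0` for pairs, differentiated along a tangent vector. -/
theorem bilin_tangentSpace {A : Set (V × V)} (hA : ∀ p ∈ A, ω p.1 p.2 = 0) {p v : V × V}
    (hv : v ∈ tangentSpace A p) : ω v.1 p.2 + ω p.1 v.2 = 0 := by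
  have h : HasLineDerivAt ℂ (fun p : V × V => ω p.1 p.2) (ω v.1 p.2 + ω p.1 v.2) p v := by
    have h1 : HasDerivAt (fun t : ℂ => ω p.1 p.2 + id t * (ω v.1 p.2 + ω p.1 v.2) + t ^ 2 * ω v.1 v.2)
        (1 * (ω v.1 p.2 + ω p.1 v.2) + (2 * 0 ^ 1) * ω v.1 v.2) 0 :=
      (((hasDerivAt_id (0 : ℂ)).mul_const _).const_add _).add
        ((hasDerivAt_pow 2 (0 : ℂ)).mul_const _)
    unfold HasLineDerivAt
    have e1 : (fun t : ℂ => ω (p + t • v).1 (p + t • v).2) =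
        fun t => ω p.1 p.2 + t * (ω v.1 p.2 + ω p.1 v.2) + t ^ 2 * ω v.1 v.2 := by
      ext t
      simp
      ring
    rw [e1]
    have e2 : 1 * (ω v.1 p.2 + ω p.1 v.2) + (2 * 0 ^ 1) * ω v.1 v.2 =
        ω v.1 p.2 + ω p.1 v.2 := by ring
    rw [e2] at h1
    exact h1
  rw [← h.lineDeriv]
  exact hv _ (bilin_mem_polyFun ω (isPolyMap_linear (LinearMap.fst ℂ V V))
    (isPolyMap_linear (LinearMap.snd ℂ V V))) hA

end Lagrangian

/-! ### Vectors in general position -/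

section GeneralPosition

variable {E F : Type*} [AddCommGroup E] [Module ℂ E] [AddCommGroup F] [Module ℂ F]

theorem exists_mul_ne_zero {f g : E → ℂ} (hf : f ∈ polyFun E) (hg : g ∈ polyFun E)
    (hf0 : ∃ v, f v ≠ 0) (hg0 : ∃ v, g v ≠ 0) : ∃ v, f v * g v ≠ 0 := by
  obtain ⟨v, -, h1, h2⟩ := zirred_univ.exists_ne_zero hf hg (hf0.imp fun _ h => ⟨trivial, h⟩)
    (hg0.imp fun _ h => ⟨trivial, h⟩)
  exact ⟨v, mul_ne_zero h1 h2⟩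

/-- To see that the images under `φ` of the points of `S` with a property `bad` are not dense, it
is enough to consider the irreducible subsets of `S` that are dominant over the target. -/
theorem exists_poly_of_irreducible_subsets [FiniteDimensional ℂ E] {S : Set E} (φ : E →ₗ[ℂ] F)
    (bad : E → Prop) (h : ∀ A ⊆ S, ZIrred A →
      (∀ g ∈ polyFun F, (∀ w ∈ A, g (φ w) = 0) → ∀ y, g y = 0) → ∀ p ∈ zariskiClosure A, ¬ bad p) :
    ∃ f ∈ polyFun F, (∃ v, f v ≠ 0) ∧ ∀ p ∈ zariskiClosure S, bad p → f (φ p) = 0 := by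
  obtain ⟨𝒜, hfin, h𝒜, rfl⟩ := exists_finite_zirred S
  replace h : ∀ A ∈ 𝒜, ZIrred A ∧ ((∀ g ∈ polyFun F, (∀ w ∈ A, g (φ w) = 0) → ∀ y, g y = 0) →
    ∀ p ∈ zariskiClosure A, ¬ bad p) := fun A hA => ⟨(h𝒜 A hA).1, h A (h𝒜 A hA).2 (h𝒜 A hA).1⟩
  clear h𝒜
  induction 𝒜, hfin using Set.Finite.induction_on with
  | empty =>
    refine ⟨_, const_mem_polyFun 1, ⟨0, one_ne_zero⟩, fun p hp => ?_⟩
    rw [Set.sUnion_empty] at hp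
    exact (zclosed_empty p hp).elim
  | @insert A s ha hs ih =>
    obtain ⟨f, hf, hf0, hfs⟩ := ih fun B hB => h B (Set.mem_insert_of_mem _ hB)
    obtain ⟨hA, hbad⟩ := h A (Set.mem_insert _ _)
    obtain ⟨g, hg, hg0, hgA⟩ : ∃ g ∈ polyFun F, (∃ v, g v ≠ 0) ∧
        ∀ p ∈ zariskiClosure A, bad p → g (φ p) = 0 := by
      by_cases hdom : ∀ g ∈ polyFun F, (∀ w ∈ A, g (φ w) = 0) → ∀ y, g y = 0
      · exact ⟨_, const_mem_polyFun 1, ⟨0, one_ne_zero⟩, fun p hp hb => (hbad hdom p hp hb).elim⟩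
      · push Not at hdom
        obtain ⟨g, hg, hgA, y, hy⟩ := hdom
        exact ⟨g, hg, ⟨y, hy⟩, fun p hp _ => hp _ (comp_mem_polyFun (isPolyMap_linear φ) hg) hgA⟩
    refine ⟨_, mul_mem_polyFun hg hf, exists_mul_ne_zero hg hf hg0 hf0, fun p hp hb => ?_⟩
    have : p ∈ zariskiClosure A ∪ zariskiClosure (⋃₀ s) := by
      refine ((zclosed_zariskiClosure A).union (zclosed_zariskiClosure _)).zariskiClosure_subset ?_ hp
      rw [Set.sUnion_insert]
      exact Set.union_subset_union (subset_zariskiClosure _) (subset_zariskiClosure _)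
    rcases this with hp | hp
    · rw [hgA p hp hb, zero_mul]
    · rw [hfs p hp hb, mul_zero]

variable {V : Type*} [AddCommGroup V] [Module ℂ V] [FiniteDimensional ℂ V]
  {ω : LinearMap.BilinForm ℂ V}

/-- The pairs of a point of `C` at which the tangent space has dimension `d`, and a tangent
vector at this point. -/
def tangentPairs (C : Set V) (d : ℕ) : Set (V × V) :=
  {p | p.1 ∈ C ∧ Module.finrank ℂ (tangentSpace C p.1) = d ∧ p.2 ∈ tangentSpace C p.1}

/-- A general vector is not a limit of tangent vectors at points of a Legendrian cone that converge
to a nonzero vector. If such limits were dense, then at a general pair `(x, h)` of a point and a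
tangent vector the variation `h'` of `h` would be arbitrary; but `ω x h = 0` for all pairs, which
differentiates to `ω x h' = 0`, and `x = 0` follows. -/
theorem exists_poly_tangentPairs (hω : IsSymplectic ω) {C : Set V} (hC : IsCone C) {d : ℕ}
    (hL : ∀ x ∈ C, Module.finrank ℂ (tangentSpace C x) = d →
      ∀ u ∈ tangentSpace C x, ∀ w ∈ tangentSpace C x, ω u w = 0) :
    ∃ f ∈ polyFun V, (∃ v, f v ≠ 0) ∧
      ∀ p ∈ zariskiClosure (tangentPairs C d), p.1 ≠ 0 → f p.2 = 0 := by
  refine exists_poly_of_irreducible_subsets (LinearMap.snd ℂ V V) (fun p => p.1 ≠ 0) ?_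
  intro A hA hAi hdom p hp hp0
  obtain ⟨g, hg, hgA, h⟩ := generic_smoothness hAi (LinearMap.snd ℂ V V) hdom
  obtain ⟨l, hl⟩ := Module.Projective.exists_dual_ne_zero ℂ hp0
  have hl1 : ∃ w ∈ A, l w.1 ≠ 0 := by
    by_contra! hn
    exact hl (hp _ (dual_mem_polyFun (l ∘ₗ LinearMap.fst ℂ V V)) hn)
  obtain ⟨w, hw, hgw, hlw⟩ := hAi.exists_ne_zero hg
    (dual_mem_polyFun (l ∘ₗ LinearMap.fst ℂ V V)) hgA hl1
  have hz : ∀ q ∈ A, ω q.1 q.2 = 0 := fun q hq =>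
    hL _ (hA hq).1 (hA hq).2.1 _ (hC.mem_tangentSpace (hA hq).1) _ (hA hq).2.2
  have hw1 : ∀ y, ω w.1 y = 0 := fun y => by
    obtain ⟨v, hv, rfl⟩ := (h w hw hgw).2 y
    have h1 := bilin_tangentSpace hz hv
    have h2 : v.1 ∈ tangentSpace C w.1 :=
      mem_tangentSpace_of_mapsTo_linear (LinearMap.fst ℂ V V) (fun q hq => (hA hq).1) hv
    rwa [hL _ (hA hw).1 (hA hw).2.1 _ h2 _ (hA hw).2.2, zero_add] at h1
  have : w.1 = 0 := hω.nondegenerate.1 _ hw1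
  apply hlw
  change l w.1 = 0
  rw [this, map_zero]

theorem finrank_submodule_prod (S T : Submodule ℂ V) :
    Module.finrank ℂ (S.prod T) = Module.finrank ℂ S + Module.finrank ℂ T := by
  have hinj : Function.Injective (S.subtype.prodMap T.subtype) :=
    Prod.map_injective.2 ⟨S.injective_subtype, T.injective_subtype⟩
  rw [← Module.finrank_prod, ← LinearMap.finrank_range_of_inj hinj, LinearMap.range_prodMap,
    Submodule.range_subtype, Submodule.range_subtype]

/-- A general vector is not the sum of two orthogonal vectors of a Legendrian cone. If such sums were
dense, then by dimensions the tangent space at a general pair `(x, y)` of orthogonal vectors would be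
the whole product of the tangent spaces at `x` and `y`, with injective sum map. Differentiating
`ω x y = 0` in `x` puts `y` into the tangent space at `x`, which equals its orthogonal; so `(y, -y)`
is tangent, with sum zero, and `y = 0`. -/
theorem exists_poly_orthogonal_sum (hω : IsSymplectic ω) {C : Set V} (hC : IsCone C)
    (hCi : ZIrred C) (hCc : ZClosed C) (hd0 : zdim C ≠ 0)
    (hd : Module.finrank ℂ V = 2 * zdim C)
    (hL : ∀ x ∈ C, Module.finrank ℂ (tangentSpace C x) = zdim C →
      ∀ u ∈ tangentSpace C x, ∀ w ∈ tangentSpace C x, ω u w = 0) :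
    ∃ f ∈ polyFun V, (∃ v, f v ≠ 0) ∧ ∀ x ∈ C, ∀ y ∈ C, ω x y = 0 → f (x + y) = 0 := by
  suffices h : ∀ A ⊆ {p : V × V | p.1 ∈ C ∧ p.2 ∈ C ∧ ω p.1 p.2 = 0}, ZIrred A →
      ¬ ∀ g ∈ polyFun V, (∀ w ∈ A, g ((LinearMap.fst ℂ V V + LinearMap.snd ℂ V V) w) = 0) →
        ∀ y, g y = 0 by
    obtain ⟨f, hf, hf0, hfS⟩ := exists_poly_of_irreducible_subsets _ (fun _ => True)
      fun A hA hAi hdom _ _ _ => h A hA hAi hdom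
    exact ⟨f, hf, hf0, fun x hx y hy hxy =>
      hfS (x, y) (subset_zariskiClosure _ ⟨hx, hy, hxy⟩) trivial⟩
  intro A hA hAi hdom
  obtain ⟨g, hg, hgA, h⟩ := generic_smoothness hAi _ hdom
  -- the closures of the projections, and general points of them
  have hproj : ∀ φ : V × V →ₗ[ℂ] V, (∀ p ∈ A, φ p ∈ C) → ∃ W : Set V, W ⊆ C ∧ ZIrred W ∧
      ZClosed W ∧ W = zariskiClosure (φ '' A) ∧ ∃ g ∈ polyFun (V × V), (∃ w ∈ A, g w ≠ 0) ∧
        ∀ w ∈ A, g w ≠ 0 → Module.finrank ℂ (tangentSpace W (φ w)) = zdim W := by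
    intro φ hφ
    have hi := (hAi.image (isPolyMap_linear φ)).zariskiClosure
    obtain ⟨g, hg, hgW, h⟩ := exists_finrank_eq_zdim hi
    refine ⟨_, hCc.zariskiClosure_subset (by rintro _ ⟨p, hp, rfl⟩; exact hφ p hp), hi,
      zclosed_zariskiClosure _, rfl, _, comp_mem_polyFun (isPolyMap_linear φ) hg, ?_,
      fun w hw hgw => h _ (subset_zariskiClosure _ ⟨w, hw, rfl⟩) hgw⟩
    by_contra! hn
    obtain ⟨w, hw, hgw⟩ := hgW
    refine hgw ((vanishesOn_zariskiClosure hg).2 ?_ w hw)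
    rintro _ ⟨p, hp, rfl⟩
    exact hn p hp
  obtain ⟨W₁, hW₁, hW₁i, hW₁c, hW₁e, g₁, hg₁, hg₁A, h₁⟩ :=
    hproj (LinearMap.fst ℂ V V) fun p hp => (hA hp).1
  obtain ⟨W₂, hW₂, hW₂i, hW₂c, hW₂e, g₂, hg₂, hg₂A, h₂⟩ :=
    hproj (LinearMap.snd ℂ V V) fun p hp => (hA hp).2.1
  have hgen : ∀ w ∈ A, g w ≠ 0 → g₁ w ≠ 0 → g₂ w ≠ 0 → W₂ = C ∧ w.2 = 0 := by
    intro w hw hgw hg₁w hg₂w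
    let T := tangentSpace A w
    have hT : T ≤ (tangentSpace W₁ w.1).prod (tangentSpace W₂ w.2) := fun v hv =>
      ⟨mem_tangentSpace_of_mapsTo_linear (LinearMap.fst ℂ V V)
        (fun q hq => hW₁e ▸ subset_zariskiClosure _ ⟨q, hq, rfl⟩) hv,
      mem_tangentSpace_of_mapsTo_linear (LinearMap.snd ℂ V V)
        (fun q hq => hW₂e ▸ subset_zariskiClosure _ ⟨q, hq, rfl⟩) hv⟩
    let ψ : T →ₗ[ℂ] V := (LinearMap.fst ℂ V V + LinearMap.snd ℂ V V).domRestrict T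
    have hψ : Function.Surjective ψ := fun y => by
      obtain ⟨v, hv, hvy⟩ := (h w hw hgw).2 y
      exact ⟨⟨v, hv⟩, hvy⟩
    have hf1 : Module.finrank ℂ V ≤ Module.finrank ℂ T := LinearMap.finrank_le_finrank_of_surjective hψ
    have hf2 := Submodule.finrank_mono hT
    have e1 : Module.finrank ℂ (tangentSpace W₁ w.1) = zdim W₁ := h₁ w hw hg₁w
    have e2 : Module.finrank ℂ (tangentSpace W₂ w.2) = zdim W₂ := h₂ w hw hg₂w
    rw [finrank_submodule_prod, e1, e2] at hf2
    have d1 := zdim_mono hCi hW₁i hW₁c hW₁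
    have d2 := zdim_mono hCi hW₂i hW₂c hW₂
    have c1 : W₁ = C := eq_of_zdim_le hCi hW₁i hW₁c hW₁ (by omega)
    have c2 : W₂ = C := eq_of_zdim_le hCi hW₂i hW₂c hW₂ (by omega)
    rw [c1, c2] at hT
    rw [c1] at e1 hf2
    rw [c2] at e2 hf2
    refine ⟨c2, ?_⟩
    have hTe : T = (tangentSpace C w.1).prod (tangentSpace C w.2) := by
      refine Submodule.eq_of_le_of_finrank_le hT ?_
      rw [finrank_submodule_prod, e1, e2]
      omega
    have hinj : Function.Injective ψ :=
      (LinearMap.injective_iff_surjective_of_finrank_eq_finrank (by omega)).2 hψ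
    have hy : w.2 ∈ tangentSpace C w.1 := by
      rw [← orthogonal_eq_of_isotropic hω (hL _ (hA hw).1 e1) (by omega),
        LinearMap.BilinForm.mem_orthogonal_iff]
      intro u hu
      have hu' : ((u, 0) : V × V) ∈ T := by
        rw [hTe]; exact ⟨hu, Submodule.zero_mem _⟩
      have := bilin_tangentSpace (fun p hp => (hA hp).2.2) hu'
      simpa using this
    have hyT : ((w.2, -w.2) : V × V) ∈ T := by
      rw [hTe]
      exact ⟨hy, Submodule.neg_mem _ (hC.mem_tangentSpace (hA hw).2.1)⟩
    have h0 : ψ ⟨_, hyT⟩ = 0 := add_neg_cancel w.2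
    have h0' := (injective_iff_map_eq_zero ψ).1 hinj _ h0
    exact congrArg (fun v : T => v.1.1) h0'
  obtain ⟨w, hw, hw1, hw2⟩ := hAi.exists_ne_zero (mul_mem_polyFun hg hg₁) hg₂
    (by
      obtain ⟨w, hw, h1, h2⟩ := hAi.exists_ne_zero hg hg₁ hgA hg₁A
      exact ⟨w, hw, mul_ne_zero h1 h2⟩) hg₂A
  have hC2 := (hgen w hw (left_ne_zero_of_mul hw1) (right_ne_zero_of_mul hw1) hw2).1
  -- the second components are dense in `C` and zero at general pairs, hence all zero
  have hzero : C ⊆ {0} := by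
    rw [← hC2, hW₂e]
    refine (zclosed_singleton (0 : V)).zariskiClosure_subset ?_
    rintro _ ⟨p, hp, rfl⟩
    by_contra hn
    obtain ⟨l, hl⟩ := Module.Projective.exists_dual_ne_zero ℂ hn
    obtain ⟨q, hq, hq1, hq2⟩ := hAi.exists_ne_zero
      (mul_mem_polyFun (mul_mem_polyFun hg hg₁) hg₂) (dual_mem_polyFun (l ∘ₗ LinearMap.snd ℂ V V))
      ⟨w, hw, mul_ne_zero hw1 hw2⟩ ⟨p, hp, hl⟩
    have := (hgen q hq (left_ne_zero_of_mul (left_ne_zero_of_mul hq1))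
      (right_ne_zero_of_mul (left_ne_zero_of_mul hq1)) (right_ne_zero_of_mul hq1)).2
    apply hq2
    change l q.2 = 0
    rw [this, map_zero]
  apply hd0
  rw [(Set.Nonempty.subset_singleton_iff hCi.1).1 hzero, zdim_singleton]

end GeneralPosition

/-! ### Hyperplanes in general position with respect to a Legendrian cone -/

section GeneralCenter

variable {V : Type*} [AddCommGroup V] [Module ℂ V] [FiniteDimensional ℂ V]
  {ω : LinearMap.BilinForm ℂ V}

/-- An irreducible closed cone of dimension `n + 1` whose tangent spaces of this dimension are
isotropic. -/
structure IsLegendrianCone (ω : LinearMap.BilinForm ℂ V) (C : Set V) (n : ℕ) : Prop where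
  isCone : IsCone C
  zclosed : ZClosed C
  zirred : ZIrred C
  zdim_eq : zdim C = n + 1
  isotropic : ∀ x ∈ C, Module.finrank ℂ (tangentSpace C x) = n + 1 →
    ∀ u ∈ tangentSpace C x, ∀ w ∈ tangentSpace C x, ω u w = 0

/-- The conditions on a vector `e` which make the hyperplane orthogonal to `e` sufficiently
general with respect to a Legendrian cone `C`: no two orthogonal points of `C` have sum `e`; the
vector `e` is not a limit of tangent vectors of `C`; the section of `C` has dimension `n`
everywhere; and the points of the section that are smooth on `C` are dense in it. -/
structure IsGeneralCenter (ω : LinearMap.BilinForm ℂ V) (C : Set V) (n : ℕ) (e : V) : Prop where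
  add_ne : ∀ x ∈ C, ∀ y ∈ C, ω x y = 0 → x + y ≠ e
  notMem : ∀ x, x ≠ 0 → (x, e) ∉ zariskiClosure (tangentPairs C (n + 1))
  hasDimAt : ∀ x ∈ C, ω e x = 0 → HasDimAt {x | x ∈ C ∧ ω e x = 0} x n
  dense : n ≠ 0 → ∀ f ∈ polyFun V, (∀ x ∈ C, x ≠ 0 → ω e x = 0 →
    Module.finrank ℂ (tangentSpace C x) = n + 1 → f x = 0) → ∀ x ∈ C, ω e x = 0 → f x = 0

/-- A finite set of points of `Z` that has to be avoided to lower the dimension. -/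
theorem exists_finite_points {Z : Set V} (hZ : ZClosed Z) {d : ℕ}
    (hd : ∀ B, ZIrred B → ZClosed B → B ⊆ Z → zdim B ≤ d) :
    ∃ F : Set V, F.Finite ∧ 0 ∉ F ∧ ∀ A, ZIrred A → ZClosed A → A ⊆ Z → zdim A ≠ 0 →
      (∀ z ∈ F, z ∉ A) → zdim A < d := by
  classical
  obtain ⟨S, hS, hSi, hU⟩ := hZ.exists_finite_zirred
  let z : Set V → V := fun B => if h : ∃ z ∈ B, z ≠ 0 then h.choose else 0
  refine ⟨z '' S \ {0}, (hS.image z).subset Set.sdiff_subset, fun h => h.2 rfl, ?_⟩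
  intro A hA hAc hAZ hA0 hAF
  obtain ⟨B, hB, hAB⟩ := hA.exists_subset_of_finite hS (fun B hB => (hSi B hB).2.1) (hU ▸ hAZ)
  obtain ⟨hBi, hBc, hBZ⟩ := hSi B hB
  have hex : ∃ z ∈ B, z ≠ 0 := by
    by_contra! hn
    have : A = {0} := (Set.Nonempty.subset_singleton_iff hA.1).1 fun a ha => hn a (hAB ha)
    exact hA0 (by rw [this, zdim_singleton])
  have hz : z B = hex.choose := dif_pos hex
  have hzA : z B ∉ A := hAF _ ⟨⟨B, hB, rfl⟩, by rw [hz]; exact hex.choose_spec.2⟩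
  refine (zdim_lt hBi hA hAc hAB fun h => hzA ?_).trans_le (hd B hBi hBc hBZ)
  rw [h, hz]
  exact hex.choose_spec.1

/-- A general hyperplane avoids finitely many nonzero vectors. -/
theorem exists_poly_avoiding_points (hω : IsSymplectic ω) {F : Set V} (hF : F.Finite) (h0 : 0 ∉ F) :
    ∃ f ∈ polyFun V, (∃ v, f v ≠ 0) ∧ ∀ e, f e ≠ 0 → ∀ z ∈ F, ω e z ≠ 0 := by
  induction F, hF using Set.Finite.induction_on with
  | empty => exact ⟨_, const_mem_polyFun 1, ⟨0, one_ne_zero⟩, fun _ _ z hz => hz.elim⟩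
  | @insert a s ha hs ih =>
    obtain ⟨f, hf, hf0, h⟩ := ih fun h => h0 (Set.mem_insert_of_mem _ h)
    have ha0 : a ≠ 0 := fun h => h0 (h ▸ Set.mem_insert a s)
    obtain ⟨v, hv⟩ : ∃ v, ω v a ≠ 0 := by
      by_contra! hn
      exact ha0 (hω.nondegenerate.2 a hn)
    refine ⟨_, mul_mem_polyFun (dual_mem_polyFun (ω.flip a)) hf,
      exists_mul_ne_zero (dual_mem_polyFun (ω.flip a)) hf ⟨v, hv⟩ hf0, fun e he z hz => ?_⟩
    rcases hz with rfl | hz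
    · exact left_ne_zero_of_mul he
    · exact h e (right_ne_zero_of_mul he) z hz

/-- A general vector is in general position with respect to a Legendrian cone. -/
theorem exists_poly_isGeneralCenter (hω : IsSymplectic ω) {C : Set V} {n : ℕ}
    (hC : IsLegendrianCone ω C n) (hdim : Module.finrank ℂ V = 2 * n + 2) :
    ∃ f ∈ polyFun V, (∃ v, f v ≠ 0) ∧ ∀ e, f e ≠ 0 → IsGeneralCenter ω C n e := by
  have hL := hC.isotropic
  rw [← hC.zdim_eq] at hL
  obtain ⟨f₁, hf₁, hf₁0, h₁⟩ := exists_poly_tangentPairs hω hC.isCone hL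
  obtain ⟨f₂, hf₂, hf₂0, h₂⟩ := exists_poly_orthogonal_sum hω hC.isCone hC.zirred hC.zclosed
    (by rw [hC.zdim_eq]; omega) (by rw [hC.zdim_eq]; omega) hL
  rw [hC.zdim_eq] at h₁
  obtain ⟨x₀, hx₀, hx₀0⟩ : ∃ x ∈ C, x ≠ 0 := by
    by_contra! hn
    have h := hC.zdim_eq
    rw [(Set.Nonempty.subset_singleton_iff hC.zirred.1).1 hn, zdim_singleton] at h
    omega
  obtain ⟨l, hl⟩ := Module.Projective.exists_dual_ne_zero ℂ hx₀0
  obtain ⟨g, hg, hgC, hgT⟩ := exists_finrank_eq_zdim hC.zirred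
  have hgl := mul_mem_polyFun hg (dual_mem_polyFun l)
  have hglC : ∃ x ∈ C, g x * l x ≠ 0 := by
    obtain ⟨x, hx, h1, h2⟩ := hC.zirred.exists_ne_zero hg (dual_mem_polyFun l) hgC ⟨x₀, hx₀, hl⟩
    exact ⟨x, hx, mul_ne_zero h1 h2⟩
  -- The factor `l` excludes the origin. A section that avoids a nonzero point on each component of
  -- the zero locus of `g * l` has no component inside that locus, which has dimension at most `n`.
  have hZc : ZClosed (C ∩ {x | g x * l x = 0}) := hC.zclosed.inter (zclosed_zero hgl)
  obtain ⟨F, hF, hF0, hFA⟩ := exists_finite_points hZc (d := n) fun B hB hBc hBZ => by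
    have := zdim_lt hC.zirred hB hBc (hBZ.trans Set.inter_subset_left) fun h => by
      obtain ⟨x, hx, hgx⟩ := hglC
      exact hgx (hBZ (h ▸ hx)).2
    rw [hC.zdim_eq] at this
    omega
  obtain ⟨f₃, hf₃, hf₃0, h₃⟩ := exists_poly_avoiding_points hω (hF.insert x₀) (by
    rintro (h | h)
    · exact hx₀0 h.symm
    · exact hF0 h)
  refine ⟨_, mul_mem_polyFun (mul_mem_polyFun hf₁ hf₂) hf₃, exists_mul_ne_zero
    (mul_mem_polyFun hf₁ hf₂) hf₃ (exists_mul_ne_zero hf₁ hf₂ hf₁0 hf₂0) hf₃0, fun e he => ?_⟩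
  have he₁ := left_ne_zero_of_mul (left_ne_zero_of_mul he)
  have he₂ := right_ne_zero_of_mul (left_ne_zero_of_mul he)
  have he₃ := h₃ e (right_ne_zero_of_mul he)
  have hdimAt : ∀ x ∈ C, ω e x = 0 → HasDimAt {x | x ∈ C ∧ ω e x = 0} x n := by
    intro x hx hex
    have hle : ∀ W, ZIrred W → ZClosed W → W ⊆ {x | x ∈ C ∧ ω e x = 0} → zdim W ≤ n := by
      intro W hW hWc hWC
      have := zdim_lt hC.zirred hW hWc (fun w hw => (hWC hw).1) fun h =>
        he₃ x₀ (Set.mem_insert _ _) (hWC (h ▸ hx₀)).2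
      rw [hC.zdim_eq] at this
      omega
    obtain ⟨W, hW, hWc, hWC, hW0, hxW, hWd⟩ := exists_zirred_hypersurface hC.zirred hC.zclosed
      (dual_mem_polyFun (ω e)) hx hex
    have hsub : W ⊆ {x | x ∈ C ∧ ω e x = 0} := fun w hw => ⟨hWC hw, hW0 w hw⟩
    refine ⟨fun W hW hWc hWC _ => hle W hW hWc hWC, W, hW, hWc, hsub, hxW, ?_⟩
    have := hle W hW hWc hsub
    rw [hC.zdim_eq] at hWd
    omega
  refine ⟨fun x hx y hy hxy h => he₂ (h ▸ h₂ x hx y hy hxy), fun x hx h => he₁ (h₁ _ h hx),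
    hdimAt, fun hn f hf hf0 x hx hex => ?_⟩
  obtain ⟨-, A, hA, hAc, hAC, hxA, hAd⟩ := hdimAt x hx hex
  have hvan : VanishesOn (fun v => f v * (g v * l v)) A := fun a ha => by
    change f a * (g a * l a) = 0
    by_cases h : g a * l a = 0
    · rw [h, mul_zero]
    · have ha0 : a ≠ 0 := fun h0 => right_ne_zero_of_mul h (by rw [h0, map_zero])
      rw [hf0 a (hAC ha).1 ha0 (hAC ha).2 (by
        rw [hgT a (hAC ha).1 (left_ne_zero_of_mul h), hC.zdim_eq]), zero_mul]
  rcases hA.2 f hf _ hgl hvan with h | h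
  · exact h x hxA
  · have := hFA A hA hAc (fun a ha => ⟨(hAC ha).1, h a ha⟩) (by omega) fun z hz hzA =>
      he₃ z (Set.mem_insert_of_mem _ hz) (hAC hzA).2
    omega

end GeneralCenter

/-! ### The section of a Legendrian cone by a general hyperplane and its projection -/

section Section

variable {V : Type*} [AddCommGroup V] [Module ℂ V] [FiniteDimensional ℂ V]
  {ω : LinearMap.BilinForm ℂ V} {C : Set V} {n : ℕ} {e : V} {U : Submodule ℂ V}

theorem IsLegendrianCone.isCone_section (hC : IsLegendrianCone ω C n) :
    IsCone ((↑) ⁻¹' C : Set U) := fun t _ hv => hC.isCone t _ hv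

theorem IsLegendrianCone.zclosed_section (hC : IsLegendrianCone ω C n) :
    ZClosed ((↑) ⁻¹' C : Set U) := hC.zclosed.preimage (isPolyMap_linear U.subtype)

theorem coe_mem_tangentSpace {x u : U} (hu : u ∈ tangentSpace ((↑) ⁻¹' C : Set U) x) :
    (u : V) ∈ tangentSpace C x :=
  mem_tangentSpace_of_mapsTo_linear U.subtype (fun _ hz => hz) hu

namespace IsGeneralCenter

theorem hasDimAt_section (he : IsGeneralCenter ω C n e) (hC : IsLegendrianCone ω C n)
    (hU : ∀ x, x ∈ U ↔ ω e x = 0) {x : U} (hx : (x : V) ∈ C) :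
    HasDimAt ((↑) ⁻¹' C : Set U) x n := by
  rw [← hasDimAt_image_iff (φ := U.subtype) hC.zclosed_section U.injective_subtype.injOn
    (fun W _ hW => hW.image_of_injective U.injective_subtype) hx]
  have h : U.subtype '' ((↑) ⁻¹' C) = {x | x ∈ C ∧ ω e x = 0} := by
    ext y
    constructor
    · rintro ⟨y, hy, rfl⟩
      exact ⟨hy, (hU y).1 y.2⟩
    · rintro ⟨hy, hey⟩
      exact ⟨⟨y, (hU y).2 hey⟩, hy, rfl⟩
  rw [h]
  exact he.hasDimAt x hx ((hU x).1 x.2)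

theorem dense_section (he : IsGeneralCenter ω C n e) (hU : ∀ x, x ∈ U ↔ ω e x = 0) (hn : n ≠ 0)
    {f : U → ℂ} (hf : f ∈ polyFun U) (h : ∀ x : U, (x : V) ∈ C → x ≠ 0 →
      Module.finrank ℂ (tangentSpace C x) = n + 1 → f x = 0) {x : U} (hx : (x : V) ∈ C) : f x = 0 := by
  obtain ⟨r, hr⟩ := LinearMap.exists_leftInverse_of_injective U.subtype U.ker_subtype
  have hr : ∀ x : U, r x = x := fun x => LinearMap.congr_fun hr x
  have h1 := he.dense hn _ (comp_mem_polyFun (isPolyMap_linear r) hf) (fun y hy hy0 hey hyT => by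
    have hyU := (hU y).2 hey
    have h2 := hr ⟨y, hyU⟩
    simp only at h2
    rw [h2]
    exact h ⟨y, hyU⟩ hy (fun h0 => hy0 (congrArg Subtype.val h0)) hyT) x hx ((hU x).1 x.2)
  rwa [hr] at h1

theorem notMem_section (he : IsGeneralCenter ω C n e) (hC : IsLegendrianCone ω C n) : e ∉ C := by
  intro h
  refine he.add_ne e h 0 ?_ (map_zero _) (add_zero e)
  simpa using hC.isCone 0 e h

/-- At a point of the section that is smooth on `C`, the section is smooth. -/
theorem finrank_tangentSpace_section (he : IsGeneralCenter ω C n e) (hω : IsSymplectic ω)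
    (hC : IsLegendrianCone ω C n) (hdim : Module.finrank ℂ V = 2 * n + 2)
    (hU : ∀ x, x ∈ U ↔ ω e x = 0) {x : U} (hx : (x : V) ∈ C) (hx0 : x ≠ 0)
    (hxT : Module.finrank ℂ (tangentSpace C x) = n + 1) :
    Module.finrank ℂ (tangentSpace ((↑) ⁻¹' C : Set U) x) = n := by
  refine le_antisymm ?_ (he.hasDimAt_section hC hU hx).le_finrank
  have heT : e ∉ tangentSpace C x := fun h =>
    he.notMem x (fun h0 => hx0 (Subtype.ext h0)) (subset_zariskiClosure _ ⟨hx, hxT, h⟩)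
  have hlt : tangentSpace C x ⊓ U < tangentSpace C x := by
    refine lt_of_le_of_ne inf_le_left fun h => heT ?_
    rw [← orthogonal_eq_of_isotropic hω (hC.isotropic x hx hxT) (by omega),
      LinearMap.BilinForm.mem_orthogonal_iff]
    intro u hu
    rw [← h] at hu
    exact hω.alt.isRefl _ _ ((hU u).1 hu.2)
  have h1 := Submodule.finrank_lt_finrank_of_lt hlt
  have h2 : (tangentSpace ((↑) ⁻¹' C : Set U) x).map U.subtype ≤ tangentSpace C x ⊓ U := by
    rintro _ ⟨u, hu, rfl⟩
    exact ⟨coe_mem_tangentSpace hu, u.2⟩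
  have h3 := Submodule.finrank_mono h2
  rw [LinearEquiv.finrank_eq
    (Submodule.equivMapOfInjective U.subtype U.injective_subtype _).symm] at h3
  omega

/-- The centre is not a tangent direction at the smooth points of the section, including those that
are singular on `C`: there it would be a limit of tangent directions at points smooth on `C`. -/
theorem center_notMem_tangentSpace (he : IsGeneralCenter ω C n e) (hC : IsLegendrianCone ω C n)
    (hU : ∀ x, x ∈ U ↔ ω e x = 0) {eU : U} (heU : (eU : V) = e) {x : U} (hx : (x : V) ∈ C)
    (hx0 : x ≠ 0)
    (hxT : Module.finrank ℂ (tangentSpace ((↑) ⁻¹' C : Set U) x) = n) :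
    eU ∉ tangentSpace ((↑) ⁻¹' C : Set U) x := by
  intro heT
  have hn : n ≠ 0 := by
    rintro rfl
    rw [Submodule.finrank_eq_zero] at hxT
    have := hC.isCone_section.mem_tangentSpace (v := x) hx
    rw [hxT] at this
    exact hx0 this
  obtain ⟨Δ, hΔ, hΔx, -, hext⟩ := exists_tangent_extension ((↑) ⁻¹' C : Set U) x
  obtain ⟨û, hû, hûx, hûT⟩ := hext _ heT
  refine he.notMem x (fun h => hx0 (Subtype.ext h)) fun f hf hfS => ?_
  -- the field `û` makes `(x, e)` a limit of pairs of a smooth point and a tangent vector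
  have hpoly : (fun z : U => f ((z : V), (û z : V)) * Δ z) ∈ polyFun U :=
    mul_mem_polyFun (comp_mem_polyFun (IsPolyMap.prodMk (isPolyMap_linear U.subtype)
      fun l => hû (l ∘ₗ U.subtype)) hf) hΔ
  have h := he.dense_section hU hn hpoly (fun z hz hz0 hzT => by
    by_cases hΔz : Δ z = 0
    · rw [hΔz, mul_zero]
    · have h1 := hûT z hΔz (by rw [hxT]; exact (he.hasDimAt_section hC hU hz).le_finrank)
      have h2 := hfS ((z : V), (û z : V)) ⟨hz, hzT, coe_mem_tangentSpace h1⟩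
      change f ((z : V), (û z : V)) * Δ z = 0
      rw [h2, zero_mul]) hx
  have h : f ((x : V), (û x : V)) * Δ x = 0 := h
  rw [hûx, heU] at h
  exact (mul_eq_zero.1 h).resolve_right hΔx

variable {Q : Type*} [AddCommGroup Q] [Module ℂ Q] {π : U →ₗ[ℂ] Q} {eU : U}

/-- Two points of the section with the same image differ by a multiple of `e`, and are orthogonal
since `e` is orthogonal to both; so a multiple of their difference would be excluded by `add_ne`. -/
theorem injOn_projection (he : IsGeneralCenter ω C n e) (hω : IsSymplectic ω)
    (hC : IsLegendrianCone ω C n) (hU : ∀ x, x ∈ U ↔ ω e x = 0) (heU : (eU : V) = e)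
    (σ : LineSplitting π eU) : Set.InjOn π ((↑) ⁻¹' C : Set U) := by
  intro x hx y hy hxy
  have h1 : x - y = (σ.τ x - σ.τ y) • eU := by
    conv_lhs => rw [← σ.split x, ← σ.split y, hxy]
    rw [sub_smul]; abel
  set c := σ.τ x - σ.τ y with hc
  by_cases hc0 : c = 0
  · rwa [hc0, zero_smul, sub_eq_zero] at h1
  have h2 : (x : V) - y = c • e := by
    rw [← heU]; exact congrArg Subtype.val h1
  have hyx : ω (y : V) x = 0 := by
    have h3 : ω ((x : V) - y) x = c * ω e x := by rw [h2, map_smul]; rfl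
    have h4 : ω (x : V) x = 0 := hω.alt x
    rw [(hU x).1 x.2, map_sub, LinearMap.sub_apply, h4, mul_zero, zero_sub, neg_eq_zero] at h3
    exact h3
  refine (he.add_ne _ (hC.isCone c⁻¹ _ hx) _ (hC.isCone (-c⁻¹) _ hy) ?_ ?_).elim
  · have := hω.alt.isRefl _ _ hyx
    simp [this]
  · rw [neg_smul, ← sub_eq_add_neg, ← smul_sub, h2, smul_smul, inv_mul_cancel₀ hc0, one_smul]

variable [FiniteDimensional ℂ Q]

theorem zclosed_projection (he : IsGeneralCenter ω C n e) (hC : IsLegendrianCone ω C n)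
    (heU : (eU : V) = e) (σ : LineSplitting π eU) {W : Set U} (hW : W ⊆ (↑) ⁻¹' C)
    (hWc : ZClosed W) : ZClosed (π '' W) :=
  σ.zclosed_image hC.isCone_section hC.zclosed_section
    (fun h => he.notMem_section hC (heU ▸ h)) hW hWc

theorem hasDimAt_projection (he : IsGeneralCenter ω C n e) (hω : IsSymplectic ω)
    (hC : IsLegendrianCone ω C n) (hU : ∀ x, x ∈ U ↔ ω e x = 0) (heU : (eU : V) = e)
    (σ : LineSplitting π eU) {x : U} (hx : (x : V) ∈ C) :
    HasDimAt (π '' ((↑) ⁻¹' C)) (π x) n :=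
  (hasDimAt_image_iff hC.zclosed_section (he.injOn_projection hω hC hU heU σ)
    (fun _ hW hWc => he.zclosed_projection hC heU σ hW hWc) hx).2 (he.hasDimAt_section hC hU hx)

theorem tangentSpace_projection (he : IsGeneralCenter ω C n e) (hω : IsSymplectic ω)
    (hC : IsLegendrianCone ω C n) (hU : ∀ x, x ∈ U ↔ ω e x = 0) (heU : (eU : V) = e)
    (σ : LineSplitting π eU) {x : U} (hx : (x : V) ∈ C) (hx0 : x ≠ 0)
    (hxT : Module.finrank ℂ (tangentSpace ((↑) ⁻¹' C : Set U) x) = n) :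
    tangentSpace (π '' ((↑) ⁻¹' C)) (π x) = (tangentSpace ((↑) ⁻¹' C : Set U) x).map π ∧
      Module.finrank ℂ (tangentSpace (π '' ((↑) ⁻¹' C)) (π x)) = n := by
  have heT := he.center_notMem_tangentSpace hC hU heU hx hx0 hxT
  have h := σ.tangentSpace_image hC.isCone_section hC.zclosed_section
    (fun h => he.notMem_section hC (heU ▸ h)) (he.injOn_projection hω hC hU heU σ) hx heT
  exact ⟨h, by rw [h, σ.finrank_map_eq heT, hxT]⟩

/-- The projection of the section is Legendrian. At the images of points that are smooth on `C` the
tangent vectors come from tangent vectors of `C`; these points are dense, and tangent vectors at the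
other smooth points extend to polynomial tangent fields. -/
theorem isLagrangian_projection (he : IsGeneralCenter ω C n e) (hω : IsSymplectic ω)
    (hC : IsLegendrianCone ω C n) (hdim : Module.finrank ℂ V = 2 * n + 2)
    (hU : ∀ x, x ∈ U ↔ ω e x = 0) (heU : (eU : V) = e) (σ : LineSplitting π eU)
    {ω' : LinearMap.BilinForm ℂ Q} (hω' : IsSymplectic ω')
    (hQ : Module.finrank ℂ Q = 2 * n) (hred : ∀ u w : U, ω' (π u) (π w) = ω u w) {v : Q}
    (hv : v ∈ π '' ((↑) ⁻¹' C))
    (hvT : Module.finrank ℂ (tangentSpace (π '' ((↑) ⁻¹' C)) v) = n) :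
    IsLagrangian ω' (tangentSpace (π '' ((↑) ⁻¹' C)) v) := by
  refine isLagrangian_of_isotropic hω' (fun u hu w hw => ?_) (by rw [hvT, hQ])
  by_cases hn : n = 0
  · have : Subsingleton Q := Module.finrank_zero_iff.1 (by rw [hQ, hn])
    rw [Subsingleton.elim u 0, map_zero, LinearMap.zero_apply]
  obtain ⟨x, hx, rfl⟩ := hv
  obtain ⟨Δ, hΔ, hΔx, -, hext⟩ := exists_tangent_extension (π '' ((↑) ⁻¹' C)) (π x)
  obtain ⟨û, hû, hûx, hûT⟩ := hext u hu
  obtain ⟨ŵ, hŵ, hŵx, hŵT⟩ := hext w hw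
  have hpoly : (fun z : U => ω' (û (π z)) (ŵ (π z)) * Δ (π z)) ∈ polyFun U :=
    comp_mem_polyFun (isPolyMap_linear π) (mul_mem_polyFun (bilin_mem_polyFun ω' hû hŵ) hΔ)
  have h := he.dense_section hU hn hpoly (fun z hz hz0 hzT => by
    by_cases hΔz : Δ (π z) = 0
    · rw [hΔz, mul_zero]
    · obtain ⟨h1, h2⟩ := he.tangentSpace_projection hω hC hU heU σ hz hz0
        (he.finrank_tangentSpace_section hω hC hdim hU hz hz0 hzT)
      have hu1 := hûT _ hΔz (by rw [hvT, h2])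
      have hw1 := hŵT _ hΔz (by rw [hvT, h2])
      rw [h1] at hu1 hw1
      obtain ⟨u', hu', hu'e⟩ := hu1
      obtain ⟨w', hw', hw'e⟩ := hw1
      change ω' (û (π z)) (ŵ (π z)) * Δ (π z) = 0
      rw [← hu'e, ← hw'e, hred, hC.isotropic z hz hzT _ (coe_mem_tangentSpace hu') _
        (coe_mem_tangentSpace hw'), zero_mul]) hx
  have h : ω' (û (π x)) (ŵ (π x)) * Δ (π x) = 0 := h
  rw [hûx, hŵx] at h
  exact (mul_eq_zero.1 h).resolve_right hΔx

end IsGeneralCenter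
end Section

/-! ### The symplectic quotient of a hyperplane -/

section Reduction

variable {V : Type*} [AddCommGroup V] [Module ℂ V] [FiniteDimensional ℂ V]
  {ω : LinearMap.BilinForm ℂ V} {H : ℙ ℂ (Module.Dual ℂ V)} {e : V}

/-- The orthogonal of the hyperplane is the line spanned by `e`, inside the hyperplane. -/
theorem pole_eq_span (hω : IsSymplectic ω) (hU : ∀ x, x ∈ hyperplane H ↔ ω e x = 0)
    {eU : hyperplane H} (heU : (eU : V) = e) : pole ω H = ℂ ∙ eU := by
  have h1 : hyperplane H = ω.orthogonal (ℂ ∙ e) := by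
    ext x
    rw [hU, LinearMap.BilinForm.mem_orthogonal_iff]
    constructor
    · intro h m hm
      obtain ⟨c, rfl⟩ := Submodule.mem_span_singleton.1 hm
      rw [map_smul, LinearMap.smul_apply, h, smul_zero]
    · exact fun h => h e (Submodule.mem_span_singleton_self e)
  have h2 : ω.orthogonal (hyperplane H) = ℂ ∙ e := by
    rw [h1, LinearMap.BilinForm.orthogonal_orthogonal hω.nondegenerate hω.alt.isRefl]
  ext x
  change (x : V) ∈ ω.orthogonal (hyperplane H) ↔ _
  rw [h2, Submodule.mem_span_singleton,
    Submodule.mem_span_singleton]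
  refine exists_congr fun c => ?_
  rw [← heU, Subtype.ext_iff]
  rfl

theorem toQuotient_surjective : Function.Surjective (toQuotient ω H) :=
  Submodule.mkQ_surjective _

theorem finrank_quotient_pole (hω : IsSymplectic ω) (hU : ∀ x, x ∈ hyperplane H ↔ ω e x = 0)
    {eU : hyperplane H} (heU : (eU : V) = e) (he : e ≠ 0) :
    Module.finrank ℂ (hyperplane H ⧸ pole ω H) + 2 = Module.finrank ℂ V := by
  have h1 := Submodule.finrank_quotient_add_finrank (pole ω H)
  have h2 : Module.finrank ℂ (pole ω H) = 1 := by
    rw [pole_eq_span hω hU heU]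
    exact finrank_span_singleton fun h => he (by rw [← heU, h]; rfl)
  have h3 : Module.finrank ℂ (hyperplane H) + 1 = Module.finrank ℂ V :=
    Module.Dual.finrank_ker_add_one_of_ne_zero H.rep_nonzero
  omega

theorem isSymplectic_reducedForm (hω : IsSymplectic ω) : IsSymplectic (reducedForm ω hω.alt H) := by
  have key : ∀ u : hyperplane H, (∀ w : hyperplane H, ω w u = 0) → toQuotient ω H u = 0 :=
    fun u hu => (Submodule.Quotient.mk_eq_zero _).2
      (LinearMap.BilinForm.mem_orthogonal_iff.2 fun w hw => hu ⟨w, hw⟩)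
  refine ⟨fun q => ?_, fun q hq => ?_, fun q hq => ?_⟩
  · obtain ⟨u, rfl⟩ := toQuotient_surjective q
    exact hω.alt u
  · obtain ⟨u, rfl⟩ := toQuotient_surjective q
    exact key u fun w => hω.alt.isRefl _ _ (hq (toQuotient ω H w))
  · obtain ⟨u, rfl⟩ := toQuotient_surjective q
    exact key u fun w => hq (toQuotient ω H w)

theorem cone_hyperplaneSection (X : Set (ℙ ℂ V)) :
    cone (hyperplaneSection X H) = (↑) ⁻¹' cone X := by
  ext u
  constructor
  · intro h hu
    exact h fun h0 => hu (by rw [h0]; rfl)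
  · intro h hu
    exact h fun h0 => hu (Subtype.ext h0)

end Reduction

/-! ### Legendrian varieties and their cones -/

section Legendrian

variable {V : Type*} [AddCommGroup V] [Module ℂ V] [FiniteDimensional ℂ V]
  {ω : LinearMap.BilinForm ℂ V} {X : Set (ℙ ℂ V)} {n : ℕ}

/-- The dimension of the cone is that of the Lagrangian tangent spaces, which exist since general
points are smooth. -/
theorem isLegendrianCone_cone (hω : IsSymplectic ω) (hX : IsLegendrian ω X)
    (hirr : @IsIrreducible _ (projZariski V) X) (hdim : Module.finrank ℂ V = 2 * n + 2) :
    IsLegendrianCone ω (cone X) n := by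
  have hc := isClosed_iff_zclosed_cone.1 hX.isClosed
  have hi := zirred_cone hirr
  have hsm : ∀ x ∈ cone X, Module.finrank ℂ (tangentSpace (cone X) x) = zdim (cone X) →
      IsLagrangian ω (tangentSpace (cone X) x) := fun x hx h =>
    hX.isLagrangian x (((hi.hasDimAt hc hx).isSmoothAt_iff hx).2 h)
  have hd : zdim (cone X) = n + 1 := by
    obtain ⟨g, -, ⟨w, hw, hgw⟩, h⟩ := exists_finrank_eq_zdim hi
    have h1 := (hsm w hw (h w hw hgw)).finrank_eq hω
    rw [h w hw hgw] at h1
    omega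
  exact ⟨isCone_cone X, hc, hi, hd, fun x hx h => (hsm x hx (h.trans hd.symm)).1⟩

/-- The closed cone of the origin and the points at which a closed cone has a tangent space that is
not of the expected dimension. -/
theorem zclosed_singular {C : Set V} (hCc : ZClosed C)
    (hd : ∀ x ∈ C, n ≤ Module.finrank ℂ (tangentSpace C x)) :
    ZClosed {x | x ∈ C ∧ (x = 0 ∨ Module.finrank ℂ (tangentSpace C x) ≠ n)} := by
  intro v hv
  by_contra hn
  have hvC : v ∈ C := hCc.zariskiClosure_subset (fun x hx => hx.1) hv
  have hv0 : v ≠ 0 := fun h => hn ⟨hvC, Or.inl h⟩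
  have hvT : Module.finrank ℂ (tangentSpace C v) = n := by
    by_contra h
    exact hn ⟨hvC, Or.inr h⟩
  obtain ⟨Δ, hΔ, hΔv, hle, -⟩ := exists_tangent_extension C v
  obtain ⟨l, hl⟩ := Module.Projective.exists_dual_ne_zero ℂ hv0
  refine mul_ne_zero hΔv hl (hv _ (mul_mem_polyFun hΔ (dual_mem_polyFun l)) ?_)
  rintro z ⟨hz, rfl | hzT⟩
  · change Δ 0 * l 0 = 0
    rw [map_zero, mul_zero]
  · change Δ z * l z = 0
    by_cases h : Δ z = 0
    · rw [h, zero_mul]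
    · exact (hzT (le_antisymm (by rw [← hvT]; exact hle z h) (hd z hz))).elim

theorem isCone_singular {C : Set V} (hC : IsCone C) :
    IsCone {x | x ∈ C ∧ (x = 0 ∨ Module.finrank ℂ (tangentSpace C x) ≠ n)} := by
  rintro t v ⟨hv, h⟩
  refine ⟨hC t v hv, ?_⟩
  by_cases ht : t = 0
  · exact Or.inl (by rw [ht, zero_smul])
  · rcases h with rfl | h
    · exact Or.inl (smul_zero t)
    · exact Or.inr (by rwa [hC.tangentSpace_smul ht])

/-- Finitely many vectors such that a hyperplane that avoids them contains no irreducible component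
of `S`. -/
theorem exists_finite_points_components (S : Set (ℙ ℂ V)) :
    ∃ F : Set V, F.Finite ∧ 0 ∉ F ∧ ∀ l : Module.Dual ℂ V, (∀ z ∈ F, l z ≠ 0) →
      letI := projZariski V
      ∀ Z ∈ irreducibleComponents S, ∃ p ∈ Z, l p.1.rep ≠ 0 := by
  let _ := projZariski V
  have := noetherianSpace_projZariski (E := V)
  have : TopologicalSpace.NoetherianSpace S := Topology.IsInducing.subtypeVal.noetherianSpace
  have hfin := TopologicalSpace.NoetherianSpace.finite_irreducibleComponents (α := S)
  have hne : ∀ Z ∈ irreducibleComponents S, Z.Nonempty := fun Z hZ => hZ.1.nonempty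
  choose p hp using hne
  let f : irreducibleComponents S → V := fun Z => (p Z.1 Z.2).1.rep
  have := hfin.to_subtype
  refine ⟨Set.range f, Set.finite_range f, ?_, fun l hl Z hZ => ⟨p Z hZ, hp Z hZ, hl _ ⟨⟨Z, hZ⟩, rfl⟩⟩⟩
  rintro ⟨Z, hZ⟩
  exact Projectivization.rep_nonzero _ hZ

/-- A property holds for a general hyperplane if it holds for the hyperplanes that are orthogonal to a
vector in general position and avoid finitely many given vectors. -/
theorem forGeneralHyperplane_of_isGeneralCenter (hω : IsSymplectic ω) (hX : IsLegendrian ω X)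
    (hirr : @IsIrreducible _ (projZariski V) X) (hdim : Module.finrank ℂ V = 2 * n + 2) {F : Set V}
    (hF : F.Finite) (hF0 : 0 ∉ F) {P : ℙ ℂ (Module.Dual ℂ V) → Prop}
    (hP : ∀ H e, e ≠ 0 → (∀ x, x ∈ hyperplane H ↔ ω e x = 0) → IsGeneralCenter ω (cone X) n e →
      (∀ z ∈ F, ω e z ≠ 0) → P H) : ForGeneralHyperplane P := by
  obtain ⟨f, hf, hf0, h⟩ := exists_poly_isGeneralCenter hω (isLegendrianCone_cone hω hX hirr hdim) hdim
  obtain ⟨g, hg, hg0, h'⟩ := exists_poly_avoiding_points hω hF hF0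
  have : Nontrivial V := Module.nontrivial_of_finrank_pos (R := ℂ) (by omega)
  refine forGeneralHyperplane_of_ne_zero (ω.toDual hω.nondegenerate) (mul_mem_polyFun hf hg)
    (exists_mul_ne_zero hf hg hf0 hg0) fun H e c he hc hH => ?_
  have hHx : ∀ x, ω e x = c * H.rep x := fun x => by
    rw [← LinearMap.BilinForm.toDual_def hω.nondegenerate, hH]; rfl
  refine hP H e (fun h0 => ?_) (fun x => ?_) (h e (left_ne_zero_of_mul he))
    (h' e (right_ne_zero_of_mul he))
  · refine smul_ne_zero hc H.rep_nonzero ?_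
    rw [← hH, h0, map_zero]
  · rw [hHx, mul_eq_zero, or_iff_right hc]
    rfl

end Legendrian

/-! ### The section of a Legendrian variety by a general hyperplane -/

section GeneralSection

variable {V : Type*} [AddCommGroup V] [Module ℂ V] [FiniteDimensional ℂ V]
  {ω : LinearMap.BilinForm ℂ V} {X : Set (ℙ ℂ V)} {n : ℕ} {H : ℙ ℂ (Module.Dual ℂ V)} {e : V}

/-- The hyperplane `H` is orthogonal to `e`, which is in general position with respect to the cone
over the Legendrian variety `X`. -/
structure IsGeneralHyperplane (ω : LinearMap.BilinForm ℂ V) (X : Set (ℙ ℂ V)) (n : ℕ)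
    (H : ℙ ℂ (Module.Dual ℂ V)) (e : V) : Prop where
  isSymplectic : IsSymplectic ω
  isLegendrianCone : IsLegendrianCone ω (cone X) n
  finrank_eq : Module.finrank ℂ V = 2 * n + 2
  isGeneralCenter : IsGeneralCenter ω (cone X) n e
  ne_zero : e ≠ 0
  mem_iff : ∀ x, x ∈ hyperplane H ↔ ω e x = 0

theorem rep_mem_section {p : ℙ ℂ (hyperplane H)} :
    (p.rep : V) ∈ cone X ↔ p ∈ hyperplaneSection X H := by
  rw [← rep_mem_cone, cone_hyperplaneSection]
  rfl

theorem cone_projectedSection :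
    cone (projectedSection ω X H) = toQuotient ω H '' ((↑) ⁻¹' cone X) := by
  rw [projectedSection, cone_projImage, cone_hyperplaneSection]

namespace IsGeneralHyperplane

theorem isSmoothAt_iff (h : IsGeneralHyperplane ω X n H e) {p : ℙ ℂ V} (hp : p ∈ X) :
    IsSmoothAt (cone X) p.rep ↔ Module.finrank ℂ (tangentSpace (cone X) p.rep) = n + 1 := by
  have hp' := rep_mem_cone.2 hp
  rw [(h.isLegendrianCone.zirred.hasDimAt h.isLegendrianCone.zclosed hp').isSmoothAt_iff hp',
    h.isLegendrianCone.zdim_eq]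

theorem exists_lineSplitting (h : IsGeneralHyperplane ω X n H e) :
    ∃ eU : hyperplane H, (eU : V) = e ∧ Nonempty (LineSplitting (toQuotient ω H) eU) := by
  refine ⟨⟨e, (h.mem_iff e).2 (h.isSymplectic.alt e)⟩, rfl, ?_⟩
  refine LineSplitting.nonempty toQuotient_surjective
    (fun h0 => h.ne_zero (congrArg Subtype.val h0)) ?_
  rw [← pole_eq_span h.isSymplectic h.mem_iff rfl]
  exact Submodule.ker_mkQ _

theorem finrank_quotient (h : IsGeneralHyperplane ω X n H e) :
    Module.finrank ℂ (hyperplane H ⧸ pole ω H) = 2 * n := by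
  obtain ⟨eU, heU, -⟩ := h.exists_lineSplitting
  have := finrank_quotient_pole h.isSymplectic h.mem_iff heU h.ne_zero
  rw [h.finrank_eq] at this
  omega

theorem injOn (h : IsGeneralHyperplane ω X n H e) :
    Set.InjOn (toQuotient ω H) ((↑) ⁻¹' cone X) := by
  obtain ⟨eU, heU, ⟨σ⟩⟩ := h.exists_lineSplitting
  exact h.isGeneralCenter.injOn_projection h.isSymplectic h.isLegendrianCone h.mem_iff heU σ

theorem zclosed_image (h : IsGeneralHyperplane ω X n H e) {W : Set (hyperplane H)}
    (hW : W ⊆ (↑) ⁻¹' cone X) (hWc : ZClosed W) : ZClosed (toQuotient ω H '' W) := by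
  obtain ⟨eU, heU, ⟨σ⟩⟩ := h.exists_lineSplitting
  exact h.isGeneralCenter.zclosed_projection h.isLegendrianCone heU σ hW hWc

theorem hasDimAt_image (h : IsGeneralHyperplane ω X n H e) {x : hyperplane H}
    (hx : (x : V) ∈ cone X) : HasDimAt (toQuotient ω H '' ((↑) ⁻¹' cone X)) (toQuotient ω H x) n := by
  obtain ⟨eU, heU, ⟨σ⟩⟩ := h.exists_lineSplitting
  exact h.isGeneralCenter.hasDimAt_projection h.isSymplectic h.isLegendrianCone h.mem_iff heU σ hx

theorem toQuotient_rep_ne_zero (h : IsGeneralHyperplane ω X n H e) {p : ℙ ℂ (hyperplane H)}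
    (hp : p ∈ hyperplaneSection X H) : toQuotient ω H p.rep ≠ 0 := fun h0 =>
  p.rep_nonzero (h.injOn (rep_mem_section.2 hp) (zero_mem_cone X) (h0.trans (map_zero _).symm))

theorem mem_smoothLocus_iff (h : IsGeneralHyperplane ω X n H e) {p : ℙ ℂ (hyperplane H)} :
    p ∈ smoothLocus (hyperplaneSection X H) ↔ p ∈ hyperplaneSection X H ∧
      Module.finrank ℂ (tangentSpace ((↑) ⁻¹' cone X : Set (hyperplane H)) p.rep) = n := by
  rw [smoothLocus, cone_hyperplaneSection]
  exact and_congr_right fun hp => (h.isGeneralCenter.hasDimAt_section h.isLegendrianCone h.mem_iff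
    (rep_mem_section.2 hp)).isSmoothAt_iff (rep_mem_section.2 hp)

theorem isLegendrian (h : IsGeneralHyperplane ω X n H e) :
    IsLegendrian (reducedForm ω h.isSymplectic.alt H) (projectedSection ω X H) := by
  obtain ⟨eU, heU, ⟨σ⟩⟩ := h.exists_lineSplitting
  refine ⟨isClosed_iff_zclosed_cone.2 ?_, fun v hv => ?_⟩
  · rw [cone_projectedSection]
    exact h.zclosed_image subset_rfl h.isLegendrianCone.zclosed_section
  · rw [cone_projectedSection] at hv ⊢
    obtain ⟨x, hx, rfl⟩ := hv.1
    exact h.isGeneralCenter.isLagrangian_projection h.isSymplectic h.isLegendrianCone h.finrank_eq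
      h.mem_iff heU σ (isSymplectic_reducedForm h.isSymplectic) h.finrank_quotient
      (fun u w => reducedForm_toQuotient ω _ H u w) hv.1 (((h.hasDimAt_image hx).isSmoothAt_iff hv.1).1 hv)

/-- Singular points of the projected section come from singular points of `X`. -/
theorem exists_singular (h : IsGeneralHyperplane ω X n H e) {q : ℙ ℂ (hyperplane H ⧸ pole ω H)}
    (hq : q ∈ singularLocus (projectedSection ω X H)) :
    ∃ x : hyperplane H, toQuotient ω H x = q.rep ∧ ∃ hx : (x : V) ≠ 0,
      Projectivization.mk ℂ (x : V) hx ∈ singularLocus X := by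
  obtain ⟨eU, heU, ⟨σ⟩⟩ := h.exists_lineSplitting
  have hqC := rep_mem_cone.2 hq.1
  have hqs := hq.2
  rw [cone_projectedSection] at hqC hqs
  obtain ⟨x, hx, hxq⟩ := hqC
  have hx0 : (x : V) ≠ 0 := fun h0 => q.rep_nonzero (by
    rw [← hxq, show x = 0 from Subtype.ext h0, map_zero])
  refine ⟨x, hxq, hx0, hx hx0, fun hsm => hqs ?_⟩
  obtain ⟨c, hc, hrep⟩ := exists_smul_rep hx0
  rw [h.isSmoothAt_iff (hx hx0), hrep, h.isLegendrianCone.isCone.tangentSpace_smul hc] at hsm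
  have hx0' : x ≠ 0 := fun h0 => hx0 (congrArg Subtype.val h0)
  rw [← hxq, (h.hasDimAt_image hx).isSmoothAt_iff ⟨x, hx, rfl⟩]
  exact (h.isGeneralCenter.tangentSpace_projection h.isSymplectic h.isLegendrianCone h.mem_iff heU σ
    hx hx0' (h.isGeneralCenter.finrank_tangentSpace_section h.isSymplectic h.isLegendrianCone
      h.finrank_eq h.mem_iff hx hx0' hsm)).2

/-- If the hyperplane contains no irreducible component of the singular locus, then the dimension
of the singular locus drops. -/
theorem dimOf_singularLocus (h : IsGeneralHyperplane ω X n H e)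
    (hcomp : letI := projZariski V
      ∀ Z ∈ irreducibleComponents (singularLocus X), ∃ p ∈ Z, ω e p.1.rep ≠ 0) :
    dimOf (projZariski _) (singularLocus (projectedSection ω X H)) + 1 ≤
      dimOf (projZariski V) (singularLocus X) := by
  let _ := projZariski V
  let _ := projZariski (hyperplane H ⧸ pole ω H)
  choose x hxq hx0 hxs using fun q : singularLocus (projectedSection ω X H) => h.exists_singular q.2
  have hxC : ∀ q, (x q : V) ∈ cone X := fun q _ => (hxs q).1
  -- the inverse of the projection embeds the singular locus into that of `X`, topologically
  let ψ : singularLocus (projectedSection ω X H) → singularLocus X :=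
    fun q => ⟨Projectivization.mk ℂ (x q : V) (hx0 q), hxs q⟩
  have hψrep : ∀ q, ∃ c : ℂ, c ≠ 0 ∧ (ψ q).1.rep = c • (x q : V) := fun q => exists_smul_rep (hx0 q)
  have hCU := h.isLegendrianCone.isCone_section (U := hyperplane H)
  have hind : Topology.IsInducing ψ := by
    refine ⟨TopologicalSpace.ext_isClosed fun S => ?_⟩
    rw [isClosed_induced_iff, isClosed_induced_iff]
    constructor
    · rintro ⟨F, hF, rfl⟩
      let D : Set V := (hyperplane H).subtype '' ((↑) ⁻¹' cone X ∩ toQuotient ω H ⁻¹' cone F)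
      have hD : IsCone D := by
        rintro t _ ⟨u, ⟨hu, huF⟩, rfl⟩
        refine ⟨t • u, ⟨hCU t u hu, ?_⟩, map_smul _ _ _⟩
        rw [Set.mem_preimage, map_smul]
        exact isCone_cone F t _ huF
      have hDc : ZClosed D := (h.isLegendrianCone.zclosed_section.inter
        ((isClosed_iff_zclosed_cone.1 hF).preimage
          (isPolyMap_linear (toQuotient ω H)))).image_of_injective
            (hyperplane H).injective_subtype
      refine ⟨Subtype.val ⁻¹' {p | p.rep ∈ D}, (isClosed_setOf_rep_mem hD hDc).preimage
        continuous_subtype_val, ?_⟩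
      ext q
      obtain ⟨c, hc, hrep⟩ := hψrep q
      change (ψ q).1.rep ∈ D ↔ q.1 ∈ F
      rw [hrep, hD.smul_mem_iff hc, ← rep_mem_cone, ← hxq]
      constructor
      · rintro ⟨u, ⟨-, hu⟩, hux⟩
        rwa [← show u = x q from Subtype.ext hux]
      · exact fun hq => ⟨x q, ⟨hxC q, hq⟩, rfl⟩
    · rintro ⟨T, hT, rfl⟩
      obtain ⟨G, hG, rfl⟩ := isClosed_induced_iff.1 hT
      let D : Set (hyperplane H ⧸ pole ω H) :=
        toQuotient ω H '' ((↑) ⁻¹' cone X ∩ (↑) ⁻¹' cone G)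
      have hD : IsCone D := by
        rintro t _ ⟨u, ⟨hu, huG⟩, rfl⟩
        exact ⟨t • u, ⟨hCU t u hu, isCone_cone G t _ huG⟩, map_smul _ _ _⟩
      have hDc : ZClosed D := h.zclosed_image Set.inter_subset_left
        (h.isLegendrianCone.zclosed_section.inter ((isClosed_iff_zclosed_cone.1 hG).preimage
          (isPolyMap_linear (hyperplane H).subtype)))
      refine ⟨{q | q.rep ∈ D}, isClosed_setOf_rep_mem hD hDc, ?_⟩
      ext q
      change q.1.rep ∈ D ↔ (ψ q).1 ∈ G
      rw [← hxq]
      constructor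
      · rintro ⟨u, ⟨hu, huG⟩, hux⟩
        rw [h.injOn hu (hxC q) hux] at huG
        exact huG (hx0 q)
      · exact fun hq => ⟨x q, ⟨hxC q, fun _ => hq⟩, rfl⟩
  refine topologicalKrullDim_add_one_le hind fun Z => ?_
  have hZ : IsIrreducible (ψ '' (Z : Set _)) := Z.isIrreducible.image ψ hind.continuous.continuousOn
  obtain ⟨Z', hZ', hsub⟩ := exists_mem_irreducibleComponents_subset_of_isIrreducible _ hZ
  have hZ'c := isClosed_of_mem_irreducibleComponents Z' hZ'
  refine ⟨⟨Z', hZ'.1, hZ'c⟩, lt_of_le_of_ne (closure_minimal hsub hZ'c) fun heq => ?_⟩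
  obtain ⟨p, hp, hep⟩ := hcomp Z' hZ'
  have heq' : closure (ψ '' (Z : Set _)) = Z' :=
    congrArg TopologicalSpace.IrreducibleCloseds.carrier heq
  -- the image of `ψ` is contained in the hyperplane
  have hHc : IsClosed (Subtype.val ⁻¹' {p : ℙ ℂ V | p.rep ∈ {v | ω e v = 0}} :
      Set (singularLocus X)) := by
    refine (isClosed_setOf_rep_mem (fun t v hv => ?_)
      (zclosed_zero (dual_mem_polyFun (ω e)))).preimage continuous_subtype_val
    change ω e (t • v) = 0
    rw [map_smul, show ω e v = 0 from hv, smul_zero]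
  have hsub' : closure (ψ '' (Z : Set _)) ⊆
      Subtype.val ⁻¹' {p : ℙ ℂ V | p.rep ∈ {v | ω e v = 0}} := by
    refine closure_minimal ?_ hHc
    rintro _ ⟨q, -, rfl⟩
    obtain ⟨c, -, hrep⟩ := hψrep q
    change ω e (ψ q).1.rep = 0
    rw [hrep, map_smul, (h.mem_iff _).1 (x q).2, smul_zero]
  rw [heq'] at hsub'
  exact hep (hsub' hp)

theorem projectsIsomorphically (h : IsGeneralHyperplane ω X n H e) {S : Set (ℙ ℂ (hyperplane H))}
    (hS : S ⊆ smoothLocus (hyperplaneSection X H)) :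
    ProjectsIsomorphically (toQuotient ω H) S (projImage (toQuotient ω H) S) := by
  obtain ⟨eU, heU, ⟨σ⟩⟩ := h.exists_lineSplitting
  refine σ.projectsIsomorphically h.isLegendrianCone.isCone_section
    h.isLegendrianCone.zclosed_section
    (fun he => h.isGeneralCenter.notMem_section h.isLegendrianCone (heU ▸ he)) h.injOn fun p hp => ?_
  obtain ⟨hpX, hpT⟩ := h.mem_smoothLocus_iff.1 (hS hp)
  have hpC := rep_mem_section.2 hpX
  exact ⟨hpC, h.isGeneralCenter.center_notMem_tangentSpace h.isLegendrianCone h.mem_iff heU hpC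
    p.rep_nonzero hpT⟩

/-- The projection is an isomorphism of the smooth locus of the section onto an open subset. -/
theorem exists_isOpen_projectsIsomorphically (h : IsGeneralHyperplane ω X n H e) :
    ∃ O : Set (ℙ ℂ (hyperplane H ⧸ pole ω H)), IsOpen[projZariski _] O ∧
      ProjectsIsomorphically (toQuotient ω H) (smoothLocus (hyperplaneSection X H))
        (projectedSection ω X H ∩ O) := by
  let _ := projZariski (hyperplane H ⧸ pole ω H)
  have hC := h.isLegendrianCone.isCone_section (U := hyperplane H)
  -- the complement of the open set is the image of the singular points of the section
  let N : Set (hyperplane H) := {x | x ∈ ((↑) ⁻¹' cone X : Set (hyperplane H)) ∧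
    (x = 0 ∨ Module.finrank ℂ (tangentSpace ((↑) ⁻¹' cone X : Set (hyperplane H)) x) ≠ n)}
  have hN : IsCone N := isCone_singular hC
  have hNc : ZClosed N := zclosed_singular h.isLegendrianCone.zclosed_section fun x hx =>
    (h.isGeneralCenter.hasDimAt_section h.isLegendrianCone h.mem_iff hx).le_finrank
  have hπN : IsCone (toQuotient ω H '' N) := by
    rintro t _ ⟨u, hu, rfl⟩
    exact ⟨t • u, hN t u hu, map_smul _ _ _⟩
  have hclosed := isClosed_setOf_rep_mem hπN (h.zclosed_image (fun x hx => hx.1) hNc)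
  refine ⟨{q | q.rep ∈ toQuotient ω H '' N}ᶜ, hclosed.isOpen_compl, ?_⟩
  have hrep : ∀ p ∈ hyperplaneSection X H, ∀ hp0 : toQuotient ω H p.rep ≠ 0,
      ((Projectivization.mk ℂ _ hp0).rep ∈ toQuotient ω H '' N ↔
        Module.finrank ℂ (tangentSpace ((↑) ⁻¹' cone X : Set (hyperplane H)) p.rep) ≠ n) := by
    intro p hp hp0
    obtain ⟨c, hc, hr⟩ := exists_smul_rep hp0
    rw [hr, hπN.smul_mem_iff hc]
    constructor
    · rintro ⟨u, hu, hup⟩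
      have := h.injOn hu.1 (rep_mem_section.2 hp) hup
      rw [this] at hu
      exact hu.2.resolve_left p.rep_nonzero
    · exact fun hT => ⟨p.rep, ⟨rep_mem_section.2 hp, Or.inr hT⟩, rfl⟩
  have heq : projectedSection ω X H ∩ {q | q.rep ∈ toQuotient ω H '' N}ᶜ =
      projImage (toQuotient ω H) (smoothLocus (hyperplaneSection X H)) := by
    ext q
    constructor
    · rintro ⟨⟨p, hp, hp0, rfl⟩, hq⟩
      refine ⟨p, h.mem_smoothLocus_iff.2 ⟨hp, ?_⟩, hp0, rfl⟩
      by_contra hT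
      exact hq ((hrep p hp hp0).2 hT)
    · rintro ⟨p, hp, hp0, rfl⟩
      obtain ⟨hpX, hpT⟩ := h.mem_smoothLocus_iff.1 hp
      exact ⟨⟨p, hpX, hp0, rfl⟩, fun hq => (hrep p hpX hp0).1 hq hpT⟩
  rw [heq]
  exact h.projectsIsomorphically subset_rfl

/-- If the hyperplane contains no singular point of `X`, then the section is smooth. -/
theorem smoothLocus_eq (h : IsGeneralHyperplane ω X n H e)
    (hsing : ∀ p ∈ singularLocus X, ω e p.rep ≠ 0) :
    smoothLocus (hyperplaneSection X H) = hyperplaneSection X H := by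
  ext p
  rw [h.mem_smoothLocus_iff, and_iff_left_iff_imp]
  intro hp
  have hpC := rep_mem_section.2 hp
  have hp0 : (p.rep : V) ≠ 0 := fun h0 => p.rep_nonzero (Subtype.ext h0)
  obtain ⟨c, hc, hrep⟩ := exists_smul_rep hp0
  refine h.isGeneralCenter.finrank_tangentSpace_section h.isSymplectic h.isLegendrianCone
    h.finrank_eq h.mem_iff hpC p.rep_nonzero ?_
  rw [← h.isLegendrianCone.isCone.tangentSpace_smul hc, ← hrep, ← h.isSmoothAt_iff (hpC hp0)]
  by_contra hs
  refine hsing _ ⟨hpC hp0, hs⟩ ?_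
  rw [hrep, map_smul, (h.mem_iff _).1 p.rep.2, smul_zero]

end IsGeneralHyperplane
end GeneralSection

end LegendrianSection

theorem theorem1p1 {V : Type*} [AddCommGroup V] [Module ℂ V] (n : ℕ)
    (hdim : Module.finrank ℂ V = 2 * n + 2)
    (ω : LinearMap.BilinForm ℂ V) (hω : IsSymplectic ω)
    (X : Set (ℙ ℂ V)) (hX : IsLegendrian ω X)
    (hirr : @IsIrreducible _ (projZariski V) X) :
    -- the case of a smooth variety, or one with isolated singularities
    ((singularLocus X).Finite →
      ForGeneralHyperplane fun H : ℙ ℂ (Module.Dual ℂ V) =>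
        Module.finrank ℂ
          (hyperplane H ⧸ pole ω H) = 2 * n ∧
        IsSymplectic (reducedForm ω hω.alt H) ∧
        singularLocus (hyperplaneSection X H) = ∅ ∧
        ProjectsIsomorphically (toQuotient ω H)
          (hyperplaneSection X H) (projectedSection ω X H) ∧
        IsLegendrian (reducedForm ω hω.alt H)
          (projectedSection ω X H)) ∧
    -- the general case
    (ForGeneralHyperplane fun H : ℙ ℂ (Module.Dual ℂ V) =>
      Module.finrank ℂ
        (hyperplane H ⧸ pole ω H) = 2 * n ∧
      IsSymplectic (reducedForm ω hω.alt H) ∧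
      (∀ p ∈ hyperplaneSection X H,
        toQuotient ω H p.rep ≠ 0) ∧
      IsLegendrian (reducedForm ω hω.alt H)
        (projectedSection ω X H) ∧
      dimOf (projZariski _)
          (singularLocus (projectedSection ω X H)) + 1 ≤
        dimOf (projZariski V)
          (singularLocus X) ∧
      ∃ O : Set (ℙ ℂ (hyperplane H ⧸ pole ω H)),
        IsOpen[projZariski _] O ∧
        ProjectsIsomorphically (toQuotient ω H)
          (smoothLocus (hyperplaneSection X H))
          (projectedSection ω X H ∩ O)) := by
  have hfd : FiniteDimensional ℂ V := Module.finite_of_finrank_pos (by omega)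
  have hgen : ∀ {H e}, e ≠ 0 → (∀ x, x ∈ hyperplane H ↔ ω e x = 0) →
      IsGeneralCenter ω (cone X) n e → IsGeneralHyperplane ω X n H e := fun he hH hc =>
    ⟨hω, isLegendrianCone_cone hω hX hirr hdim, hdim, hc, he, hH⟩
  constructor
  · intro hfin
    refine forGeneralHyperplane_of_isGeneralCenter hω hX hirr hdim
      (hfin.image Projectivization.rep) ?_ fun H e he hH hc hF => ?_
    · rintro ⟨p, -, hp⟩
      exact p.rep_nonzero hp
    · have h := hgen he hH hc
      have hs := h.smoothLocus_eq fun p hp => hF _ ⟨p, hp, rfl⟩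
      refine ⟨h.finrank_quotient, isSymplectic_reducedForm hω, ?_,
        h.projectsIsomorphically hs.ge, h.isLegendrian⟩
      refine Set.eq_empty_of_forall_notMem fun p hp => hp.2 ?_
      have : p ∈ smoothLocus (hyperplaneSection X H) := hs.symm ▸ hp.1
      exact this.2
  · obtain ⟨F, hF, hF0, hcomp⟩ := exists_finite_points_components (singularLocus X)
    refine forGeneralHyperplane_of_isGeneralCenter hω hX hirr hdim hF hF0 fun H e he hH hc hFe => ?_
    have h := hgen he hH hc
    exact ⟨h.finrank_quotient, isSymplectic_reducedForm hω, fun p hp => h.toQuotient_rep_ne_zero hp,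
      h.isLegendrian, h.dimOf_singularLocus (hcomp (ω e) hFe), h.exists_isOpen_projectsIsomorphically⟩
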